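/- **Setting.** Let $(\Omega,d)$ be a connected metric space with a separable, nonatomic Borel probability measure $\mu$. Let $Lip(\Omega)$ be the class of functions $f:\Omega\to\mathbb R$ that are Lipschitz on every ball, put $|\nabla f|(x)=\limsup_{y\to x,\,y\ne x}|f(x)-f(y)|/d(x,y)$ (and $0$ at isolated points), and assume, as a standing condition on the space, that for all $f\in Lip(\Omega)$ and $c\in\mathbb R$ one has $|\nabla f|=0$ a.e. on $\{f=c\}$. For Borel $A$ let $\mu^+(A)=\liminf_{h\to0+}(\mu(A_h)-\mu(A))/h$, where $A_h=\{x:d(x,A)<h\}$. Let $I:[0,1]\to[0,\infty)$ be an isoperimetric estimator: $I$ is continuous, concave, increasing on $(0,1/2)$, symmetric about $1/2$, $I(0)=0$, $I>0$ on $(0,1)$, and $\mu^+(A)\ge I(\mu(A))$ for all Borel $A$. For measurable $u$ on $\Omega$ let $u^*(s)=\inf\{t\ge0:\mu\{|u|>t\}\le s\}$ and $u^{**}(t)=\frac1t\int_0^tu^*(s)\,ds$. Let $X,Y$ be rearrangement invariant Banach function spaces on $\Omega$ (with the Fatou property), and let $\bar X,\bar Y$ be their representations on $(0,1)$, so that $\|u\|_X=\|u^*\|_{\bar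 X}$ and $\|u\|_Y=\|u^*\|_{\bar Y}$. Let $\overline\alpha_X=\inf_{s>1}\ln h_X(s)/\ln s$ be the upper Boyd index, where $h_X(s)$ is the norm on $\bar X$ of the dilation operator $E_sf(t)=f^*(t/s)\chi_{(0,s)}(t)$. Put $\|u\|_{LS(X)}=\big\|(u^{**}(t)-u^*(t))\frac{I(t)}t\big\|_{\bar X}$. **Theorem.** Let $Q_If(t)=\int_t^1f(s)\frac{ds}{I(s)}$, and suppose that there is a constant $C$ such that $\|Q_If\|_{\bar Y}\le C\|f\|_{\bar X}$ for all nonnegative $f\in\bar X$ that are supported in $(0,1/2)$. Then every $g\in Lip(\Omega)$ with $|\nabla g|\in X$ is integrable, and there is a constant $K$ such that for all integrable $g\in Lip(\Omega)$ $$\Big\|g-\int_\Omega g\,d\mu\Big\|_Y\le K\,\big\||\nabla g|\big\|_X .$$ Moreover: (a) If the operator $\tilde Q_If(t)=\frac{I(t)}t\int_t^{1/2}f(s)\frac{ds}{I(s)}$ (understood as $0$ for $t\ge1/2$) is bounded on $\bar X$, then there is a constant $K$ such that for all integrable $g\in Lip(\Omega)$ $$\Big\|g-\int_\Omega g\,d\mu\Big\|_Y\le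 K\,\Big\|\Big(g-\int_\Omega g\,d\mu\Big)^{*}(t)\,\frac{I(t)}t\Big\|_{\bar X}\quad\text{and}\quad\Big\|\Big(g-\int_\Omega g\,d\mu\Big)^{*}(t)\,\frac{I(t)}t\Big\|_{\bar X}\le K\,\big\||\nabla g|\big\|_X .$$ (b) If $\overline\alpha_X<1$, or if there is a constant $c>0$ such that $\int_t^1\frac{I(s)}{s}\frac{ds}{s}\le c\,\frac{I(t)}t$ for all $t\in(0,1)$, then there is a constant $K$ such that for all integrable $g\in Lip(\Omega)$ $$\Big\|g-\int_\Omega g\,d\mu\Big\|_Y\le K\Big(\Big\|g-\int_\Omega g\,d\mu\Big\|_{LS(X)}+\Big\|g-\int_\Omega g\,d\mu\Big\|_{L^1}\Big)$$ and $$\Big\|g-\int_\Omega g\,d\mu\Big\|_{LS(X)}+\Big\|g-\int_\Omega g\,d\mu\Big\|_{L^1}\le K\,\big\||\nabla g|\big\|_X .$$ The constants $K$ do not depend on $g$. -/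

import Mathlib

open MeasureTheory Set Filter Topology
open scoped ENNReal NNReal

noncomputable section

/-! Decreasing rearrangements. Measurable functions enter through their absolute values, as
functions with values in `[0, ∞]`. -/

/-- The decreasing rearrangement `f^*(s) = inf {t ≥ 0 : μ {f > t} ≤ s}` of `f ≥ 0`. -/
def rearr {α : Type*} [MeasurableSpace α] (μ : Measure α) (f : α → ℝ≥0∞) (s : ℝ) : ℝ≥0∞ :=
  sInf {t : ℝ≥0∞ | μ {x | t < f x} ≤ ENNReal.ofReal s}

/-- The maximal average `f^{**}(t) = (1/t) ∫_0^t f^*(s) ds`. -/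
def rearrAvg {α : Type*} [MeasurableSpace α] (μ : Measure α) (f : α → ℝ≥0∞) (t : ℝ) : ℝ≥0∞ :=
  (∫⁻ s in Ioo 0 t, rearr μ f s) / ENNReal.ofReal t

/-- Lebesgue measure on the interval `(0, 1)`. -/
def unitVol : Measure ℝ := volume.restrict (Ioo 0 1)

theorem lt_rearr_iff {Ω : Type*} [MeasurableSpace Ω] {μ : Measure Ω}
    (f : Ω → ℝ≥0∞) (t : ℝ≥0∞) (s : ℝ) :
    t < rearr μ f s ↔ ENNReal.ofReal s < μ {x | t < f x} := by
  constructor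
  · intro h
    by_contra hc
    exact absurd (sInf_le (by simpa using hc)) (not_le.2 h)
  · intro h
    have hU : {x | t < f x} = ⋃ n : ℕ, {x | t + ((n : ℝ≥0∞) + 1)⁻¹ < f x} := by
      ext x
      simp only [mem_ofPred_eq, mem_iUnion]
      constructor
      · intro hx
        have hd : 0 < f x - t := by simpa using hx
        obtain ⟨n, hn⟩ := ENNReal.exists_inv_nat_lt hd.ne'
        refine ⟨n, ?_⟩
        have h2 : ((n : ℝ≥0∞) + 1)⁻¹ < f x - t :=
          lt_of_le_of_lt (ENNReal.inv_le_inv.2 le_self_add) hn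
        exact lt_tsub_iff_left.1 h2
      · rintro ⟨n, hn⟩
        exact lt_of_le_of_lt le_self_add hn
    have hm : Monotone fun n : ℕ => {x | t + ((n : ℝ≥0∞) + 1)⁻¹ < f x} := by
      intro a b hab x hx
      refine lt_of_le_of_lt ?_ (show t + ((a : ℝ≥0∞) + 1)⁻¹ < f x from hx)
      gcongr
    rw [hU, hm.measure_iUnion, lt_iSup_iff] at h
    obtain ⟨n, hn⟩ := h
    have htop : t ≠ ∞ := by
      rintro rfl
      simp at hn
    refine lt_of_lt_of_le (ENNReal.lt_add_right htop (b := ((n : ℝ≥0∞) + 1)⁻¹) (by simp)) ?_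
    refine le_sInf fun u hu => ?_
    by_contra hc
    refine absurd hn (not_lt.2 (le_trans (measure_mono ?_) hu))
    intro x hx
    exact lt_trans (not_le.1 hc) hx

/-- `f` and `f^*` are equimeasurable. -/
theorem equimeas_rearr {Ω : Type*} [MeasurableSpace Ω] {μ : Measure Ω} [IsProbabilityMeasure μ]
    (f : Ω → ℝ≥0∞) (t : ℝ≥0∞) :
    μ {x | t < f x} = unitVol {s | t < rearr μ f s} := by
  simp only [lt_rearr_iff]
  have h1 : μ {x | t < f x} ≤ 1 := prob_le_one
  set a := μ {x | t < f x}
  have ha : a ≠ ∞ := ne_top_of_le_ne_top ENNReal.one_ne_top h1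
  have ha1 : a.toReal ≤ 1 := by
    simpa using ENNReal.toReal_mono ENNReal.one_ne_top h1
  rw [unitVol, Measure.restrict_apply' measurableSet_Ioo]
  have : {s | ENNReal.ofReal s < a} ∩ Ioo (0:ℝ) 1 = Ioo 0 a.toReal := by
    ext s
    simp only [mem_inter_iff, mem_ofPred_eq, mem_Ioo]
    constructor
    · rintro ⟨h, h0, -⟩
      exact ⟨h0, (ENNReal.ofReal_lt_iff_lt_toReal h0.le ha).1 h⟩
    · rintro ⟨h0, h⟩
      exact ⟨(ENNReal.ofReal_lt_iff_lt_toReal h0.le ha).2 h, h0, by linarith⟩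
  rw [this]; simp [ha]

/-! Rearrangement invariant spaces. -/

/-- A rearrangement invariant Banach function space over a probability space, given by its
function norm (with value `∞` outside of the space) on nonnegative measurable functions. The
space consists of the measurable `u` for which the norm of `|u|` is finite. On a probability
space, `norm_one` and `embed` say that `L^∞ ⊆ X ⊆ L^1`. -/
structure RISpace {Ω : Type*} [MeasurableSpace Ω] (μ : Measure Ω) where
  norm : (Ω → ℝ≥0∞) → ℝ≥0∞
  norm_eq_zero : ∀ f, AEMeasurable f μ → (norm f = 0 ↔ f =ᵐ[μ] 0)
  norm_smul : ∀ (c : ℝ≥0) (f), AEMeasurable f μ → norm (fun x => c * f x) = c * norm f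
  norm_add : ∀ f g, AEMeasurable f μ → AEMeasurable g μ →
    norm (fun x => f x + g x) ≤ norm f + norm g
  norm_mono : ∀ f g, AEMeasurable f μ → AEMeasurable g μ → f ≤ᵐ[μ] g → norm f ≤ norm g
  fatou : ∀ f : ℕ → Ω → ℝ≥0∞, (∀ n, AEMeasurable (f n) μ) → Monotone f →
    norm (fun x => ⨆ n, f n x) = ⨆ n, norm (f n)
  norm_one : norm (fun _ => 1) < ∞
  embed : ∃ C : ℝ≥0, ∀ f, AEMeasurable f μ → ∫⁻ x, f x ∂μ ≤ C * norm f
  rearrangement_invariant : ∀ f g, AEMeasurable f μ → AEMeasurable g μ →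
    (∀ t, μ {x | t < f x} = μ {x | t < g x}) → norm f = norm g

namespace RISpace

variable {Ω : Type*} [MeasurableSpace Ω] {μ : Measure Ω}

/-- The norm of the representation `X̄` of `X` on the interval `(0, 1)`: the norm of `h` is the
norm in `X` of any function on `Ω` that is equimeasurable with `h`. All these functions have the
same norm, and over a nonatomic probability space they exist. -/
def bar (X : RISpace μ) (h : ℝ → ℝ≥0∞) : ℝ≥0∞ :=
  ⨅ (f : Ω → ℝ≥0∞) (_ : AEMeasurable f μ ∧ ∀ t, μ {x | t < f x} = unitVol {s | t < h s}),
    X.norm f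

/-- The representation property `‖f^*‖_X̄ = ‖f‖_X`. -/
theorem bar_rearr [IsProbabilityMeasure μ] (X : RISpace μ) (f : Ω → ℝ≥0∞)
    (hf : AEMeasurable f μ) :
    X.bar (rearr μ f) = X.norm f := by
  apply le_antisymm
  · exact iInf₂_le f ⟨hf, equimeas_rearr f⟩
  · refine le_iInf₂ fun g hg => ?_
    refine le_of_eq (X.rearrangement_invariant f g hf hg.1 fun t => ?_)
    rw [hg.2 t, equimeas_rearr f t]

/-- The dilation `E_s h (t) = h^*(t / s)` for `0 < t < s`, and `0` for `s < t < 1`. -/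
def dilation (s : ℝ) (h : ℝ → ℝ≥0∞) (t : ℝ) : ℝ≥0∞ :=
  (Ioo 0 s).indicator (fun t => rearr unitVol h (t / s)) t

/-- The norm of the dilation operator `E_s` on `X̄`. -/
def dilationNorm (X : RISpace μ) (s : ℝ) : ℝ≥0∞ :=
  ⨆ (h : ℝ → ℝ≥0∞) (_ : Measurable h ∧ X.bar h ≤ 1), X.bar (dilation s h)

/-- The upper Boyd index `inf_{s > 1} ln h_X(s) / ln s`. -/
def upperBoydIndex (X : RISpace μ) : ℝ :=
  sInf ((fun s : ℝ => Real.log (X.dilationNorm s).toReal / Real.log s) '' Ioi 1)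

end RISpace

/-! Metric probability spaces. -/

section Metric

variable {Ω : Type*} [MetricSpace Ω]

/-- The class `Lip(Ω)` of functions that are Lipschitz on every ball. -/
def IsLip (f : Ω → ℝ) : Prop :=
  ∀ x r, ∃ K : ℝ≥0, LipschitzOnWith K f (Metric.ball x r)

/-- The modulus of the gradient, `limsup_{y → x, y ≠ x} |f x - f y| / d (x, y)`. It is `0` at
isolated points, where the punctured neighbourhood filter is trivial. -/
def gradNorm (f : Ω → ℝ) (x : Ω) : ℝ≥0∞ :=
  limsup (fun y => edist (f x) (f y) / edist x y) (𝓝[≠] x)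

variable [MeasurableSpace Ω]

/-- The Minkowski content `μ⁺(A) = liminf_{h → 0+} (μ(A_h) - μ(A)) / h`. -/
def minkowskiContent (μ : Measure Ω) (A : Set Ω) : ℝ≥0∞ :=
  liminf (fun h : ℝ => (μ (Metric.thickening h A) - μ A) / ENNReal.ofReal h) (𝓝[>] 0)

/-- The isoperimetric profile: the largest function with `μ⁺(A) ≥ I(μ(A))` for all Borel `A`. -/
def isoperimetricProfile (μ : Measure Ω) (t : ℝ) : ℝ≥0∞ :=
  ⨅ (A : Set Ω) (_ : MeasurableSet A ∧ μ A = ENNReal.ofReal t), minkowskiContent μ A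

/-- Isoperimetric estimators. The field `pos` excludes only the zero function, which is
"increasing on `(0, 1/2)`" in the weak sense alone. -/
structure IsIsoperimetricEstimator (μ : Measure Ω) (I : ℝ → ℝ) : Prop where
  continuousOn : ContinuousOn I (Icc 0 1)
  concaveOn : ConcaveOn ℝ (Icc 0 1) I
  monotoneOn : MonotoneOn I (Ioo 0 (1 / 2))
  symm : ∀ t ∈ Icc (0 : ℝ) 1, I (1 - t) = I t
  zero : I 0 = 0
  pos : ∀ t ∈ Ioo (0 : ℝ) 1, 0 < I t
  le_profile : ∀ t ∈ Icc (0 : ℝ) 1, ENNReal.ofReal (I t) ≤ isoperimetricProfile μ t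

/-- The standing assumptions on a metric probability space: it is connected, the probability
measure `μ` is separable (concentrated on a separable set) and nonatomic, and the gradient of a
function in `Lip(Ω)` vanishes a.e. on each level set of the function. -/
structure IsMetricProbabilitySpace (μ : Measure Ω) : Prop where
  connected : ConnectedSpace Ω
  probability : IsProbabilityMeasure μ
  separable : ∃ S : Set Ω, TopologicalSpace.IsSeparable S ∧ μ Sᶜ = 0
  nonatomic : NullSingletonClass μ
  grad_level : ∀ f : Ω → ℝ, IsLip f → ∀ c : ℝ, ∀ᵐ x ∂μ, f x = c → gradNorm f x = 0

end Metric

/-! Isoperimetric Hardy operators, on nonnegative functions on `(0, 1)`. -/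

/-- `Q_I f (t) = ∫_t^1 f(s) ds / I(s)`. -/
def hardyQ (I : ℝ → ℝ) (f : ℝ → ℝ≥0∞) (t : ℝ) : ℝ≥0∞ :=
  ∫⁻ s in Ioo t 1, f s / ENNReal.ofReal (I s)

/-- `Q̃_I f (t) = (I(t) / t) ∫_t^{1/2} f(s) ds / I(s)`, which is `0` for `t ≥ 1/2`. -/
def hardyQTilde (I : ℝ → ℝ) (f : ℝ → ℝ≥0∞) (t : ℝ) : ℝ≥0∞ :=
  ENNReal.ofReal (I t / t) * ∫⁻ s in Ioo t (1 / 2), f s / ENNReal.ofReal (I s)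

/-- The condition `∫_t^1 I(s) / s² ds ≤ c I(t) / t` for `t ∈ (0, 1)`. -/
def HasIntegralCondition (I : ℝ → ℝ) : Prop :=
  ∃ c > 0, ∀ t ∈ Ioo (0 : ℝ) 1, (∫ s in t..1, I s / s / s) ≤ c * (I t / t)

namespace RISpace

variable {Ω : Type*} [MeasurableSpace Ω] {μ : Measure Ω}

/-- The norm of the real function `u` in `X`. -/
def fnNorm (X : RISpace μ) (u : Ω → ℝ) : ℝ≥0∞ :=
  X.norm (fun x => ‖u x‖ₑ)

/-- `‖u^*(t) I(t) / t‖_X̄`. -/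
def weightedNorm (X : RISpace μ) (I : ℝ → ℝ) (u : Ω → ℝ) : ℝ≥0∞ :=
  X.bar (fun t => rearr μ (fun x => ‖u x‖ₑ) t * ENNReal.ofReal (I t / t))

/-- `‖u‖_{LS(X)} = ‖(u^{**}(t) - u^*(t)) I(t) / t‖_X̄`. -/
def lsNorm (X : RISpace μ) (I : ℝ → ℝ) (u : Ω → ℝ) : ℝ≥0∞ :=
  X.bar (fun t => (rearrAvg μ (fun x => ‖u x‖ₑ) t - rearr μ (fun x => ‖u x‖ₑ) t) *
    ENNReal.ofReal (I t / t))

end RISpace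

/-- The function `u - ∫ u dμ`. -/
def centered {Ω : Type*} [MeasurableSpace Ω] (μ : Measure Ω) (u : Ω → ℝ) (x : Ω) : ℝ :=
  u x - ∫ y, u y ∂μ

end

noncomputable section

/-! The engine is a coarea inequality: for $f\in Lip(\Omega)$, $\int_a^b
I(\mu\{f>t\})\,dt\le\int_{\{a<f<b\}}|\nabla f|\,d\mu$. It comes from $\mu^+\ge I(\mu)$ by the layer
cake formula and Fatou, and the standing condition on level sets removes $\{f=a\}$ and $\{f=b\}$
(`IsIsoperimetricEstimator.lintegral_le_setLIntegral_gradNorm`).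

Let $f\ge0$ vanish on half of the space. Between the levels $f^*(2^{-j})$ and $f^*(2^{-j-1})$,
$j\ge1$, the distribution function is at least $2^{-j-1}$ and at most $2^{-j}\le1/2$, so
$f^*(2^{-j-1})-f^*(2^{-j})\le\gamma_j/I(2^{-j-1})$, where $\gamma_j$ is the integral of $|\nabla f|$
over the band between these levels. Summation gives $f^*(t)\le c+\int_t^{1/2}\varphi\,ds/I(s)$,
where $\varphi$ is a step function built from the numbers $2^j\gamma_j$
(`rearr_le_lintegral_hardyMajorant`). No differentiation of $f^*$ is needed. The bands are disjoint
and the $j$-th has measure at most $2^{-j}$, so $\varphi$ is up to a factor dominated by an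
averaging of $|\nabla f|$, and $\|\varphi\|_{\bar X}\le4\||\nabla f|\|_X$. That averaging does not
increase the norm is seen by approximating a mean by many rotations of the circle, each of which
preserves the distribution (`RISpace.bar_dyadicGlue_setAverage_le`).

The hypothesis on $Q_I$ now bounds $\|f\|_Y$. A general $g$ is split at a median, $|g-m|=f_1+f_2$,
and $Y\subseteq L^1$ controls both the integrability of $g$ and the distance from the median to the
mean.

For (a), multiplication of the bound for $f^*$ by $I(t)/t$ turns the Hardy integral into $\tilde
Q_I\varphi$. Conversely $Q_I$ applied to $f^*I/t$ at $s$ is at least $f^*(2s)/2$. For (b),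
$r(f^{**}(r)-f^*(r))$ is nondecreasing, which bounds dyadic increments of $f^*$ by
$\int(f^{**}-f^*)\,ds/s$, a value of $Q_I$ on the oscillation. In the other direction either
$(f^{**}-f^*)I/t\le|\nabla f|^{**}$ and a Boyd index below $1$ bounds the averages, or the integral
condition makes $I(t)/t$ grow geometrically along dyadic points, and a series of dilated band
averages converges. -/

instance : IsProbabilityMeasure unitVol := ⟨by simp [unitVol]⟩

/-! ### Decreasing rearrangements and their averages. -/

section Rearrangement

variable {Ω : Type*} [MeasurableSpace Ω] {μ : Measure Ω}

theorem rearr_antitone (f : Ω → ℝ≥0∞) : Antitone (rearr μ f) := by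
  intro s t hst
  refine sInf_le_sInf fun u hu => le_trans hu (ENNReal.ofReal_le_ofReal hst)

theorem measurable_rearr (f : Ω → ℝ≥0∞) : Measurable (rearr μ f) :=
  (rearr_antitone f).measurable

theorem measure_rearr_lt_le (f : Ω → ℝ≥0∞) (s : ℝ) :
    μ {x | rearr μ f s < f x} ≤ ENNReal.ofReal s :=
  not_lt.1 fun h => lt_irrefl _ ((lt_rearr_iff f _ s).2 h)

theorem rearr_le_iff (f : Ω → ℝ≥0∞) (t : ℝ≥0∞) (s : ℝ) :
    rearr μ f s ≤ t ↔ μ {x | t < f x} ≤ ENNReal.ofReal s := by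
  rw [← not_lt, lt_rearr_iff, not_lt]

theorem rearr_le_of_distr {α : Type*} [MeasurableSpace α] {ν : Measure α} {f : Ω → ℝ≥0∞}
    {g : α → ℝ≥0∞} (h : ∀ t, μ {x | t < f x} ≤ ν {x | t < g x}) (s : ℝ) :
    rearr μ f s ≤ rearr ν g s :=
  (rearr_le_iff _ _ _).2 ((h _).trans (measure_rearr_lt_le g s))

theorem rearr_mono {f g : Ω → ℝ≥0∞} (h : f ≤ g) (s : ℝ) : rearr μ f s ≤ rearr μ g s :=
  rearr_le_of_distr (fun _ => measure_mono fun x hx => lt_of_lt_of_le hx (h x)) s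

theorem map_eq_of_equimeas {α : Type*} [MeasurableSpace α] {ν : Measure α}
    [IsProbabilityMeasure μ] [IsProbabilityMeasure ν] {f : Ω → ℝ≥0∞} {g : α → ℝ≥0∞}
    (hf : Measurable f) (hg : Measurable g) (h : ∀ t, μ {x | t < f x} = ν {x | t < g x}) :
    μ.map f = ν.map g := by
  have := Measure.isFiniteMeasure_map μ f
  refine Measure.ext_of_Iic _ _ fun a => ?_
  have e : (Iic a : Set ℝ≥0∞) = (Ioi a)ᶜ := by simp
  rw [e, Measure.map_apply hf measurableSet_Ioi.compl, Measure.map_apply hg measurableSet_Ioi.compl,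
    preimage_compl, preimage_compl, prob_compl_eq_one_sub (hf measurableSet_Ioi),
    prob_compl_eq_one_sub (hg measurableSet_Ioi)]
  exact congrArg _ (h a)

/-- $f$ and $f^*$ have the same law. A general $\Phi$ is kept so that truncations $y\mapsto y-c$ can
be integrated. -/
theorem lintegral_comp_rearr [IsProbabilityMeasure μ] {f : Ω → ℝ≥0∞} (hf : Measurable f)
    {Φ : ℝ≥0∞ → ℝ≥0∞} (hΦ : Measurable Φ) :
    ∫⁻ s in Ioo (0 : ℝ) 1, Φ (rearr μ f s) = ∫⁻ x, Φ (f x) ∂μ := by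
  rw [← lintegral_map hΦ hf, map_eq_of_equimeas hf (measurable_rearr f) (equimeas_rearr f),
    lintegral_map hΦ (measurable_rearr f), unitVol]

theorem lintegral_rearr [IsProbabilityMeasure μ] {f : Ω → ℝ≥0∞} (hf : Measurable f) :
    ∫⁻ s in Ioo (0 : ℝ) 1, rearr μ f s = ∫⁻ x, f x ∂μ :=
  lintegral_comp_rearr hf measurable_id

/-- Where $u$ exceeds the right side, $f$ or $g$ exceeds its own level at $t/2$, and each of these
sets has measure at most $t/2$. -/
theorem rearr_add_le {u f g : Ω → ℝ≥0∞} {c : ℝ≥0∞} (h : ∀ x, u x ≤ f x + g x + c) {t : ℝ}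
    (ht : 0 ≤ t) : rearr μ u t ≤ rearr μ f (t / 2) + rearr μ g (t / 2) + c := by
  rw [rearr_le_iff]
  have hs : {x | rearr μ f (t / 2) + rearr μ g (t / 2) + c < u x} ⊆
      {x | rearr μ f (t / 2) < f x} ∪ {x | rearr μ g (t / 2) < g x} := by
    intro x hx
    by_contra hc
    simp only [mem_union, mem_ofPred_eq, not_or, not_lt] at hc
    refine absurd (lt_of_lt_of_le hx (h x)) (not_lt.2 ?_)
    gcongr
    exacts [hc.1, hc.2]
  refine (measure_mono hs).trans ((measure_union_le _ _).trans ?_)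
  refine (add_le_add (measure_rearr_lt_le f _) (measure_rearr_lt_le g _)).trans ?_
  rw [← ENNReal.ofReal_add (by linarith) (by linarith), add_halves]

theorem rearr_eq_zero {f : Ω → ℝ≥0∞} {s : ℝ} (h : μ {x | f x ≠ 0} ≤ ENNReal.ofReal s) :
    rearr μ f s = 0 := by
  rw [← nonpos_iff_eq_zero, rearr_le_iff]
  simpa [pos_iff_ne_zero] using h

theorem rearr_lt_top [IsProbabilityMeasure μ] {f : Ω → ℝ≥0∞} (hf : Measurable f)
    (h : ∀ x, f x ≠ ∞) {s : ℝ} (hs : 0 < s) : rearr μ f s < ∞ := by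
  have hT : Tendsto (μ ∘ fun n : ℕ => {x | (n : ℝ≥0∞) < f x}) atTop
      (𝓝 (μ (⋂ n : ℕ, {x | (n : ℝ≥0∞) < f x}))) := by
    refine tendsto_measure_iInter_atTop
      (fun n => (measurableSet_lt measurable_const hf).nullMeasurableSet) ?_
      ⟨0, measure_ne_top _ _⟩
    intro a b hab x hx
    exact lt_of_le_of_lt (b := (b : ℝ≥0∞)) (by exact_mod_cast hab) hx
  have he : (⋂ n : ℕ, {x | (n : ℝ≥0∞) < f x}) = ∅ := by
    ext x
    simp only [mem_iInter, mem_ofPred_eq, mem_empty_iff_false, iff_false, not_forall, not_lt]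
    obtain ⟨n, hn⟩ := ENNReal.exists_nat_gt (h x)
    exact ⟨n, hn.le⟩
  rw [he, measure_empty] at hT
  obtain ⟨n, hn⟩ := (hT.eventually_lt_const (ENNReal.ofReal_pos.2 hs)).exists
  exact lt_of_le_of_lt ((rearr_le_iff f n s).2 hn.le) (ENNReal.natCast_lt_top n)

/-- The Hardy–Littlewood inequality `∫_E f ≤ ∫_0^{μ E} f^*`. -/
theorem setLIntegral_le_rearr [IsProbabilityMeasure μ] {f : Ω → ℝ≥0∞} (hf : Measurable f)
    {E : Set Ω} (hE : MeasurableSet E) {t : ℝ} (ht : μ E ≤ ENNReal.ofReal t) :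
    ∫⁻ x in E, f x ∂μ ≤ ∫⁻ s in Ioo 0 t, rearr μ f s := by
  rw [← lintegral_indicator hE, ← lintegral_rearr (hf.indicator hE)]
  -- The function $f\chi_E$ lives on a set of measure at most $t$, so its rearrangement lives on
  -- $(0,t)$.
  have h0 : ∀ s, t ≤ s → rearr μ (E.indicator f) s = 0 := fun s hs => by
    refine rearr_eq_zero (le_trans (measure_mono ?_) (ht.trans (ENNReal.ofReal_le_ofReal hs)))
    intro x hx
    by_contra hc
    exact hx (by simp [hc])
  rw [← lintegral_indicator measurableSet_Ioo, ← lintegral_indicator measurableSet_Ioo]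
  refine lintegral_mono fun s => ?_
  by_cases hs : s ∈ Ioo (0 : ℝ) 1
  · rw [indicator_of_mem hs]
    rcases lt_or_ge s t with hst | hst
    · rw [indicator_of_mem (show s ∈ Ioo 0 t from ⟨hs.1, hst⟩)]
      exact rearr_mono (indicator_le_self _ _) s
    · rw [h0 s hst]; exact zero_le
  · rw [indicator_of_notMem hs]; exact zero_le

theorem measurable_rearrAvg (f : Ω → ℝ≥0∞) : Measurable (rearrAvg μ f) := by
  refine Measurable.div (Monotone.measurable fun s t hst => ?_) ENNReal.measurable_ofReal
  exact lintegral_mono_set (Ioo_subset_Ioo_right hst)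

theorem rearr_le_rearrAvg (f : Ω → ℝ≥0∞) {t : ℝ} (ht : 0 < t) :
    rearr μ f t ≤ rearrAvg μ f t := by
  rw [rearrAvg, ENNReal.le_div_iff_mul_le (by simp [ht]) (by simp)]
  calc rearr μ f t * ENNReal.ofReal t = ∫⁻ s in Ioo 0 t, rearr μ f t := by simp
    _ ≤ _ := setLIntegral_mono (measurable_rearr f) fun s hs => rearr_antitone f hs.2.le

theorem rearrAvg_le [IsProbabilityMeasure μ] {f : Ω → ℝ≥0∞} (hf : Measurable f) {t : ℝ}
    (ht : t ≤ 1) : rearrAvg μ f t ≤ (∫⁻ x, f x ∂μ) / ENNReal.ofReal t := by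
  rw [← lintegral_rearr hf]
  exact ENNReal.div_le_div_right (lintegral_mono_set (Ioo_subset_Ioo_right ht)) _

/-- `t (f^{**}(t) - f^*(t)) = ∫_0^t (f^*(s) - f^*(t)) ds`. -/
theorem mul_rearrAvg_sub (f : Ω → ℝ≥0∞) {t : ℝ} (ht : 0 < t) (hfin : rearr μ f t ≠ ∞) :
    ENNReal.ofReal t * (rearrAvg μ f t - rearr μ f t) =
      ∫⁻ s in Ioo 0 t, (rearr μ f s - rearr μ f t) := by
  rw [lintegral_sub' aemeasurable_const (by simpa using ENNReal.mul_ne_top hfin (by simp))]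
  · rw [ENNReal.mul_sub (by simp), rearrAvg, ENNReal.mul_div_cancel (by simp [ht]) (by simp)]
    simp [mul_comm]
  · exact (ae_restrict_mem measurableSet_Ioo).mono fun s hs => rearr_antitone f hs.2.le

end Rearrangement

/-! ### A uniformly distributed variable on $\Omega$. -/

section Uniform

/-- The distances to a dense sequence determine a point of its closure, and $\mathbb R^{\mathbb N}$
embeds measurably in $\mathbb R$. Each fibre thus meets a set of full measure in at most one point,
which is null. -/
theorem exists_measurable_real_injective {Ω : Type*} [MetricSpace Ω] [MeasurableSpace Ω]
    [BorelSpace Ω] {μ : Measure Ω} [IsProbabilityMeasure μ] [NullSingletonClass μ] {S : Set Ω}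
    (hS : TopologicalSpace.IsSeparable S) (hμS : μ Sᶜ = 0) :
    ∃ ψ : Ω → ℝ, Measurable ψ ∧ ∀ c, μ (ψ ⁻¹' {c}) = 0 := by
  obtain ⟨C, hC, hSC⟩ := hS
  have hCn : C.Nonempty := by
    by_contra hc
    rw [not_nonempty_iff_eq_empty.1 hc, closure_empty, subset_empty_iff] at hSC
    simp [hSC] at hμS
  obtain ⟨q, rfl⟩ := hC.exists_eq_range hCn
  let Φ : Ω → ℕ → ℝ := fun x n => dist x (q n)
  have hΦ : Measurable Φ :=
    measurable_pi_lambda _ fun n => (continuous_id.dist continuous_const).measurable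
  have hinj : ∀ x ∈ closure (range q), ∀ y, Φ x = Φ y → x = y := by
    intro x hx y hxy
    refine eq_of_forall_dist_le fun ε hε => ?_
    obtain ⟨_, ⟨n, rfl⟩, hn⟩ := Metric.mem_closure_iff.1 hx (ε / 2) (by positivity)
    have h2 : dist x (q n) = dist y (q n) := congrFun hxy n
    have := dist_triangle_right x y (q n)
    linarith
  refine ⟨embeddingReal (ℕ → ℝ) ∘ Φ, (measurableEmbedding_embeddingReal _).measurable.comp hΦ,
    fun c => ?_⟩
  refine measure_mono_null (t := Sᶜ ∪ (embeddingReal (ℕ → ℝ) ∘ Φ ⁻¹' {c} ∩ closure (range q)))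
    (fun x hx => ?_) (measure_union_null hμS (Set.Subsingleton.measure_zero ?_ _))
  · by_cases h : x ∈ S
    · exact Or.inr ⟨hx, hSC h⟩
    · exact Or.inl h
  · intro x hx y hy
    exact hinj x hx.2 y ((measurableEmbedding_embeddingReal (ℕ → ℝ)).injective
      ((show _ = c from hx.1).trans (show _ = c from hy.1).symm))

-- The probability integral transform: without atoms the distribution function is continuous, hence
-- attains every value in $(0,1)$.
open ProbabilityTheory in
theorem map_cdf_eq_unitVol (ν : Measure ℝ) [IsProbabilityMeasure ν] (hν : ∀ c, ν {c} = 0) :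
    ν.map (cdf ν) = unitVol := by
  have hcont : Continuous (cdf ν) := by
    refine continuous_iff_continuousAt.2 fun x => ?_
    rw [(cdf ν).mono.continuousAt_iff_leftLim_eq_rightLim, StieltjesFunction.rightLim_eq]
    have h := (cdf ν).measure_singleton x
    rw [measure_cdf, hν, eq_comm, ENNReal.ofReal_eq_zero] at h
    exact le_antisymm ((cdf ν).mono.leftLim_le le_rfl) (by linarith)
  have hIic : ∀ x, ν (Iic x) = ENNReal.ofReal (cdf ν x) := fun x => by
    rw [cdf_eq_real, ofReal_measureReal]
  have hsurj : ∀ a, 0 < a → a < 1 → ∃ x, cdf ν x = a := fun a h0 h1 =>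
    mem_range_of_exists_le_of_exists_ge hcont
      (((tendsto_cdf_atBot ν).eventually_lt_const h0).exists.imp fun _ h => h.le)
      (((tendsto_cdf_atTop ν).eventually_const_lt h1).exists.imp fun _ h => h.le)
  have := Measure.isFiniteMeasure_map ν (cdf ν)
  have hlow : ∀ a, 0 < a → a < 1 → ENNReal.ofReal a ≤ ν (cdf ν ⁻¹' Iic a) := by
    intro a h0 h1
    obtain ⟨x, rfl⟩ := hsurj a h0 h1
    rw [← hIic]
    exact measure_mono fun y hy => (cdf ν).mono hy
  have hup : ∀ a, 0 < a → a < 1 → ν (cdf ν ⁻¹' Iio a) ≤ ENNReal.ofReal a := by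
    intro a h0 h1
    obtain ⟨x, rfl⟩ := hsurj a h0 h1
    rw [← hIic]
    exact measure_mono fun y hy => le_of_lt ((cdf ν).mono.reflect_lt hy)
  refine Measure.ext_of_Iic _ _ fun a => ?_
  rw [Measure.map_apply hcont.measurable measurableSet_Iic, unitVol,
    Measure.restrict_apply measurableSet_Iic]
  rcases lt_or_ge a 0 with ha | ha
  · have e1 : cdf ν ⁻¹' Iic a = ∅ := by
      ext x; simpa using lt_of_lt_of_le ha (cdf_nonneg ν x)
    have e2 : Iic a ∩ Ioo (0 : ℝ) 1 = ∅ := by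
      ext x; simp only [mem_inter_iff, mem_Iic, mem_Ioo, mem_empty_iff_false, iff_false]
      intro h; linarith
    rw [e1, e2]; simp
  rcases le_or_gt 1 a with ha1 | ha1
  · have e1 : cdf ν ⁻¹' Iic a = univ := by
      ext x; simpa using (cdf_le_one ν x).trans ha1
    have e2 : Iic a ∩ Ioo (0 : ℝ) 1 = Ioo 0 1 := by
      ext x; simp only [mem_inter_iff, mem_Iic, mem_Ioo, and_iff_right_iff_imp]
      intro h; linarith
    rw [e1, e2]; simp
  have e2 : volume (Iic a ∩ Ioo (0 : ℝ) 1) = ENNReal.ofReal a := by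
    have : Iic a ∩ Ioo (0 : ℝ) 1 = Ioc 0 a := by
      ext x; simp only [mem_inter_iff, mem_Iic, mem_Ioo, mem_Ioc]
      constructor
      · intro h; exact ⟨h.2.1, h.1⟩
      · intro h; exact ⟨h.2, h.1, by linarith⟩
    rw [this]; simp
  rw [e2]
  apply le_antisymm
  -- The upper bound `hup` concerns open half-lines, so the closed one is reached as $b\downarrow
  -- a$.
  · have ht : Tendsto ENNReal.ofReal (𝓝[>] a) (𝓝 (ENNReal.ofReal a)) :=
      ENNReal.continuous_ofReal.continuousAt.tendsto.mono_left nhdsWithin_le_nhds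
    refine ge_of_tendsto ht ?_
    filter_upwards [Ioo_mem_nhdsGT ha1] with b hb
    exact (measure_mono fun x hx => lt_of_le_of_lt hx hb.1).trans
      (hup b (lt_of_le_of_lt ha hb.1) hb.2)
  · rcases ha.eq_or_lt with rfl | h0
    · simp
    · exact hlow a h0 ha1

/-- Composition with $U$ realises every measurable function on $(0,1)$ on $\Omega$, so the infimum
in `RISpace.bar` is not over an empty family. -/
theorem IsMetricProbabilitySpace.exists_uniform {Ω : Type*} [MetricSpace Ω] [MeasurableSpace Ω]
    [BorelSpace Ω] {μ : Measure Ω} (h : IsMetricProbabilitySpace μ) :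
    ∃ U : Ω → ℝ, MeasurePreserving U μ unitVol := by
  have := h.probability
  have := h.nonatomic
  obtain ⟨S, hS, hμS⟩ := h.separable
  obtain ⟨ψ, hψ, hc⟩ := exists_measurable_real_injective hS hμS
  have := Measure.isProbabilityMeasure_map (μ := μ) hψ.aemeasurable
  have hF : Measurable (ProbabilityTheory.cdf (μ.map ψ)) :=
    (ProbabilityTheory.cdf (μ.map ψ)).mono.measurable
  refine ⟨_, hF.comp hψ, ?_⟩
  rw [← Measure.map_map hF hψ]
  refine map_cdf_eq_unitVol _ fun c => ?_
  rw [Measure.map_apply hψ (measurableSet_singleton c)]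
  exact hc c

end Uniform

/-! ### The representation norm on $(0,1)$. -/

namespace RISpace

variable {Ω : Type*} [MeasurableSpace Ω] {μ : Measure Ω}

theorem bar_eq (X : RISpace μ) {U : Ω → ℝ} (hU : MeasurePreserving U μ unitVol) {h : ℝ → ℝ≥0∞}
    (hh : Measurable h) : X.bar h = X.norm (h ∘ U) := by
  have hd : ∀ t, μ {x | t < (h ∘ U) x} = unitVol {s | t < h s} := fun t =>
    hU.measure_preimage (measurableSet_lt measurable_const hh).nullMeasurableSet
  have hm : Measurable (h ∘ U) := hh.comp hU.measurable
  refine le_antisymm (iInf₂_le _ ⟨hm.aemeasurable, hd⟩) (le_iInf₂ fun g hg => le_of_eq ?_)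
  exact X.rearrangement_invariant _ _ hm.aemeasurable hg.1 fun t => by rw [hd, hg.2]

/-- `bar` sees only the distribution function, so no measurability is needed here. -/
theorem bar_congr_distr (X : RISpace μ) {h k : ℝ → ℝ≥0∞}
    (e : ∀ t, unitVol {s | t < h s} = unitVol {s | t < k s}) : X.bar h = X.bar k := by
  unfold bar
  simp only [e]

theorem bar_rearr_unitVol (X : RISpace μ) (h : ℝ → ℝ≥0∞) : X.bar (rearr unitVol h) = X.bar h :=
  X.bar_congr_distr fun t => (equimeas_rearr h t).symm

variable (X : RISpace μ) (hμ : ∃ U : Ω → ℝ, MeasurePreserving U μ unitVol)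
include hμ

theorem bar_mono {h k : ℝ → ℝ≥0∞} (hh : Measurable h) (hk : Measurable k)
    (hle : ∀ s ∈ Ioo (0 : ℝ) 1, h s ≤ k s) : X.bar h ≤ X.bar k := by
  obtain ⟨U, hU⟩ := hμ
  rw [X.bar_eq hU hh, X.bar_eq hU hk]
  refine X.norm_mono _ _ (hh.comp hU.measurable).aemeasurable
    (hk.comp hU.measurable).aemeasurable ?_
  have : ∀ᵐ s ∂unitVol, h s ≤ k s := (ae_restrict_mem measurableSet_Ioo).mono hle
  exact hU.quasiMeasurePreserving.ae this

theorem bar_congr {h k : ℝ → ℝ≥0∞} (hh : Measurable h) (hk : Measurable k)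
    (hle : ∀ s ∈ Ioo (0 : ℝ) 1, h s = k s) : X.bar h = X.bar k :=
  le_antisymm (X.bar_mono hμ hh hk fun s hs => (hle s hs).le)
    (X.bar_mono hμ hk hh fun s hs => (hle s hs).ge)

theorem bar_add {h k : ℝ → ℝ≥0∞} (hh : Measurable h) (hk : Measurable k) :
    X.bar (fun s => h s + k s) ≤ X.bar h + X.bar k := by
  obtain ⟨U, hU⟩ := hμ
  rw [X.bar_eq hU hh, X.bar_eq hU hk, X.bar_eq hU (h := fun s => h s + k s) (hh.add hk)]
  exact X.norm_add _ _ (hh.comp hU.measurable).aemeasurable (hk.comp hU.measurable).aemeasurable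

theorem bar_smul (c : ℝ≥0) {h : ℝ → ℝ≥0∞} (hh : Measurable h) :
    X.bar (fun s => c * h s) = c * X.bar h := by
  obtain ⟨U, hU⟩ := hμ
  rw [X.bar_eq hU hh, X.bar_eq hU (hh.const_mul _)]
  exact X.norm_smul _ _ (hh.comp hU.measurable).aemeasurable

theorem bar_const (c : ℝ≥0) : X.bar (fun _ => (c : ℝ≥0∞)) = c * X.norm (fun _ => 1) := by
  obtain ⟨U, hU⟩ := id hμ
  have := X.bar_smul hμ c (h := fun _ => 1) measurable_const
  rw [X.bar_eq hU (h := fun _ => 1) measurable_const] at this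
  simp only [mul_one] at this
  exact this

theorem bar_iSup {h : ℕ → ℝ → ℝ≥0∞} (hh : ∀ n, Measurable (h n)) (hm : Monotone h) :
    X.bar (fun s => ⨆ n, h n s) = ⨆ n, X.bar (h n) := by
  obtain ⟨U, hU⟩ := hμ
  rw [X.bar_eq hU (.iSup hh)]
  simp only [fun n => X.bar_eq hU (hh n)]
  exact X.fatou (fun n => h n ∘ U) (fun n => ((hh n).comp hU.measurable).aemeasurable)
    fun a b hab x => hm hab (U x)

theorem bar_zero : X.bar (fun _ => 0) = 0 := by
  simpa using X.bar_smul hμ 0 (h := fun _ => 1) measurable_const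

theorem bar_sum_le {h : ℕ → ℝ → ℝ≥0∞} (hh : ∀ n, Measurable (h n)) (N : ℕ) :
    X.bar (fun s => ∑ n ∈ Finset.range N, h n s) ≤ ∑ n ∈ Finset.range N, X.bar (h n) := by
  induction N with
  | zero => simp [X.bar_zero hμ]
  | succ N ih =>
    simp only [Finset.sum_range_succ]
    exact (X.bar_add hμ (Finset.measurable_sum _ fun n _ => hh n) (hh N)).trans
      (add_le_add_left ih _)

theorem bar_tsum_le {h : ℕ → ℝ → ℝ≥0∞} (hh : ∀ n, Measurable (h n)) :
    X.bar (fun s => ∑' n, h n s) ≤ ∑' n, X.bar (h n) := by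
  simp only [ENNReal.tsum_eq_iSup_nat]
  rw [X.bar_iSup hμ (fun N => Finset.measurable_sum _ fun n _ => hh n)]
  · exact iSup_mono fun N => X.bar_sum_le hμ hh N
  · intro a b hab s
    exact Finset.sum_le_sum_of_subset (Finset.range_mono hab)

theorem bar_le_norm_of_distr [IsProbabilityMeasure μ] {h : ℝ → ℝ≥0∞} {f : Ω → ℝ≥0∞}
    (hf : Measurable f)
    (hd : ∀ t, unitVol {s | t < h s} ≤ μ {x | t < f x}) : X.bar h ≤ X.norm f := by
  rw [← X.bar_rearr_unitVol, ← X.bar_rearr f hf.aemeasurable]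
  exact X.bar_mono hμ (measurable_rearr _) (measurable_rearr _) fun s _ => rearr_le_of_distr hd s

theorem bar_le_bar_of_distr {h k : ℝ → ℝ≥0∞}
    (hd : ∀ t, unitVol {s | t < h s} ≤ unitVol {x | t < k x}) : X.bar h ≤ X.bar k := by
  rw [← X.bar_rearr_unitVol, ← X.bar_rearr_unitVol k]
  exact X.bar_mono hμ (measurable_rearr _) (measurable_rearr _) fun s _ => rearr_le_of_distr hd s

end RISpace

/-! ### Gluing on dyadic intervals, and rotations of the circle. -/

section Dyadic

theorem volume_preimage_affine {a : ℝ} (ha : 0 < a) (b : ℝ) (B : Set ℝ) :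
    volume ((fun x => a * x + b) ⁻¹' B) = ENNReal.ofReal a⁻¹ * volume B := by
  have : (fun x => a * x + b) ⁻¹' B = (fun x => a * x) ⁻¹' ((fun x => x + b) ⁻¹' B) := rfl
  rw [this, Real.volume_preimage_mul_left ha.ne', measure_preimage_add_right,
    abs_of_pos (inv_pos.2 ha)]

theorem unitVol_apply (S : Set ℝ) : unitVol S = volume (S ∩ Ioo 0 1) :=
  Measure.restrict_apply' measurableSet_Ioo

theorem unitVol_apply_Ioc (S : Set ℝ) : unitVol S = volume (S ∩ Ioc 0 1) := by
  rw [unitVol, Measure.restrict_congr_set Ioo_ae_eq_Ioc, Measure.restrict_apply' measurableSet_Ioc]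

/-- The compression `v (2 s)` of `v` to `(0, 1/2)`. -/
def compress (v : ℝ → ℝ≥0∞) : ℝ → ℝ≥0∞ := (Ioo 0 (1 / 2)).indicator fun s => v (2 * s)

theorem measurable_compress {v : ℝ → ℝ≥0∞} (hv : Measurable v) : Measurable (compress v) :=
  (hv.comp (measurable_const_mul 2)).indicator measurableSet_Ioo

theorem unitVol_compress (v : ℝ → ℝ≥0∞) (t : ℝ≥0∞) :
    unitVol {s | t < compress v s} = ENNReal.ofReal 2⁻¹ * unitVol {s | t < v s} := by
  rw [unitVol_apply, unitVol_apply, ← volume_preimage_affine two_pos 0]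
  congr 1
  ext s
  simp only [compress, mem_inter_iff, mem_ofPred_eq, mem_preimage, mem_Ioo, add_zero]
  by_cases h : s ∈ Ioo (0 : ℝ) (1 / 2)
  · rw [indicator_of_mem h]
    constructor
    · rintro ⟨h1, -⟩; exact ⟨h1, by linarith [h.1], by linarith [h.2]⟩
    · rintro ⟨h1, -⟩; exact ⟨h1, h.1, by linarith [h.2]⟩
  · rw [indicator_of_notMem h]
    constructor
    · rintro ⟨h1, -⟩; exact absurd h1 not_lt_zero
    · rintro ⟨-, h1, h2⟩; exact absurd ⟨by linarith, by linarith⟩ h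

/-- This second half-size copy, together with `compress v`, makes up a function equimeasurable with
$v$. -/
theorem unitVol_compress_shift (v : ℝ → ℝ≥0∞) (t : ℝ≥0∞) :
    unitVol {s | t < (Ioo (1 / 2) 1).indicator (fun s => v (2 * s - 1)) s} =
      ENNReal.ofReal 2⁻¹ * unitVol {s | t < v s} := by
  rw [unitVol_apply, unitVol_apply, ← volume_preimage_affine two_pos (-1)]
  congr 1
  ext s
  simp only [mem_inter_iff, mem_ofPred_eq, mem_preimage, mem_Ioo]
  by_cases h : s ∈ Ioo (1 / 2 : ℝ) 1
  · rw [indicator_of_mem h]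
    constructor
    · rintro ⟨h1, -⟩; exact ⟨h1, by linarith [h.1], by linarith [h.2]⟩
    · rintro ⟨h1, -⟩; exact ⟨h1, by linarith [h.1], h.2⟩
  · rw [indicator_of_notMem h]
    constructor
    · rintro ⟨h1, -⟩; exact absurd h1 not_lt_zero
    · rintro ⟨-, h1, h2⟩; exact absurd ⟨by linarith, by linarith⟩ h

/-- The half-open dyadic intervals that partition `(0, 1]`. -/
def dyadicIoc (i : ℕ) : Set ℝ := Ioc ((1 / 2) ^ (i + 1)) ((1 / 2) ^ i)

/-- The $i$-th dyadic interval has length $2^{-(i+1)}$; the exponent $i+1$ in all normalisations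
below comes from here. -/
theorem mem_dyadicIoc_iff {i : ℕ} {s : ℝ} :
    s ∈ dyadicIoc i ↔ 2 ^ (i + 1) * s + -1 ∈ Ioc (0 : ℝ) 1 := by
  have h : (2 : ℝ) ^ (i + 1) * (1 / 2) ^ (i + 1) = 1 := by rw [← mul_pow]; norm_num
  have h' : (2 : ℝ) ^ (i + 1) * (1 / 2) ^ i = 2 := by
    rw [pow_succ, mul_right_comm, ← mul_pow]; norm_num
  have hp : (0 : ℝ) < 2 ^ (i + 1) := by positivity
  rw [dyadicIoc, mem_Ioc, mem_Ioc, ← mul_lt_mul_iff_right₀ hp, ← mul_le_mul_iff_right₀ hp, h, h']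
  constructor <;> rintro ⟨h1, h2⟩ <;> constructor <;> linarith

theorem exists_mem_dyadicIoc {s : ℝ} (hs : s ∈ Ioc (0 : ℝ) 1) : ∃ i, s ∈ dyadicIoc i :=
  exists_nat_pow_near_of_lt_one hs.1 hs.2 (by norm_num) (by norm_num)

theorem dyadicIoc_subset (i : ℕ) : dyadicIoc i ⊆ Ioc 0 1 := fun s hs =>
  ⟨lt_trans (by positivity) hs.1, hs.2.trans (pow_le_one₀ (by norm_num) (by norm_num))⟩

theorem dyadicIoc_eq_of_mem {i j : ℕ} {s : ℝ} (hi : s ∈ dyadicIoc i) (hj : s ∈ dyadicIoc j) :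
    i = j := by
  by_contra hne
  wlog h : i < j generalizing i j
  · exact this hj hi (Ne.symm hne) (by omega)
  have : (1 / 2 : ℝ) ^ j ≤ (1 / 2) ^ (i + 1) :=
    pow_le_pow_of_le_one (by norm_num) (by norm_num) h
  linarith [hi.1, hj.2]

/-- The function on `(0, 1]` that is an affine copy of `F i` on the `i`-th dyadic interval. -/
def dyadicGlue (F : ℕ → ℝ → ℝ≥0∞) (s : ℝ) : ℝ≥0∞ :=
  ∑' i, (dyadicIoc i).indicator (fun s => F i (2 ^ (i + 1) * s + -1)) s

theorem dyadicGlue_of_mem (F : ℕ → ℝ → ℝ≥0∞) {i : ℕ} {s : ℝ} (hs : s ∈ dyadicIoc i) :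
    dyadicGlue F s = F i (2 ^ (i + 1) * s + -1) := by
  rw [dyadicGlue, tsum_eq_single i, indicator_of_mem hs]
  intro j hj
  exact indicator_of_notMem (fun h => hj (dyadicIoc_eq_of_mem h hs)) _

theorem measurable_dyadicGlue {F : ℕ → ℝ → ℝ≥0∞} (hF : ∀ i, Measurable (F i)) :
    Measurable (dyadicGlue F) :=
  Measurable.tsum fun i => ((hF i).comp (by fun_prop)).indicator measurableSet_Ioc

theorem unitVol_dyadicGlue {F : ℕ → ℝ → ℝ≥0∞} (hF : ∀ i, Measurable (F i)) (t : ℝ≥0∞) :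
    unitVol {s | t < dyadicGlue F s} =
      ∑' i, ENNReal.ofReal (2 ^ (i + 1))⁻¹ * volume ({x | t < F i x} ∩ Ioc 0 1) := by
  have he : {s | t < dyadicGlue F s} ∩ Ioc 0 1 =
      ⋃ i, (fun s => 2 ^ (i + 1) * s + -1) ⁻¹' ({x | t < F i x} ∩ Ioc 0 1) := by
    ext s
    simp only [mem_inter_iff, mem_iUnion, mem_preimage, ← mem_dyadicIoc_iff]
    constructor
    · rintro ⟨h1, h2⟩
      obtain ⟨i, hi⟩ := exists_mem_dyadicIoc h2
      refine ⟨i, ?_, hi⟩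
      rw [mem_ofPred_eq, dyadicGlue_of_mem F hi] at h1
      exact h1
    · rintro ⟨i, h1, hi⟩
      refine ⟨?_, dyadicIoc_subset i hi⟩
      rw [mem_ofPred_eq, dyadicGlue_of_mem F hi]
      exact h1
  rw [unitVol_apply_Ioc, he, measure_iUnion]
  · simp only [volume_preimage_affine (show (0 : ℝ) < 2 ^ _ by positivity)]
  · intro i j hij
    refine Set.disjoint_left.2 fun s hi hj => hij ?_
    exact dyadicIoc_eq_of_mem (mem_dyadicIoc_iff.2 hi.2) (mem_dyadicIoc_iff.2 hj.2)
  · intro i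
    exact (by fun_prop : Measurable fun s : ℝ => 2 ^ (i + 1) * s + -1)
      ((measurableSet_lt measurable_const (hF i)).inter measurableSet_Ioc)

/-- Invariance under rotation: $(c,c+1]$ and $(0,1]$ are both fundamental domains for integer
translations. -/
theorem lintegral_fract_add {F : ℝ → ℝ≥0∞} (c : ℝ) :
    ∫⁻ x in Ioc (0 : ℝ) 1, F (Int.fract (x + c)) = ∫⁻ x in Ioc (0 : ℝ) 1, F x := by
  have h1 : ∫⁻ x in Ioc (0 : ℝ) 1, F (Int.fract (x + c)) =
      ∫⁻ x in Ioc c (c + 1), F (Int.fract x) := by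
    have := (measurePreserving_add_right (volume : Measure ℝ) c).setLIntegral_comp_preimage_emb
      (measurableEmbedding_addRight c) (fun x => F (Int.fract x)) (Ioc c (c + 1))
    rw [← this]
    congr 2
    ext x; simp [add_comm]
  have h2 : ∫⁻ x in Ioc c (c + 1), F (Int.fract x) =
      ∫⁻ x in Ioc (0 : ℝ) (0 + 1), F (Int.fract x) := by
    refine (isAddFundamentalDomain_Ioc one_pos c volume).setLIntegral_eq
      (isAddFundamentalDomain_Ioc one_pos 0 volume) (fun x => F (Int.fract x)) ?_
    rintro ⟨_, n, rfl⟩ x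
    change F (Int.fract (n • (1 : ℝ) + x)) = _
    simp
  rw [h1, h2, zero_add, ← restrict_Ioo_eq_restrict_Ioc]
  refine setLIntegral_congr_fun measurableSet_Ioo fun x hx => ?_
  simp only [Int.fract_eq_self.2 ⟨hx.1.le, hx.2⟩]

theorem volume_fract_add (B : Set ℝ) (hB : MeasurableSet B) (c : ℝ) :
    volume ({x | Int.fract (x + c) ∈ B} ∩ Ioc 0 1) = volume (B ∩ Ioc 0 1) := by
  have h := lintegral_fract_add (F := B.indicator 1) c
  rw [lintegral_indicator_one hB, Measure.restrict_apply' measurableSet_Ioc] at h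
  rw [← h, ← Measure.restrict_apply' measurableSet_Ioc, ← lintegral_indicator_one]
  · rfl
  · exact (measurable_fract.comp (measurable_add_const c)) hB

/-- The average of an antitone function is, up to a small error, at most the mean of its values at
equidistant points of the circle. -/
theorem mul_lintegral_le_sum_fract {F : ℝ → ℝ≥0∞} (hF : Antitone F) {M : ℝ≥0}
    (hM : ∀ x, F x ≤ M) (n : ℕ) (x : ℝ) :
    (n + 1 : ℕ) * ∫⁻ y in Ioc (0 : ℝ) 1, F y ≤
      M + ∑ k ∈ Finset.range (n + 1), F (Int.fract (x + k / (n + 1 : ℕ))) := by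
  set N : ℝ := ((n + 1 : ℕ) : ℝ) with hN
  have hN0 : 0 < N := by positivity
  set P : ℝ → ℝ≥0∞ := fun x => ∑ k ∈ Finset.range (n + 1), F (Int.fract (x + k / N)) with hP
  -- A shift by $1/N$ permutes the summands cyclically, so it is enough to compare values of $P$ on
  -- $[0,1/N)$.
  have hper : Function.Periodic P (1 / N) := by
    intro y
    have h1 := Finset.sum_range_succ (fun k : ℕ => F (Int.fract (y + k / N))) (n + 1)
    rw [Finset.sum_range_succ' (fun k : ℕ => F (Int.fract (y + k / N))) (n + 1)] at h1
    have e1 : F (Int.fract (y + ((n + 1 : ℕ) : ℝ) / N)) = F (Int.fract (y + ((0 : ℕ) : ℝ) / N)) := by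
      rw [← hN, div_self hN0.ne']; simp
    rw [e1] at h1
    have h2 := (ENNReal.add_left_inj (ne_top_of_le_ne_top ENNReal.coe_ne_top (hM _))).1 h1
    rw [hP]
    simp only
    rw [← h2]
    refine Finset.sum_congr rfl fun k _ => ?_
    congr 2
    push_cast
    ring
  have hfr : ∀ y ∈ Ico 0 (1 / N), ∀ k ∈ Finset.range (n + 1), Int.fract (y + k / N) = y + k / N := by
    intro y hy k hk
    rw [Int.fract_eq_self]
    refine ⟨add_nonneg hy.1 (by positivity), ?_⟩
    have hk' : (k : ℝ) + 1 ≤ N := by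
      rw [hN]; exact_mod_cast Finset.mem_range.1 hk
    calc y + k / N < 1 / N + k / N := by linarith [hy.2]
      _ = (k + 1) / N := by ring
      _ ≤ 1 := (div_le_one hN0).2 hk'
  -- Pair the $(k+1)$-st term at $z$ with the $k$-th at $y$: since $z+(k+1)/N\ge y+k/N$, only one
  -- unpaired term at $z$ remains, and it is at most $M$.
  have hbase : ∀ z ∈ Ico 0 (1 / N), ∀ y ∈ Ico 0 (1 / N), P z ≤ M + P y := by
    intro z hz y hy
    have ez : P z = ∑ k ∈ Finset.range (n + 1), F (z + k / N) :=
      Finset.sum_congr rfl fun k hk => by rw [hfr z hz k hk]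
    have ey : P y = ∑ k ∈ Finset.range (n + 1), F (y + k / N) :=
      Finset.sum_congr rfl fun k hk => by rw [hfr y hy k hk]
    rw [ez, ey, Finset.sum_range_succ', Finset.sum_range_succ, add_comm]
    refine add_le_add (hM _) (le_add_right (Finset.sum_le_sum fun k _ => hF ?_))
    have : ((k + 1 : ℕ) : ℝ) / N = k / N + 1 / N := by push_cast; ring
    rw [this]
    linarith [hz.1, hy.2]
  have hall : ∀ z y, P z ≤ M + P y := by
    intro z y
    obtain ⟨z', hz', ez⟩ := hper.exists_mem_Ico₀ (by positivity) z
    obtain ⟨y', hy', ey⟩ := hper.exists_mem_Ico₀ (by positivity) y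
    rw [ez, ey]
    exact hbase z' hz' y' hy'
  have hmeas : ∀ k ∈ Finset.range (n + 1), Measurable fun z : ℝ => F (Int.fract (z + k / N)) :=
    fun k _ => hF.measurable.comp (measurable_fract.comp (measurable_add_const _))
  -- Each rotation preserves the integral, so the left side is the mean of $P$, which lies within
  -- $M$ of every value of $P$.
  have hint : (n + 1 : ℕ) * ∫⁻ y in Ioc (0 : ℝ) 1, F y = ∫⁻ z in Ioc (0 : ℝ) 1, P z := by
    rw [hP, lintegral_finsetSum _ hmeas]
    simp only [lintegral_fract_add]
    simp
  rw [hint]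
  calc ∫⁻ z in Ioc (0 : ℝ) 1, P z ≤ ∫⁻ z in Ioc (0 : ℝ) 1, (M + P x) :=
        lintegral_mono fun z => hall z x
    _ = M + P x := by simp

end Dyadic

/-- Hardy–Littlewood followed by the substitution $s=x/a$. With $a=2^{i+1}$ it bounds the normalised
integral over $E$ by the mean of a decreasing function on $(0,1]$. -/
theorem bounded_rearr_comp_lintegral {Ω : Type*} [MeasurableSpace Ω] {μ : Measure Ω}
    [IsProbabilityMeasure μ] {f : Ω → ℝ≥0∞} (hf : Measurable f) {E : Set Ω} (hE : MeasurableSet E)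
    {a : ℝ} (ha : 0 < a) (hμE : μ E ≤ ENNReal.ofReal a⁻¹) :
    ENNReal.ofReal a * ∫⁻ x in E, f x ∂μ ≤
      ∫⁻ x in Ioc (0 : ℝ) 1, rearr μ (E.indicator f) (a⁻¹ * x) := by
  have h1 : ∫⁻ x in E, f x ∂μ ≤ ∫⁻ s in Ioo 0 a⁻¹, rearr μ (E.indicator f) s := by
    refine le_trans (le_of_eq ?_) (setLIntegral_le_rearr (hf.indicator hE) hE hμE)
    exact setLIntegral_congr_fun hE fun x hx => (indicator_of_mem hx f).symm
  have h2 : ∫⁻ s in Ioo 0 a⁻¹, rearr μ (E.indicator f) s =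
      ENNReal.ofReal a⁻¹ * ∫⁻ x in Ioc (0 : ℝ) 1, rearr μ (E.indicator f) (a⁻¹ * x) := by
    have ha' : (0 : ℝ) < a⁻¹ := inv_pos.2 ha
    rw [← restrict_Ioo_eq_restrict_Ioc, ← lintegral_indicator measurableSet_Ioo,
      ← lintegral_indicator measurableSet_Ioo]
    conv_lhs => rw [← Real.smul_map_volume_mul_left ha'.ne']
    rw [lintegral_smul_measure, lintegral_map
      ((measurable_rearr _).indicator measurableSet_Ioo) (measurable_const_mul _), abs_of_pos ha',
      smul_eq_mul]
    congr 2
    funext x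
    by_cases hx : x ∈ Ioo (0 : ℝ) 1
    · rw [indicator_of_mem hx, indicator_of_mem]
      exact ⟨mul_pos ha' hx.1, by nlinarith [hx.2]⟩
    · rw [indicator_of_notMem hx, indicator_of_notMem]
      rintro ⟨h1, h2⟩
      exact hx ⟨pos_of_mul_pos_right h1 ha'.le, by
        by_contra hc
        nlinarith⟩
  calc ENNReal.ofReal a * ∫⁻ x in E, f x ∂μ
      ≤ ENNReal.ofReal a * (ENNReal.ofReal a⁻¹ *
        ∫⁻ x in Ioc (0 : ℝ) 1, rearr μ (E.indicator f) (a⁻¹ * x)) := by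
          gcongr; exact h1.trans h2.le
    _ = _ := by
      rw [← mul_assoc, ← ENNReal.ofReal_mul ha.le, mul_inv_cancel₀ ha.ne']; simp

/-- Undoing the stretching puts the set inside $(0,\mu\{f>t\})$. -/
theorem volume_rearr_scaled_le {Ω : Type*} [MeasurableSpace Ω] {μ : Measure Ω}
    [IsProbabilityMeasure μ] (f : Ω → ℝ≥0∞) {a : ℝ} (ha : 0 < a) (t : ℝ≥0∞) :
    ENNReal.ofReal a⁻¹ * volume ({x | t < rearr μ f (a⁻¹ * x)} ∩ Ioc 0 1) ≤ μ {x | t < f x} := by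
  rw [← volume_preimage_affine ha 0]
  have hfin : μ {x | t < f x} ≠ ∞ := measure_ne_top _ _
  calc volume ((fun x => a * x + 0) ⁻¹' ({x | t < rearr μ f (a⁻¹ * x)} ∩ Ioc 0 1))
      ≤ volume (Ioo 0 (μ {x | t < f x}).toReal) := by
        refine measure_mono fun x hx => ?_
        obtain ⟨h1, h2, -⟩ := hx
        simp only [mem_ofPred_eq, lt_rearr_iff, add_zero] at h1 h2
        rw [inv_mul_cancel_left₀ ha.ne'] at h1
        have hx0 := pos_of_mul_pos_right h2 ha.le
        exact ⟨hx0, (ENNReal.ofReal_lt_iff_lt_toReal hx0.le hfin).1 h1⟩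
    _ = μ {x | t < f x} := by simp [hfin]

/-! ### Norms of dilations and of averaging operators. -/

namespace RISpace

variable {Ω : Type*} [MeasurableSpace Ω] {μ : Measure Ω}
-- Rotating every piece inside its own dyadic interval leaves the distribution unchanged.
theorem bar_dyadicGlue_fract (X : RISpace μ) {F : ℕ → ℝ → ℝ≥0∞} (hF : ∀ i, Measurable (F i)) (c : ℝ) :
    X.bar (dyadicGlue fun i x => F i (Int.fract (x + c))) = X.bar (dyadicGlue F) := by
  refine X.bar_congr_distr fun t => ?_
  rw [unitVol_dyadicGlue hF, unitVol_dyadicGlue (F := fun i x => F i (Int.fract (x + c))) fun i =>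
    (hF i).comp (measurable_fract.comp (measurable_add_const c))]
  congr 1
  funext i
  congr 1
  exact volume_fract_add {x | t < F i x} (measurableSet_lt measurable_const (hF i)) c

variable (X : RISpace μ) (hμ : ∃ U : Ω → ℝ, MeasurePreserving U μ unitVol)
include hμ

theorem bar_compress_le {v : ℝ → ℝ≥0∞} : X.bar (compress v) ≤ X.bar v := by
  refine X.bar_le_bar_of_distr hμ fun t => ?_
  rw [unitVol_compress]
  exact mul_le_of_le_one_left zero_le (by simp)

/-- $v$ is equimeasurable with the sum of two copies of itself, each squeezed into one half of
$(0,1)$, and the two copies have equal norm. -/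
theorem bar_le_two_mul_compress {v : ℝ → ℝ≥0∞} (hv : Measurable v) :
    X.bar v ≤ 2 * X.bar (compress v) := by
  set w : ℝ → ℝ≥0∞ := (Ioo (1 / 2) 1).indicator fun s => v (2 * s - 1) with hw
  have hwm : Measurable w :=
    (hv.comp ((measurable_const_mul 2).sub_const 1)).indicator measurableSet_Ioo
  have hcm := measurable_compress hv
  have e1 : X.bar v = X.bar (fun s => compress v s + w s) := by
    refine X.bar_congr_distr fun t => ?_
    have hU : {s | t < compress v s + w s} = {s | t < compress v s} ∪ {s | t < w s} := by
      ext s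
      simp only [mem_union, mem_ofPred_eq]
      by_cases hs : s ∈ Ioo (0 : ℝ) (1 / 2)
      · have : w s = 0 := indicator_of_notMem (fun h => by linarith [hs.2, h.1]) _
        simp [this]
      · have : compress v s = 0 := indicator_of_notMem hs _
        simp [this]
    rw [hU, measure_union _ (measurableSet_lt measurable_const hwm), unitVol_compress,
      unitVol_compress_shift, ← add_mul, ← ENNReal.ofReal_add (by norm_num) (by norm_num)]
    · norm_num
    · refine Set.disjoint_left.2 fun s h1 h2 => ?_
      have h1' : s ∈ Ioo (0 : ℝ) (1 / 2) := by
        by_contra hc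
        rw [mem_ofPred_eq, compress, indicator_of_notMem hc] at h1
        exact not_lt_zero h1
      have h2' : s ∈ Ioo (1 / 2 : ℝ) 1 := by
        by_contra hc
        rw [mem_ofPred_eq, hw, indicator_of_notMem hc] at h2
        exact not_lt_zero h2
      linarith [h1'.2, h2'.1]
  have e2 : X.bar w = X.bar (compress v) :=
    X.bar_congr_distr fun t => by rw [unitVol_compress, unitVol_compress_shift]
  rw [e1, two_mul]
  exact (X.bar_add hμ hcm hwm).trans (by rw [e2])

/-- Compressing $v(s/2)$ gives back $v$ restricted to $(0,1/2)$. -/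
theorem bar_comp_half_le {v : ℝ → ℝ≥0∞} (hv : Measurable v) :
    X.bar (fun s => v (s / 2)) ≤ 2 * X.bar v := by
  have hm : Measurable fun s => v (s / 2) := hv.comp (measurable_id.div_const 2)
  refine (X.bar_le_two_mul_compress hμ hm).trans ?_
  gcongr
  refine X.bar_mono hμ (measurable_compress hm) hv fun s _ => ?_
  refine indicator_apply_le' (fun _ => ?_) fun _ => zero_le
  simp only [mul_div_cancel_left₀ s (two_ne_zero (α := ℝ)), le_refl]

theorem bar_comp_div_pow_le {v : ℝ → ℝ≥0∞} (hv : Measurable v) (n : ℕ) :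
    X.bar (fun s => v (s / 2 ^ n)) ≤ 2 ^ n * X.bar v := by
  induction n with
  | zero => simp
  | succ n ih =>
    have := X.bar_comp_half_le hμ (v := fun s => v (s / 2 ^ n)) (hv.comp (measurable_id.div_const _))
    have e : ∀ s : ℝ, s / 2 ^ (n + 1) = s / 2 / 2 ^ n := fun s => by rw [pow_succ']; field_simp
    simp only [e]
    refine this.trans ?_
    rw [pow_succ', mul_assoc]
    gcongr

/-- Averaging over the dyadic intervals does not increase the norm (the bounded case). -/
theorem bar_dyadicGlue_average_le_of_bounded {F : ℕ → ℝ → ℝ≥0∞} (hF : ∀ i, Antitone (F i))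
    {M : ℝ≥0} (hM : ∀ i x, F i x ≤ M) :
    X.bar (dyadicGlue fun i _ => ∫⁻ y in Ioc (0 : ℝ) 1, F i y) ≤ X.bar (dyadicGlue F) := by
  have hFm : ∀ i, Measurable (F i) := fun i => (hF i).measurable
  -- Pointwise the mean is at most $M/N$ plus the average of $N=n+1$ rotated copies, all with the
  -- norm of `dyadicGlue F`; the triangle inequality does the rest. The error vanishes as
  -- $N\to\infty$ because constants belong to $X$.
  have key : ∀ n : ℕ, X.bar (dyadicGlue fun i _ => ∫⁻ y in Ioc (0 : ℝ) 1, F i y) ≤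
      (((n + 1 : ℕ) : ℝ≥0)⁻¹ * M : ℝ≥0) * X.norm (fun _ => 1) + X.bar (dyadicGlue F) := by
    intro n
    set N : ℝ≥0 := ((n + 1 : ℕ) : ℝ≥0) with hN
    have hN0 : N ≠ 0 := by positivity
    set R : ℕ → ℝ → ℝ≥0∞ := fun k => dyadicGlue fun i x => F i (Int.fract (x + k / (n + 1 : ℕ)))
      with hR
    have hRm : ∀ k, Measurable (R k) := fun k => measurable_dyadicGlue fun i =>
      (hFm i).comp (measurable_fract.comp (measurable_add_const _))
    have hSm : Measurable fun s => ∑ k ∈ Finset.range (n + 1), R k s :=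
      Finset.measurable_sum _ fun k _ => hRm k
    calc X.bar (dyadicGlue fun i _ => ∫⁻ y in Ioc (0 : ℝ) 1, F i y)
        ≤ X.bar (fun s => ((N⁻¹ * M : ℝ≥0) : ℝ≥0∞) +
            ((N⁻¹ : ℝ≥0) : ℝ≥0∞) * ∑ k ∈ Finset.range (n + 1), R k s) := by
          refine X.bar_mono hμ (measurable_dyadicGlue fun i => measurable_const)
            (measurable_const.add (hSm.const_mul _)) fun s hs => ?_
          obtain ⟨i, hi⟩ := exists_mem_dyadicIoc ⟨hs.1, hs.2.le⟩
          have h := mul_lintegral_le_sum_fract (hF i) (hM i) n (2 ^ (i + 1) * s + -1)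
          simp only [hR, dyadicGlue_of_mem _ hi]
          have hcoe : ((N⁻¹ : ℝ≥0) : ℝ≥0∞) * (n + 1 : ℕ) = 1 := by
            have : ((n + 1 : ℕ) : ℝ≥0∞) = (N : ℝ≥0∞) := by rw [hN]; push_cast; rfl
            rw [this, ← ENNReal.coe_mul, inv_mul_cancel₀ hN0, ENNReal.coe_one]
          calc ∫⁻ y in Ioc (0 : ℝ) 1, F i y
              = ((N⁻¹ : ℝ≥0) : ℝ≥0∞) * ((n + 1 : ℕ) * ∫⁻ y in Ioc (0 : ℝ) 1, F i y) := by
                rw [← mul_assoc, hcoe, one_mul]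
            _ ≤ _ := by
                rw [ENNReal.coe_mul, ← mul_add]
                gcongr
      _ ≤ X.bar (fun _ => ((N⁻¹ * M : ℝ≥0) : ℝ≥0∞)) +
          X.bar (fun s => ((N⁻¹ : ℝ≥0) : ℝ≥0∞) * ∑ k ∈ Finset.range (n + 1), R k s) :=
        X.bar_add hμ measurable_const (hSm.const_mul _)
      _ ≤ _ := by
        rw [X.bar_const hμ, X.bar_smul hμ _ hSm]
        gcongr
        calc ((N⁻¹ : ℝ≥0) : ℝ≥0∞) * X.bar (fun s => ∑ k ∈ Finset.range (n + 1), R k s)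
            ≤ ((N⁻¹ : ℝ≥0) : ℝ≥0∞) * ∑ k ∈ Finset.range (n + 1), X.bar (R k) := by
              gcongr
              exact X.bar_sum_le hμ hRm _
          _ = ((N⁻¹ : ℝ≥0) : ℝ≥0∞) * (N * X.bar (dyadicGlue F)) := by
              simp only [hR, X.bar_dyadicGlue_fract hFm]
              rw [Finset.sum_const, Finset.card_range, nsmul_eq_mul, hN]
              push_cast
              rfl
          _ = X.bar (dyadicGlue F) := by
              rw [← mul_assoc, ← ENNReal.coe_mul, inv_mul_cancel₀ hN0, ENNReal.coe_one, one_mul]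
  have hlim : Tendsto (fun n : ℕ => (((((n + 1 : ℕ) : ℝ≥0)⁻¹ * M : ℝ≥0) : ℝ≥0∞)) *
      X.norm (fun _ => 1) + X.bar (dyadicGlue F)) atTop
      (𝓝 (((0 * M : ℝ≥0) : ℝ≥0∞) * X.norm (fun _ => 1) + X.bar (dyadicGlue F))) := by
    refine Tendsto.add ?_ tendsto_const_nhds
    refine ENNReal.Tendsto.mul_const (ENNReal.tendsto_coe.2 ?_) (Or.inr X.norm_one.ne)
    refine Tendsto.mul_const _ ?_
    exact (tendsto_inv_atTop_nhds_zero_nat (𝕜 := ℝ≥0)).comp (tendsto_add_atTop_nat 1)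
  have := ge_of_tendsto' hlim key
  simpa using this

theorem bar_dyadicGlue_average_le {F : ℕ → ℝ → ℝ≥0∞} (hF : ∀ i, Antitone (F i)) :
    X.bar (dyadicGlue fun i _ => ∫⁻ y in Ioc (0 : ℝ) 1, F i y) ≤ X.bar (dyadicGlue F) := by
  have hFm : ∀ i, Measurable (F i) := fun i => (hF i).measurable
  -- Truncation at height $M$ reduces to the bounded case; the Fatou property passes to the limit.
  set A : ℕ → ℝ → ℝ≥0∞ := fun M => dyadicGlue fun i _ => ∫⁻ y in Ioc (0 : ℝ) 1, min (F i y) M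
    with hA
  have hAm : ∀ M, Measurable (A M) := fun M => measurable_dyadicGlue fun i => measurable_const
  have hmono : Monotone A := by
    intro a b hab s
    refine ENNReal.tsum_le_tsum fun i => indicator_le_indicator (lintegral_mono fun y => ?_)
    exact min_le_min_left _ (by exact_mod_cast hab)
  calc X.bar (dyadicGlue fun i _ => ∫⁻ y in Ioc (0 : ℝ) 1, F i y)
      ≤ X.bar (fun s => ⨆ M, A M s) := by
        refine X.bar_mono hμ (measurable_dyadicGlue fun i => measurable_const) (.iSup hAm)
          fun s hs => ?_
        obtain ⟨i, hi⟩ := exists_mem_dyadicIoc ⟨hs.1, hs.2.le⟩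
        simp only [hA, dyadicGlue_of_mem _ hi]
        rw [← lintegral_iSup (fun n => (hFm i).min measurable_const)]
        · refine lintegral_mono fun y => ?_
          refine le_of_forall_lt fun c hc => ?_
          obtain ⟨n, hn⟩ := ENNReal.exists_nat_gt hc.ne_top
          exact lt_of_lt_of_le (lt_min hc hn) (le_iSup (fun n : ℕ => min (F i y) n) n)
        · intro a b hab y
          exact min_le_min_left _ (by exact_mod_cast hab)
    _ = ⨆ M, X.bar (A M) := X.bar_iSup hμ hAm hmono
    _ ≤ _ := by
        refine iSup_le fun M => ?_
        refine (X.bar_dyadicGlue_average_le_of_bounded hμ (M := (M : ℝ≥0))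
          (fun i a b hab => min_le_min_right _ (hF i hab))
          fun i x => (min_le_right _ _).trans (by simp)).trans ?_
        refine X.bar_mono hμ (measurable_dyadicGlue fun i => (hFm i).min measurable_const)
          (measurable_dyadicGlue hFm) fun s _ => ?_
        exact ENNReal.tsum_le_tsum fun i => indicator_le_indicator (min_le_left _ _)

/-- Averaging over disjoint sets, whose averages are placed on the dyadic intervals, does not
increase the norm. -/
theorem bar_dyadicGlue_setAverage_le [IsProbabilityMeasure μ] {f : Ω → ℝ≥0∞} (hf : Measurable f)
    {E : ℕ → Set Ω} (hE : ∀ i, MeasurableSet (E i)) (hd : Pairwise (Function.onFun Disjoint E))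
    (hμE : ∀ i, μ (E i) ≤ ENNReal.ofReal ((1 / 2) ^ (i + 1))) :
    X.bar (dyadicGlue fun i _ => ENNReal.ofReal (2 ^ (i + 1)) * ∫⁻ x in E i, f x ∂μ) ≤
      X.norm f := by
  have hp : ∀ i : ℕ, (0 : ℝ) < 2 ^ (i + 1) := fun i => by positivity
  -- The rearrangement of $f\chi_{E_i}$, stretched to $(0,1)$. Gluing shrinks it back, so the pieces
  -- together have a distribution function no larger than that of $f$, the $E_i$ being disjoint.
  set F : ℕ → ℝ → ℝ≥0∞ := fun i x => rearr μ ((E i).indicator f) ((2 ^ (i + 1))⁻¹ * x) with hF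
  have hFa : ∀ i, Antitone (F i) := fun i a b hab =>
    rearr_antitone _ (mul_le_mul_of_nonneg_left hab (inv_pos.2 (hp i)).le)
  calc X.bar (dyadicGlue fun i _ => ENNReal.ofReal (2 ^ (i + 1)) * ∫⁻ x in E i, f x ∂μ)
      ≤ X.bar (dyadicGlue fun i _ => ∫⁻ y in Ioc (0 : ℝ) 1, F i y) := by
        refine X.bar_mono hμ (measurable_dyadicGlue fun i => measurable_const)
          (measurable_dyadicGlue fun i => measurable_const) fun s _ => ?_
        refine ENNReal.tsum_le_tsum fun i => indicator_le_indicator ?_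
        refine bounded_rearr_comp_lintegral hf (hE i) (hp i) ((hμE i).trans (le_of_eq ?_))
        rw [one_div, inv_pow]
    _ ≤ X.bar (dyadicGlue F) := X.bar_dyadicGlue_average_le hμ hFa
    _ ≤ X.norm f := by
        refine X.bar_le_norm_of_distr hμ hf fun t => ?_
        rw [unitVol_dyadicGlue fun i => (hFa i).measurable]
        have hm : MeasurableSet {x | t < f x} := measurableSet_lt measurable_const hf
        calc _ ≤ ∑' i, μ ({x | t < f x} ∩ E i) := by
              refine ENNReal.tsum_le_tsum fun i => ?_
              refine (volume_rearr_scaled_le _ (hp i) t).trans (measure_mono fun x hx => ?_)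
              have hxE : x ∈ E i := by
                by_contra hc
                rw [mem_ofPred_eq, indicator_of_notMem hc] at hx
                exact not_lt_zero hx
              rw [mem_ofPred_eq, indicator_of_mem hxE] at hx
              exact ⟨hx, hxE⟩
          _ = μ (⋃ i, {x | t < f x} ∩ E i) :=
              (measure_iUnion (fun i j hij => (hd hij).mono inter_subset_right inter_subset_right)
                fun i => hm.inter (hE i)).symm
          _ ≤ _ := measure_mono (iUnion_subset fun i => inter_subset_left)

end RISpace

/-! ### The modulus of the gradient. -/

section Gradient

variable {Ω : Type*} [MetricSpace Ω]

theorem IsLip.continuous {f : Ω → ℝ} (hf : IsLip f) : Continuous f := by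
  refine continuous_iff_continuousAt.2 fun x => ?_
  obtain ⟨K, hK⟩ := hf x 1
  exact hK.continuousOn.continuousAt (Metric.ball_mem_nhds x one_pos)

theorem IsLip.comp_lipschitz {f : Ω → ℝ} (hf : IsLip f) {K : ℝ≥0} {φ : ℝ → ℝ}
    (hφ : LipschitzWith K φ) : IsLip (φ ∘ f) := fun x r => by
  obtain ⟨L, hL⟩ := hf x r
  exact ⟨K * L, hφ.comp_lipschitzOnWith hL⟩

theorem gradNorm_le_of_eventually {f g : Ω → ℝ} {x : Ω}
    (h : ∀ᶠ y in 𝓝 x, edist (f x) (f y) ≤ edist (g x) (g y)) : gradNorm f x ≤ gradNorm g x :=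
  limsup_le_limsup ((eventually_nhdsWithin_of_eventually_nhds h).mono fun _ hy =>
    ENNReal.div_le_div_right hy _)

theorem gradNorm_comp_le {f : Ω → ℝ} {φ : ℝ → ℝ} (hφ : LipschitzWith 1 φ) (x : Ω) :
    gradNorm (φ ∘ f) x ≤ gradNorm f x :=
  gradNorm_le_of_eventually (Eventually.of_forall fun y => by simpa using hφ (f x) (f y))

theorem gradNorm_eq_zero_of_eventually {f : Ω → ℝ} {x : Ω} (h : ∀ᶠ y in 𝓝 x, f y = f x) :
    gradNorm f x = 0 := by
  refine nonpos_iff_eq_zero.1 (le_trans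
    (limsup_le_limsup (v := fun _ => 0) ((eventually_nhdsWithin_of_eventually_nhds h).mono
      fun y hy => ?_)) (limsup_le_of_le (by isBoundedDefault) (by simp)))
  simp [hy]

theorem exists_edist_le_of_gradNorm_lt {f : Ω → ℝ} {x : Ω} {c : ℝ≥0∞} (hc : gradNorm f x < c) :
    ∃ r > 0, ∀ y ∈ Metric.ball x r, edist (f x) (f y) ≤ c * edist x y := by
  have h := eventually_nhdsWithin_iff.1 (eventually_lt_of_limsup_lt hc)
  obtain ⟨r, hr, h⟩ := Metric.eventually_nhds_iff_ball.1 h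
  refine ⟨r, hr, fun y hy => ?_⟩
  rcases eq_or_ne y x with rfl | hne
  · simp
  · have := (h y hy hne).le
    rwa [ENNReal.div_le_iff (by simpa using hne.symm) (edist_ne_top _ _)] at this

theorem gradNorm_le_of_forall {f : Ω → ℝ} {x : Ω} {c : ℝ≥0∞}
    (h : ∀ᶠ y in 𝓝 x, edist (f x) (f y) ≤ c * edist x y) : gradNorm f x ≤ c := by
  refine limsup_le_of_le (by isBoundedDefault) ?_
  filter_upwards [eventually_nhdsWithin_of_eventually_nhds h, self_mem_nhdsWithin] with y hy hne
  rwa [ENNReal.div_le_iff (by simpa using Ne.symm hne) (edist_ne_top _ _)]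

/-- The limsup is an infimum over radii $1/(n+1)$ of suprema of difference quotients. Each supremum
is lower semicontinuous: a point $y$ that witnesses a value above $t$ at $x$ still does so at nearby
points. -/
theorem measurable_gradNorm [MeasurableSpace Ω] [BorelSpace Ω] {f : Ω → ℝ} (hf : Continuous f) :
    Measurable (gradNorm f) := by
  have e : gradNorm f = fun x => ⨅ n : ℕ, ⨆ y ∈ Metric.ball x (1 / ((n : ℝ) + 1)) ∩ {x}ᶜ,
      edist (f x) (f y) / edist x y := by
    funext x
    have := (nhdsWithin_hasBasis (Metric.nhds_basis_ball_inv_nat_succ (x := x)) {x}ᶜ).limsup_eq_iInf_iSup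
      (u := fun y => edist (f x) (f y) / edist x y)
    simpa [gradNorm] using this
  rw [e]
  refine Measurable.iInf fun n => measurable_of_Ioi fun t => IsOpen.measurableSet ?_
  refine isOpen_iff_mem_nhds.2 fun x hx => ?_
  simp only [mem_preimage, mem_Ioi, lt_iSup_iff] at hx
  obtain ⟨y, ⟨hy, hyx⟩, ht⟩ := hx
  have hyx' : x ≠ y := Ne.symm hyx
  have hq : Tendsto (fun z => edist (f z) (f y) / edist z y) (𝓝 x)
      (𝓝 (edist (f x) (f y) / edist x y)) :=
    ENNReal.Tendsto.div ((hf.tendsto x).edist tendsto_const_nhds) (Or.inr (by simpa using hyx'))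
      (tendsto_id.edist tendsto_const_nhds) (Or.inl (edist_ne_top _ _))
  have hd : Tendsto (fun z => dist y z) (𝓝 x) (𝓝 (dist y x)) :=
    tendsto_const_nhds.dist tendsto_id
  filter_upwards [hq.eventually_const_lt ht, hd.eventually_lt_const hy,
    isOpen_ne.mem_nhds hyx'] with z h1 h2 h3
  simp only [mem_preimage, mem_Ioi, lt_iSup_iff]
  exact ⟨y, ⟨h2, Ne.symm h3⟩, h1⟩

/-- Enlargements of superlevel sets become superlevel sets of a single function, so the layer cake
formula integrates their measures. -/
theorem thickening_superlevel (f : Ω → ℝ) {t : ℝ} (ht : 0 ≤ t) (h : ℝ) :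
    Metric.thickening h {x | t < f x} =
      {x | ENNReal.ofReal t < ⨆ y ∈ Metric.ball x h, ENNReal.ofReal (f y)} := by
  ext x
  simp only [Metric.mem_thickening_iff, mem_ofPred_eq, lt_iSup_iff, Metric.mem_ball, exists_prop,
    ENNReal.ofReal_lt_ofReal_iff_of_nonneg ht]
  constructor
  · rintro ⟨y, h1, h2⟩; exact ⟨y, by rwa [dist_comm], h1⟩
  · rintro ⟨y, h1, h2⟩; exact ⟨y, h2, by rwa [dist_comm]⟩

end Gradient

/-! ### The coarea inequality. -/

section Coarea

theorem lintegral_eq_lintegral_superlevel {Ω : Type*} [MeasurableSpace Ω] {μ : Measure Ω}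
    {f : Ω → ℝ≥0∞} (hf : Measurable f)
    (hfin : ∀ x, f x ≠ ∞) :
    ∫⁻ x, f x ∂μ = ∫⁻ t in Ioi (0 : ℝ), μ {x | ENNReal.ofReal t < f x} := by
  have := lintegral_eq_lintegral_meas_lt μ (f := fun x => (f x).toReal)
    (Eventually.of_forall fun x => ENNReal.toReal_nonneg) hf.ennreal_toReal.aemeasurable
  simp only [ENNReal.ofReal_toReal (hfin _)] at this
  rw [this]
  refine setLIntegral_congr_fun measurableSet_Ioi fun t ht => ?_
  simp only [ENNReal.ofReal_lt_iff_lt_toReal (le_of_lt ht) (hfin _)]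

variable {Ω : Type*} [MetricSpace Ω] [MeasurableSpace Ω] {μ : Measure Ω}
  {I : ℝ → ℝ}

theorem IsIsoperimetricEstimator.le_minkowskiContent [IsProbabilityMeasure μ]
    (hI : IsIsoperimetricEstimator μ I) {A : Set Ω} (hA : MeasurableSet A) :
    ENNReal.ofReal (I (μ.real A)) ≤ minkowskiContent μ A :=
  (hI.le_profile _ ⟨measureReal_nonneg, measureReal_le_one⟩).trans
    (iInf₂_le A ⟨hA, (ofReal_measureReal).symm⟩)

theorem minkowskiContent_le_liminf (A : Set Ω) {h : ℕ → ℝ} (hh : Tendsto h atTop (𝓝[>] 0)) :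
    minkowskiContent μ A ≤
      liminf (fun n => (μ (Metric.thickening (h n) A) - μ A) / ENNReal.ofReal (h n)) atTop :=
  liminf_le_liminf_of_le (u := fun h : ℝ =>
    (μ (Metric.thickening h A) - μ A) / ENNReal.ofReal h) hh

theorem measurable_iSup_ball [BorelSpace Ω] (f : Ω → ℝ≥0∞) (h : ℝ) :
    Measurable fun x => ⨆ y ∈ Metric.ball x h, f y := by
  refine measurable_of_Ioi fun t => IsOpen.measurableSet ?_
  have : (fun x => ⨆ y ∈ Metric.ball x h, f y) ⁻¹' Ioi t =
      ⋃ y ∈ {y | t < f y}, Metric.ball y h := by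
    ext x
    simp only [mem_preimage, mem_Ioi, lt_iSup_iff, mem_iUnion, exists_prop, mem_ofPred_eq]
    constructor
    · rintro ⟨y, h1, h2⟩; exact ⟨y, h2, Metric.mem_ball_comm.1 h1⟩
    · rintro ⟨y, h1, h2⟩; exact ⟨y, Metric.mem_ball_comm.1 h2, h1⟩
  rw [this]
  exact isOpen_biUnion fun y _ => Metric.isOpen_ball

/-- The coarea inequality for bounded nonnegative Lipschitz functions. -/
theorem IsIsoperimetricEstimator.lintegral_le_of_lipschitz [BorelSpace Ω] [IsProbabilityMeasure μ]
    (hI : IsIsoperimetricEstimator μ I) {f : Ω → ℝ} {L : ℝ≥0} (hf : LipschitzWith L f) {M : ℝ}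
    (hM : ∀ x, f x ≤ M) :
    ∫⁻ t in Ioi (0 : ℝ), ENNReal.ofReal (I (μ.real {x | t < f x})) ≤ ∫⁻ x, gradNorm f x ∂μ := by
  set F : Ω → ℝ≥0∞ := fun x => ENNReal.ofReal (f x) with hF
  set S : ℝ → Ω → ℝ≥0∞ := fun h x => ⨆ y ∈ Metric.ball x h, F y with hS
  set h : ℕ → ℝ := fun n => 1 / ((n : ℝ) + 1) with hh
  have hpos : ∀ n, 0 < h n := fun n => by positivity
  have hlim : Tendsto h atTop (𝓝[>] 0) :=
    tendsto_nhdsWithin_iff.2 ⟨tendsto_one_div_add_atTop_nhds_zero_nat,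
      Eventually.of_forall hpos⟩
  have hFm : Measurable F := hf.continuous.measurable.ennreal_ofReal
  have hSm : ∀ r, Measurable (S r) := measurable_iSup_ball F
  have hFM : ∀ x, F x ≤ ENNReal.ofReal M := fun x => ENNReal.ofReal_le_ofReal (hM x)
  have hSM : ∀ r x, S r x ≤ ENNReal.ofReal M := fun r x => iSup₂_le fun y _ => hFM y
  have hFS : ∀ n x, F x ≤ S (h n) x := fun n x =>
    le_iSup₂ (f := fun y _ => F y) x (Metric.mem_ball_self (hpos n))
  have hSF : ∀ (x : Ω) (c : ℝ≥0∞) (r : ℝ), (∀ y ∈ Metric.ball x r, edist (f x) (f y) ≤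
      c * edist x y) → S r x - F x ≤ c * ENNReal.ofReal r := by
    intro x c r hc
    rw [tsub_le_iff_right]
    refine iSup₂_le fun y hy => ?_
    calc F y ≤ ENNReal.ofReal (|f y - f x| + f x) :=
          ENNReal.ofReal_le_ofReal (by linarith [le_abs_self (f y - f x)])
      _ ≤ ENNReal.ofReal |f y - f x| + F x := ENNReal.ofReal_add_le
      _ ≤ c * ENNReal.ofReal r + F x := by
          gcongr
          rw [← Real.dist_eq, dist_comm, ← edist_dist]
          refine (hc y hy).trans ?_
          gcongr
          rw [edist_dist, dist_comm]
          exact ENNReal.ofReal_le_ofReal (le_of_lt hy)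
  have hthick : ∀ n, ∫⁻ t in Ioi (0 : ℝ), μ (Metric.thickening (h n) {x | t < f x}) =
      ∫⁻ x, S (h n) x ∂μ := by
    intro n
    rw [lintegral_eq_lintegral_superlevel (hSm _)
      fun x => ne_top_of_le_ne_top ENNReal.ofReal_ne_top (hSM _ x)]
    refine setLIntegral_congr_fun measurableSet_Ioi fun t ht => ?_
    simp only [thickening_superlevel f (le_of_lt ht)]
    rfl
  have hlev : ∫⁻ t in Ioi (0 : ℝ), μ {x | t < f x} = ∫⁻ x, F x ∂μ := by
    rw [lintegral_eq_lintegral_superlevel hFm fun x => ENNReal.ofReal_ne_top]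
    refine setLIntegral_congr_fun measurableSet_Ioi fun t ht => ?_
    simp only [hF, ENNReal.ofReal_lt_ofReal_iff_of_nonneg (le_of_lt ht)]
  have hFfin : ∫⁻ x, F x ∂μ ≠ ∞ := by
    refine ne_top_of_le_ne_top ?_ (lintegral_mono hFM)
    simp
  have hm1 : Measurable fun t : ℝ => μ {x | t < f x} :=
    Antitone.measurable fun a b hab => measure_mono fun x hx => lt_of_le_of_lt hab hx
  have hm2 : ∀ r, Measurable fun t : ℝ => μ (Metric.thickening r {x | t < f x}) := fun r =>
    Antitone.measurable fun a b hab => measure_mono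
      (Metric.thickening_subset_of_subset r fun x hx => lt_of_le_of_lt hab hx)
  -- The layer cake formula, applied to $S_hF$ and to $F$. Boundedness of $f$ makes $\int F$ finite,
  -- which the subtraction requires.
  have hquot : ∀ n, ∫⁻ t in Ioi (0 : ℝ),
      (μ (Metric.thickening (h n) {x | t < f x}) - μ {x | t < f x}) / ENNReal.ofReal (h n) =
      ∫⁻ x, (S (h n) x - F x) / ENNReal.ofReal (h n) ∂μ := by
    intro n
    have h1 : Measurable fun t : ℝ =>
        μ (Metric.thickening (h n) {x | t < f x}) - μ {x | t < f x} := (hm2 _).sub hm1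
    have h2 : Measurable fun x => S (h n) x - F x := (hSm _).sub hFm
    simp only [div_eq_mul_inv]
    rw [lintegral_mul_const _ h1, lintegral_mul_const _ h2,
      lintegral_sub hm1 (by rwa [hlev]) (Eventually.of_forall fun t =>
        measure_mono (Metric.self_subset_thickening (hpos n) _)),
      lintegral_sub hFm hFfin (Eventually.of_forall (hFS n)), hthick, hlev]
  -- Fatou is used in the level variable and reverse Fatou on $\Omega$. The latter needs a
  -- dominating function, here the global Lipschitz constant.
  calc ∫⁻ t in Ioi (0 : ℝ), ENNReal.ofReal (I (μ.real {x | t < f x}))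
      ≤ ∫⁻ t in Ioi (0 : ℝ), liminf (fun n => (μ (Metric.thickening (h n) {x | t < f x}) -
          μ {x | t < f x}) / ENNReal.ofReal (h n)) atTop :=
        lintegral_mono fun t => (hI.le_minkowskiContent
          (measurableSet_lt measurable_const hf.continuous.measurable)).trans
          (minkowskiContent_le_liminf _ hlim)
    _ ≤ liminf (fun n => ∫⁻ t in Ioi (0 : ℝ), (μ (Metric.thickening (h n) {x | t < f x}) -
          μ {x | t < f x}) / ENNReal.ofReal (h n)) atTop :=
        lintegral_liminf_le fun n => ((hm2 _).sub hm1).div_const _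
    _ = liminf (fun n => ∫⁻ x, (S (h n) x - F x) / ENNReal.ofReal (h n) ∂μ) atTop := by
        simp only [hquot]
    _ ≤ limsup (fun n => ∫⁻ x, (S (h n) x - F x) / ENNReal.ofReal (h n) ∂μ) atTop :=
        liminf_le_limsup
    _ ≤ ∫⁻ x, limsup (fun n => (S (h n) x - F x) / ENNReal.ofReal (h n)) atTop ∂μ := by
        refine limsup_lintegral_le (fun _ => (L : ℝ≥0∞))
          (fun n => ((hSm _).sub hFm).div_const _) (fun n => Eventually.of_forall fun x => ?_)
          (by simp)
        refine ENNReal.div_le_of_le_mul ?_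
        exact hSF x L (h n) fun y _ => hf x y
    _ ≤ ∫⁻ x, gradNorm f x ∂μ := by
        refine lintegral_mono fun x => le_of_forall_gt_imp_ge_of_dense fun c hc => ?_
        obtain ⟨r, hr, hrc⟩ := exists_edist_le_of_gradNorm_lt hc
        refine limsup_le_of_le (by isBoundedDefault) ?_
        filter_upwards [hlim.eventually (Ioo_mem_nhdsGT hr)] with n hn
        refine ENNReal.div_le_of_le_mul (hSF x c (h n) fun y hy => ?_)
        exact hrc y (Metric.ball_subset_ball hn.2.le hy)

end Coarea

section Coarea

variable {Ω : Type*} [MetricSpace Ω] [MeasurableSpace Ω] [BorelSpace Ω] {μ : Measure Ω}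
  {I : ℝ → ℝ}

omit [BorelSpace Ω] in
theorem IsIsoperimetricEstimator.measurable_indicator (hI : IsIsoperimetricEstimator μ I) :
    Measurable ((Icc 0 1).indicator I) := by
  classical
  rw [← piecewise_eq_indicator]
  exact hI.continuousOn.measurable_piecewise continuousOn_const measurableSet_Icc

/-- The coarea inequality for bounded nonnegative functions in `Lip(Ω)`. -/
theorem IsIsoperimetricEstimator.lintegral_le_of_bounded [IsProbabilityMeasure μ]
    (hI : IsIsoperimetricEstimator μ I) {f : Ω → ℝ} (hf : IsLip f) (h0 : ∀ x, 0 ≤ f x) {M : ℝ≥0}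
    (hM : ∀ x, f x ≤ M) :
    ∫⁻ t in Ioi (0 : ℝ), ENNReal.ofReal (I (μ.real {x | t < f x})) ≤ ∫⁻ x, gradNorm f x ∂μ := by
  obtain ⟨x₀⟩ : Nonempty Ω := nonempty_of_isProbabilityMeasure μ
  -- An $M$-Lipschitz cutoff, equal to $M$ on the ball of radius $n$ and to $0$ beyond $n+1$;
  -- $\min(f,\psi_n)$ is globally Lipschitz.
  set ψ : ℕ → Ω → ℝ := fun n x => max 0 (min M (M * (n + 1 - dist x x₀))) with hψ
  set u : ℕ → Ω → ℝ := fun n x => min (f x) (ψ n x) with hu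
  have hM0 : (0 : ℝ) ≤ M := M.2
  have hψ0 : ∀ n x, 0 ≤ ψ n x := fun n x => le_max_left _ _
  have hψM : ∀ n x, ψ n x ≤ M := fun n x => max_le hM0 (min_le_left _ _)
  have hu0 : ∀ n x, 0 ≤ u n x := fun n x => le_min (h0 x) (hψ0 n x)
  have hψL : ∀ n x y, |ψ n x - ψ n y| ≤ M * dist x y := by
    intro n x y
    calc |ψ n x - ψ n y|
        ≤ |min (M : ℝ) (M * (n + 1 - dist x x₀)) - min (M : ℝ) (M * (n + 1 - dist y x₀))| := by
          simpa using abs_max_sub_max_le_max (0 : ℝ) (min (M : ℝ) (M * (n + 1 - dist x x₀))) 0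
            (min (M : ℝ) (M * (n + 1 - dist y x₀)))
      _ ≤ |M * (n + 1 - dist x x₀) - M * (n + 1 - dist y x₀)| := by
          simpa using abs_min_sub_min_le_max (M : ℝ) (M * (n + 1 - dist x x₀)) M
            (M * (n + 1 - dist y x₀))
      _ = M * |dist y x₀ - dist x x₀| := by
          rw [← mul_sub, abs_mul, abs_of_nonneg hM0]; ring_nf
      _ ≤ M * dist x y := by
          gcongr
          rw [dist_comm x y]
          exact abs_dist_sub_le y x x₀
  have huL : ∀ n x y, |u n x - u n y| ≤ max |f x - f y| |ψ n x - ψ n y| := fun n x y =>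
    abs_min_sub_min_le_max _ _ _ _
  have hψnear : ∀ (n : ℕ) x, dist x x₀ ≤ n → u n x = f x := by
    intro n x hx
    have : ψ n x = M := by
      have h1 : (M : ℝ) ≤ M * (n + 1 - dist x x₀) := le_mul_of_one_le_right hM0 (by linarith)
      simp only [hψ, min_eq_left h1, max_eq_right hM0]
    simp only [hu, this, min_eq_left (hM x)]
  have hufar : ∀ (n : ℕ) x, (n : ℝ) + 1 ≤ dist x x₀ → u n x = 0 := by
    intro n x hx
    have : ψ n x = 0 := max_eq_left ((min_le_right _ _).trans
      (mul_nonpos_of_nonneg_of_nonpos hM0 (by linarith)))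
    simp only [hu, this, min_eq_right (h0 x)]
  have hulip : ∀ n, ∃ K : ℝ≥0, LipschitzWith K (u n) := by
    intro n
    -- The radius $n+3$ leaves a gap: a point beyond it has distance at least $1$ from the points
    -- where $u_n$ can be nonzero, and there $u_n\le M$ already gives the Lipschitz bound.
    obtain ⟨K, hK⟩ := hf x₀ (n + 3)
    refine ⟨max K M, LipschitzWith.of_le_add_mul _ fun y x => ?_⟩
    have hd : 0 ≤ dist y x := dist_nonneg
    have hmM : (M : ℝ) ≤ (max K M : ℝ≥0) := by exact_mod_cast le_max_right K M
    have hmK : (K : ℝ) ≤ (max K M : ℝ≥0) := by exact_mod_cast le_max_left K M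
    rcases le_or_gt ((n : ℝ) + 1) (dist y x₀) with hy | hy
    · rw [hufar n y hy]
      exact add_nonneg (hu0 n x) (mul_nonneg (NNReal.coe_nonneg _) hd)
    rcases lt_or_ge (dist x x₀) (n + 3) with hx | hx
    · have h1 : |f y - f x| ≤ K * dist y x := by
        rw [← Real.dist_eq]
        exact hK.dist_le_mul y (by rw [Metric.mem_ball]; linarith) x hx
      have h2 := (huL n y x).trans (max_le_max h1 (hψL n y x))
      have h3 : max (K * dist y x) (M * dist y x) ≤ (max K M : ℝ≥0) * dist y x :=
        max_le (by gcongr) (by gcongr)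
      linarith [le_abs_self (u n y - u n x)]
    · have h1 : 1 ≤ dist y x := by
        have := dist_triangle_left x x₀ y
        linarith
      have h2 : u n y ≤ M := (min_le_left _ _).trans (hM y)
      have h3 : (M : ℝ) * 1 ≤ (max K M : ℝ≥0) * dist y x := by gcongr
      linarith [hu0 n x]
  -- The cutoff adds slope at most $M$, and only at distance at least $n$ from $x_0$, a set whose
  -- measure tends to $0$.
  have hugrad : ∀ n x, gradNorm (u n) x ≤
      gradNorm f x + {x | (n : ℝ) ≤ dist x x₀}.indicator (fun _ => (M : ℝ≥0∞)) x := by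
    intro n x
    rcases lt_or_ge (dist x x₀) n with hx | hx
    · refine le_add_right (gradNorm_le_of_eventually ?_)
      filter_upwards [Metric.isOpen_ball.mem_nhds (show x ∈ Metric.ball x₀ n from hx)] with y hy
      rw [hψnear n x hx.le, hψnear n y (le_of_lt hy)]
    · rw [indicator_of_mem (show x ∈ {x | (n : ℝ) ≤ dist x x₀} from hx), ← tsub_le_iff_right]
      refine le_of_forall_gt_imp_ge_of_dense fun c hc => ?_
      rw [tsub_le_iff_right]
      obtain ⟨r, hr, hrc⟩ := exists_edist_le_of_gradNorm_lt hc
      refine gradNorm_le_of_forall ?_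
      filter_upwards [Metric.ball_mem_nhds x hr] with y hy
      calc edist (u n x) (u n y) ≤ edist (f x) (f y) + M * edist x y := by
            rw [edist_dist, edist_dist, Real.dist_eq, Real.dist_eq, edist_dist,
              ← ENNReal.ofReal_coe_nnreal, ← ENNReal.ofReal_mul hM0,
              ← ENNReal.ofReal_add (abs_nonneg _) (by positivity)]
            refine ENNReal.ofReal_le_ofReal ((huL n x y).trans (max_le ?_ ?_))
            · have : 0 ≤ M * dist x y := by positivity
              linarith
            · linarith [hψL n x y, abs_nonneg (f x - f y)]
        _ ≤ (c + M) * edist x y := by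
            rw [add_mul]
            gcongr
            exact hrc y hy
  have hfm : Measurable (gradNorm f) := measurable_gradNorm hf.continuous
  have hfarm : ∀ n : ℕ, MeasurableSet {x | (n : ℝ) ≤ dist x x₀} := fun n =>
    measurableSet_le measurable_const (continuous_id.dist continuous_const).measurable
  have hstep : ∀ n, ∫⁻ t in Ioi (0 : ℝ), ENNReal.ofReal (I (μ.real {x | t < u n x})) ≤
      ∫⁻ x, gradNorm f x ∂μ + M * μ {x | (n : ℝ) ≤ dist x x₀} := by
    intro n
    obtain ⟨K, hK⟩ := hulip n
    refine (hI.lintegral_le_of_lipschitz hK (M := M)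
      fun x => (min_le_left _ _).trans (hM x)).trans ?_
    refine (lintegral_mono (hugrad n)).trans ?_
    rw [lintegral_add_left hfm, lintegral_indicator_const (hfarm n)]
  have htail : Tendsto (fun n : ℕ => ∫⁻ x, gradNorm f x ∂μ + M * μ {x | (n : ℝ) ≤ dist x x₀}) atTop
      (𝓝 (∫⁻ x, gradNorm f x ∂μ)) := by
    have h1 : Tendsto (fun n : ℕ => μ {x | (n : ℝ) ≤ dist x x₀}) atTop
        (𝓝 (μ (⋂ n : ℕ, {x | (n : ℝ) ≤ dist x x₀}))) :=
      tendsto_measure_iInter_atTop (fun n => (hfarm n).nullMeasurableSet)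
        (fun a b hab x hx => le_trans (by exact_mod_cast hab) (show (b : ℝ) ≤ dist x x₀ from hx))
        ⟨0, measure_ne_top _ _⟩
    have h2 : (⋂ n : ℕ, {x | (n : ℝ) ≤ dist x x₀}) = ∅ := by
      ext x
      simp only [mem_iInter, mem_ofPred_eq, mem_empty_iff_false, iff_false, not_forall, not_le]
      exact exists_nat_gt _
    rw [h2, measure_empty] at h1
    simpa using tendsto_const_nhds.add
      (ENNReal.Tendsto.const_mul h1 (Or.inr (ENNReal.coe_ne_top (r := M))))
  have hlev : ∀ t : ℝ, Tendsto (fun n => ENNReal.ofReal (I (μ.real {x | t < u n x}))) atTop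
      (𝓝 (ENNReal.ofReal (I (μ.real {x | t < f x})))) := by
    intro t
    have hmono : Monotone fun n => {x | t < u n x} := by
      intro a b hab x hx
      refine lt_of_lt_of_le (show t < u a x from hx) (min_le_min_left _ (max_le_max_left _
        (min_le_min_left _ (mul_le_mul_of_nonneg_left ?_ hM0))))
      have : (a : ℝ) ≤ b := by exact_mod_cast hab
      linarith
    have hunion : ⋃ n, {x | t < u n x} = {x | t < f x} := by
      ext x
      simp only [mem_iUnion, mem_ofPred_eq]
      constructor
      · rintro ⟨n, hn⟩; exact lt_of_lt_of_le hn (min_le_left _ _)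
      · intro hx
        obtain ⟨n, hn⟩ := exists_nat_ge (dist x x₀)
        exact ⟨n, by rwa [hψnear n x hn]⟩
    have h1 := tendsto_measure_iUnion_atTop (μ := μ) hmono
    rw [hunion] at h1
    have h2 : Tendsto (fun n => μ.real {x | t < u n x}) atTop (𝓝 (μ.real {x | t < f x})) :=
      (ENNReal.tendsto_toReal (measure_ne_top _ _)).comp h1
    refine ENNReal.tendsto_ofReal ?_
    refine (hI.continuousOn _ ⟨measureReal_nonneg, measureReal_le_one⟩).tendsto.comp ?_
    exact tendsto_nhdsWithin_iff.2 ⟨h2, Eventually.of_forall fun n =>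
      ⟨measureReal_nonneg, measureReal_le_one⟩⟩
  have hImeas : ∀ n, AEMeasurable (fun t => ENNReal.ofReal (I (μ.real {x | t < u n x})))
      (volume.restrict (Ioi 0)) := by
    intro n
    have hD : Measurable fun t => μ.real {x | t < u n x} :=
      Antitone.measurable fun a b hab => measureReal_mono fun x hx => lt_of_le_of_lt hab hx
    have : (fun t => ENNReal.ofReal (I (μ.real {x | t < u n x}))) =
        fun t => ENNReal.ofReal ((Icc 0 1).indicator I (μ.real {x | t < u n x})) := by
      funext t
      rw [indicator_of_mem (show _ ∈ Icc (0 : ℝ) 1 from ⟨measureReal_nonneg, measureReal_le_one⟩)]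
    rw [this]
    exact (hI.measurable_indicator.comp hD).ennreal_ofReal.aemeasurable
  calc ∫⁻ t in Ioi (0 : ℝ), ENNReal.ofReal (I (μ.real {x | t < f x}))
      = ∫⁻ t in Ioi (0 : ℝ), liminf (fun n => ENNReal.ofReal (I (μ.real {x | t < u n x}))) atTop :=
        lintegral_congr fun t => (hlev t).liminf_eq.symm
    _ ≤ liminf (fun n => ∫⁻ t in Ioi (0 : ℝ), ENNReal.ofReal (I (μ.real {x | t < u n x}))) atTop :=
        lintegral_liminf_le' hImeas
    _ ≤ liminf (fun n : ℕ => ∫⁻ x, gradNorm f x ∂μ + M * μ {x | (n : ℝ) ≤ dist x x₀}) atTop :=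
        liminf_le_liminf (Eventually.of_forall hstep)
    _ = ∫⁻ x, gradNorm f x ∂μ := htail.liminf_eq

/-- The coarea inequality between two levels of a function in `Lip(Ω)`. -/
theorem IsIsoperimetricEstimator.lintegral_le_setLIntegral_gradNorm
    (hΩ : IsMetricProbabilitySpace μ) (hI : IsIsoperimetricEstimator μ I) {f : Ω → ℝ}
    (hf : IsLip f) {a b : ℝ} (hab : a ≤ b) :
    ∫⁻ t in Ioo a b, ENNReal.ofReal (I (μ.real {x | t < f x})) ≤
      ∫⁻ x in {x | a < f x ∧ f x < b}, gradNorm f x ∂μ := by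
  have := hΩ.probability
  -- For $0<t<b-a$ one has $\varphi(f)>t$ exactly when $f>t+a$, so the bounded case applied to
  -- $\varphi\circ f$ covers the levels between $a$ and $b$.
  set φ : ℝ → ℝ := fun r => max 0 (min (b - a) (r - a)) with hφ
  have hφL : LipschitzWith 1 φ := by
    refine LipschitzWith.of_dist_le_mul fun r s => ?_
    rw [Real.dist_eq, Real.dist_eq, NNReal.coe_one, one_mul]
    calc |φ r - φ s| ≤ |min (b - a) (r - a) - min (b - a) (s - a)| := by
          simpa using abs_max_sub_max_le_max (0 : ℝ) (min (b - a) (r - a)) 0 (min (b - a) (s - a))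
      _ ≤ |r - a - (s - a)| := by
          simpa using abs_min_sub_min_le_max (b - a) (r - a) (b - a) (s - a)
      _ = |r - s| := by ring_nf
  have hc := hf.continuous
  have hm : MeasurableSet {x | a < f x ∧ f x < b} :=
    ((isOpen_lt continuous_const hc).inter (isOpen_lt hc continuous_const)).measurableSet
  have h1 := hI.lintegral_le_of_bounded (hf.comp_lipschitz hφL) (M := ⟨b - a, sub_nonneg.2 hab⟩)
    (fun x => le_max_left _ _)
    (fun x => max_le (sub_nonneg.2 hab) (min_le_left _ _))
  have h2 : ∫⁻ t in Ioo a b, ENNReal.ofReal (I (μ.real {x | t < f x})) =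
      ∫⁻ t in Ioo 0 (b - a), ENNReal.ofReal (I (μ.real {x | t < (φ ∘ f) x})) := by
    have := (measurePreserving_add_right (volume : Measure ℝ) a).setLIntegral_comp_preimage_emb
      (measurableEmbedding_addRight a)
      (fun t => ENNReal.ofReal (I (μ.real {x | t < f x}))) (Ioo a b)
    rw [← this, preimage_add_const_Ioo, sub_self]
    refine setLIntegral_congr_fun measurableSet_Ioo fun t ht => ?_
    have e : {x | t + a < f x} = {x | t < (φ ∘ f) x} := by
      ext x
      simp only [mem_ofPred_eq, Function.comp, hφ, lt_max_iff, lt_min_iff]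
      constructor
      · intro h; exact Or.inr ⟨ht.2, by linarith⟩
      · rintro (h | h)
        · exact absurd h (not_lt.2 ht.1.le)
        · linarith [h.2]
    simp only [e]
  rw [h2, ← lintegral_indicator hm]
  refine (lintegral_mono_set Ioo_subset_Ioi_self).trans (h1.trans (lintegral_mono_ae ?_))
  -- Off the band, $\varphi\circ f$ is locally constant where $f<a$ or $f>b$; on $\{f=a\}$ and
  -- $\{f=b\}$ the gradient vanishes almost everywhere by the standing condition.
  filter_upwards [hΩ.grad_level f hf a, hΩ.grad_level f hf b] with x ha hb
  by_cases hx : a < f x ∧ f x < b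
  · rw [indicator_of_mem (show x ∈ {x | a < f x ∧ f x < b} from hx)]
    exact gradNorm_comp_le hφL x
  · rw [indicator_of_notMem (show x ∉ {x | a < f x ∧ f x < b} from hx)]
    rcases lt_trichotomy (f x) a with h | h | h
    · refine (gradNorm_eq_zero_of_eventually ?_).le
      filter_upwards [(isOpen_lt hc continuous_const).mem_nhds (show x ∈ {x | f x < a} from h)]
        with y hy
      have e : ∀ z, f z < a → (φ ∘ f) z = 0 := fun z hz =>
        max_eq_left ((min_le_right _ _).trans (by linarith))
      rw [e y hy, e x h]
    · exact (gradNorm_comp_le hφL x).trans (ha h).le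
    · have h' : b ≤ f x := not_lt.1 fun hlt => hx ⟨h, hlt⟩
      rcases h'.eq_or_lt with he | hlt
      · exact (gradNorm_comp_le hφL x).trans (hb he.symm).le
      · refine (gradNorm_eq_zero_of_eventually ?_).le
        filter_upwards [(isOpen_lt continuous_const hc).mem_nhds (show x ∈ {x | b < f x} from hlt)]
          with y hy
        have e : ∀ z, b < f z → (φ ∘ f) z = b - a := fun z hz => by
          simp only [Function.comp, hφ, min_eq_left (show b - a ≤ f z - a by linarith),
            max_eq_right (sub_nonneg.2 hab)]
        rw [e y hy, e x hlt]

end Coarea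

/-! ### Elementary properties of isoperimetric estimators. -/

namespace IsIsoperimetricEstimator

variable {Ω : Type*} [MetricSpace Ω] [MeasurableSpace Ω] {μ : Measure Ω} {I : ℝ → ℝ}
variable (hI : IsIsoperimetricEstimator μ I)
include hI

theorem one : I 1 = 0 := by
  have := hI.symm 0 ⟨le_rfl, zero_le_one⟩
  rwa [sub_zero, hI.zero] at this

theorem nonneg {t : ℝ} (ht : t ∈ Icc (0 : ℝ) 1) : 0 ≤ I t := by
  rcases ht.1.eq_or_lt with rfl | h0
  · exact hI.zero.ge
  rcases ht.2.eq_or_lt with rfl | h1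
  · exact hI.one.ge
  exact (hI.pos t ⟨h0, h1⟩).le

/-- $t$ lies between $s$ and $1-s$, where $I$ takes equal values, and $I$ is concave. Unlike the
field `monotoneOn`, this includes the end points. -/
theorem mono {s t : ℝ} (hs : 0 ≤ s) (hst : s ≤ t) (ht : t ≤ 1 / 2) : I s ≤ I t := by
  have hs1 : s ∈ Icc (0 : ℝ) 1 := ⟨hs, by linarith⟩
  have := hI.concaveOn.min_le_of_mem_Icc hs1 (y := 1 - s) ⟨by linarith, by linarith⟩
    (z := t) ⟨hst, by linarith⟩
  rwa [hI.symm s hs1, min_self] at this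

theorem le_half {t : ℝ} (ht : t ∈ Icc (0 : ℝ) 1) : I t ≤ I (1 / 2) := by
  rcases le_total t (1 / 2) with h | h
  · exact hI.mono ht.1 h le_rfl
  · rw [← hI.symm t ht]
    exact hI.mono (by linarith [ht.2]) (by linarith) le_rfl

/-- Concavity with $I(0)=0$. The product form stays meaningful at $s=0$, where level sets of measure
zero occur. -/
theorem mul_le {s t : ℝ} (hs : 0 ≤ s) (hst : s ≤ t) (ht : t ≤ 1) : s * I t ≤ t * I s := by
  rcases hs.eq_or_lt with rfl | h0
  · simp [hI.zero]
  have htp : 0 < t := h0.trans_le hst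
  have := hI.concaveOn.2 (show t ∈ Icc (0 : ℝ) 1 from ⟨htp.le, ht⟩)
    (show (0 : ℝ) ∈ Icc (0 : ℝ) 1 from ⟨le_rfl, zero_le_one⟩) (show 0 ≤ s / t by positivity)
    (show 0 ≤ 1 - s / t by rw [sub_nonneg, div_le_one htp]; exact hst) (by ring)
  simp only [smul_eq_mul, hI.zero, mul_zero, add_zero, div_mul_cancel₀ s htp.ne'] at this
  rw [div_mul_eq_mul_div, div_le_iff₀ htp] at this
  linarith

theorem div_le_div {s t : ℝ} (hs : 0 < s) (hst : s ≤ t) (ht : t ≤ 1) : I t / t ≤ I s / s := by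
  rw [div_le_div_iff₀ (hs.trans_le hst) hs]
  linarith [hI.mul_le hs.le hst ht]

/-- An estimator is arbitrary outside $[0,1]$; its extension by zero is measurable on $\mathbb R$.
-/
theorem indicator : IsIsoperimetricEstimator μ ((Icc 0 1).indicator I) := by
  have e : EqOn ((Icc 0 1).indicator I) I (Icc 0 1) := fun t ht => indicator_of_mem ht I
  have hs : Ioo (0 : ℝ) (1 / 2) ⊆ Icc 0 1 := fun t ht => ⟨ht.1.le, by linarith [ht.2]⟩
  refine ⟨hI.continuousOn.congr e, hI.concaveOn.congr e.symm, hI.monotoneOn.congr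
    (e.mono hs).symm, fun t ht => ?_, ?_, fun t ht => ?_, fun t ht => ?_⟩
  · rw [e ht, e ⟨by linarith [ht.2], by linarith [ht.1]⟩, hI.symm t ht]
  · rw [e ⟨le_rfl, zero_le_one⟩, hI.zero]
  · rw [e (Ioo_subset_Icc_self ht)]; exact hI.pos t ht
  · rw [e ht]; exact hI.le_profile t ht

end IsIsoperimetricEstimator

/-! ### Dyadic bands and increments of the rearrangement. -/

section Bands

/-- The set where `F` lies strictly between two consecutive dyadic values of its rearrangement. -/
def dyadicBand {Ω : Type*} [MeasurableSpace Ω] (μ : Measure Ω) (F : Ω → ℝ≥0∞) (j : ℕ) : Set Ω :=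
  {x | rearr μ F ((1 / 2) ^ j) < F x ∧ F x < rearr μ F ((1 / 2) ^ (j + 1))}

section Measure

variable {Ω : Type*} [MeasurableSpace Ω] {μ : Measure Ω}

theorem measurableSet_dyadicBand {F : Ω → ℝ≥0∞} (hF : Measurable F) (j : ℕ) :
    MeasurableSet (dyadicBand μ F j) :=
  (measurableSet_lt measurable_const hF).inter (measurableSet_lt hF measurable_const)

theorem measure_dyadicBand_le (F : Ω → ℝ≥0∞) (j : ℕ) :
    μ (dyadicBand μ F j) ≤ ENNReal.ofReal ((1 / 2) ^ j) :=
  (measure_mono fun _ hx => hx.1).trans (measure_rearr_lt_le F _)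

theorem pairwise_disjoint_dyadicBand (F : Ω → ℝ≥0∞) :
    Pairwise (Function.onFun Disjoint (dyadicBand μ F)) := by
  have key : ∀ i j, i < j → Disjoint (dyadicBand μ F i) (dyadicBand μ F j) := by
    intro i j hij
    refine Set.disjoint_left.2 fun x hi hj => ?_
    refine lt_irrefl (F x) (hi.2.trans_le (le_trans ?_ hj.1.le))
    exact rearr_antitone F (pow_le_pow_of_le_one (by norm_num) (by norm_num) hij)
  intro i j hij
  rcases lt_or_gt_of_ne hij with h | h
  · exact key i j h
  · exact (key j i h).symm

/-- The averages of `G` over the dyadic bands of `F`, moved to the dyadic intervals. -/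
def bandAverage (μ : Measure Ω) (F G : Ω → ℝ≥0∞) : ℝ → ℝ≥0∞ :=
  dyadicGlue fun i _ => ENNReal.ofReal (2 ^ (i + 1)) * ∫⁻ x in dyadicBand μ F (i + 1), G x ∂μ

theorem measurable_bandAverage (F G : Ω → ℝ≥0∞) : Measurable (bandAverage μ F G) :=
  measurable_dyadicGlue fun _ => measurable_const

theorem RISpace.bar_bandAverage_le [IsProbabilityMeasure μ] (X : RISpace μ)
    (hμ : ∃ U : Ω → ℝ, MeasurePreserving U μ unitVol)
    {F G : Ω → ℝ≥0∞} (hF : Measurable F) (hG : Measurable G) :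
    X.bar (bandAverage μ F G) ≤ X.norm G :=
  X.bar_dyadicGlue_setAverage_le hμ hG (fun i => measurableSet_dyadicBand hF (i + 1))
    (fun i j hij => pairwise_disjoint_dyadicBand F (by simpa using hij))
    fun i => measure_dyadicBand_le F (i + 1)

theorem measureReal_superlevel_le {f : Ω → ℝ} {s τ : ℝ} (hs : 0 ≤ s)
    (hfin : rearr μ (fun x => ‖f x‖ₑ) s ≠ ∞)
    (h : (rearr μ (fun x => ‖f x‖ₑ) s).toReal ≤ τ) : μ.real {x | τ < f x} ≤ s := by
  refine ENNReal.toReal_le_of_le_ofReal hs (le_trans (measure_mono fun x hx => ?_)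
    ((rearr_le_iff _ (ENNReal.ofReal τ) s).1 ((ENNReal.le_ofReal_iff_toReal_le hfin
      (le_trans ENNReal.toReal_nonneg h)).2 h)))
  have hx' : τ < f x := hx
  have hτ : 0 ≤ τ := le_trans ENNReal.toReal_nonneg h
  rw [mem_ofPred_eq, Real.enorm_of_nonneg (hτ.trans hx'.le)]
  exact (ENNReal.ofReal_lt_ofReal_iff_of_nonneg hτ).2 hx'

theorem lt_measureReal_superlevel [IsProbabilityMeasure μ] {f : Ω → ℝ} (h0 : ∀ x, 0 ≤ f x)
    {s τ : ℝ} (hτ : 0 ≤ τ)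
    (h : τ < (rearr μ (fun x => ‖f x‖ₑ) s).toReal) : s < μ.real {x | τ < f x} := by
  have h1 : ENNReal.ofReal τ < rearr μ (fun x => ‖f x‖ₑ) s :=
    (ENNReal.ofReal_lt_iff_lt_toReal hτ fun hc => by simp [hc] at h; linarith).2 h
  rw [lt_rearr_iff] at h1
  have e : {x | ENNReal.ofReal τ < ‖f x‖ₑ} = {x | τ < f x} := by
    ext x
    simp only [mem_ofPred_eq, Real.enorm_of_nonneg (h0 x),
      ENNReal.ofReal_lt_ofReal_iff_of_nonneg hτ]
  rw [e] at h1
  rcases lt_or_ge s 0 with hs | hs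
  · exact hs.trans_le measureReal_nonneg
  · exact (ENNReal.ofReal_lt_iff_lt_toReal hs (measure_ne_top _ _)).1 h1

/-- `∫_0^t (f^*(s) - f^*(t)) ds ≤ ∫_{f^*(t)}^∞ μ {f > τ} dτ`. -/
theorem lintegral_rearr_sub_le [IsProbabilityMeasure μ] {f : Ω → ℝ} (hf : Measurable f)
    (h0 : ∀ x, 0 ≤ f x) {t : ℝ} (ht : t ≤ 1) {c : ℝ} (hc0 : 0 ≤ c)
    (hc : ENNReal.ofReal c ≤ rearr μ (fun x => ‖f x‖ₑ) t) :
    ∫⁻ s in Ioo 0 t, (rearr μ (fun x => ‖f x‖ₑ) s - rearr μ (fun x => ‖f x‖ₑ) t) ≤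
      ∫⁻ τ in Ioi c, μ {x | τ < f x} := by
  have hFm : Measurable fun x => ‖f x‖ₑ := hf.enorm
  -- Lowering the subtracted level to $c$ and integrating over all of $(0,1)$ only increases the
  -- integral, which then depends on the law of $f$ alone.
  calc ∫⁻ s in Ioo 0 t, (rearr μ (fun x => ‖f x‖ₑ) s - rearr μ (fun x => ‖f x‖ₑ) t)
      ≤ ∫⁻ s in Ioo 0 1, (rearr μ (fun x => ‖f x‖ₑ) s - ENNReal.ofReal c) :=
        (lintegral_mono_set (Ioo_subset_Ioo_right ht)).trans
          (lintegral_mono fun s => tsub_le_tsub_left hc _)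
    _ = ∫⁻ x, (‖f x‖ₑ - ENNReal.ofReal c) ∂μ :=
        lintegral_comp_rearr hFm (Φ := fun y => y - ENNReal.ofReal c)
          (measurable_id.sub_const _)
    _ = ∫⁻ τ in Ioi (0 : ℝ), μ {x | ENNReal.ofReal τ < ‖f x‖ₑ - ENNReal.ofReal c} :=
        lintegral_eq_lintegral_superlevel (hFm.sub_const _) fun x =>
          ENNReal.sub_ne_top (by simp)
    _ = ∫⁻ τ in Ioi (0 : ℝ), μ {x | τ + c < f x} := by
        refine setLIntegral_congr_fun measurableSet_Ioi fun τ hτ => ?_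
        have hτ' : (0 : ℝ) < τ := hτ
        simp only [Real.enorm_of_nonneg (h0 _), ← ENNReal.ofReal_sub _ hc0,
          ENNReal.ofReal_lt_ofReal_iff_of_nonneg hτ'.le, lt_sub_iff_add_lt]
    _ = ∫⁻ τ in Ioi c, μ {x | τ < f x} := by
        have := (measurePreserving_add_right (volume : Measure ℝ) c).setLIntegral_comp_preimage_emb
          (measurableEmbedding_addRight c) (fun t => μ {x | t < f x}) (Ioi c)
        rw [← this, preimage_add_const_Ioi, sub_self]

end Measure

variable {Ω : Type*} [MetricSpace Ω] [MeasurableSpace Ω] [BorelSpace Ω] {μ : Measure Ω} {I : ℝ → ℝ}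
variable (hΩ : IsMetricProbabilitySpace μ) (hI : IsIsoperimetricEstimator μ I)
include hΩ hI

theorem lintegral_Ioo_rearr_le {f : Ω → ℝ} (hf : IsLip f) (h0 : ∀ x, 0 ≤ f x) {s s' : ℝ}
    (hs' : 0 < s') (hss : s' ≤ s) :
    ∫⁻ τ in Ioo (rearr μ (fun x => ‖f x‖ₑ) s).toReal (rearr μ (fun x => ‖f x‖ₑ) s').toReal,
        ENNReal.ofReal (I (μ.real {x | τ < f x})) ≤
      ∫⁻ x in {x | rearr μ (fun x => ‖f x‖ₑ) s < ‖f x‖ₑ ∧ ‖f x‖ₑ < rearr μ (fun x => ‖f x‖ₑ) s'},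
        gradNorm f x ∂μ := by
  have := hΩ.probability
  have hfin : ∀ r, 0 < r → rearr μ (fun x => ‖f x‖ₑ) r ≠ ∞ := fun r hr =>
    (rearr_lt_top hf.continuous.measurable.enorm (fun x => enorm_ne_top) hr).ne
  refine (hI.lintegral_le_setLIntegral_gradNorm hΩ hf (ENNReal.toReal_mono (hfin _ hs')
    (rearr_antitone _ hss))).trans (le_of_eq ?_)
  congr 2
  ext x
  simp only [mem_ofPred_eq, Real.enorm_of_nonneg (h0 x)]
  rw [ENNReal.lt_ofReal_iff_toReal_lt (hfin s (hs'.trans_le hss)),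
    ENNReal.ofReal_lt_iff_lt_toReal (h0 x) (hfin s' hs')]

/-- The increment of the rearrangement between consecutive dyadic points. -/
theorem rearr_dyadic_step {f : Ω → ℝ} (hf : IsLip f) (h0 : ∀ x, 0 ≤ f x) {j : ℕ} (hj : 1 ≤ j) :
    rearr μ (fun x => ‖f x‖ₑ) ((1 / 2) ^ (j + 1)) ≤ rearr μ (fun x => ‖f x‖ₑ) ((1 / 2) ^ j) +
      (∫⁻ x in dyadicBand μ (fun x => ‖f x‖ₑ) j, gradNorm f x ∂μ) /
        ENNReal.ofReal (I ((1 / 2) ^ (j + 1))) := by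
  have := hΩ.probability
  set F : Ω → ℝ≥0∞ := fun x => ‖f x‖ₑ
  have hp : ∀ i : ℕ, (0 : ℝ) < (1 / 2) ^ i := fun i => by positivity
  have hfin : ∀ r, 0 < r → rearr μ F r ≠ ∞ := fun r hr =>
    (rearr_lt_top hf.continuous.measurable.enorm (fun x => enorm_ne_top) hr).ne
  have hj2 : (1 / 2 : ℝ) ^ j ≤ 1 / 2 := by
    simpa using pow_le_pow_of_le_one (a := (1 / 2 : ℝ)) (by norm_num) (by norm_num) hj
  have hlt : (1 / 2 : ℝ) ^ (j + 1) < (1 / 2) ^ j := by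
    rw [pow_succ]; linarith [hp j]
  have hIpos : 0 < I ((1 / 2) ^ (j + 1)) := hI.pos _ ⟨hp _, by linarith⟩
  rw [← tsub_le_iff_left, ENNReal.le_div_iff_mul_le (Or.inl (ENNReal.ofReal_pos.2 hIpos).ne')
    (Or.inl ENNReal.ofReal_ne_top)]
  refine le_trans ?_ (lintegral_Ioo_rearr_le hΩ hI hf h0 (hp (j + 1)) hlt.le)
  set a := (rearr μ F ((1 / 2) ^ j)).toReal
  set b := (rearr μ F ((1 / 2) ^ (j + 1))).toReal
  have e : rearr μ F ((1 / 2) ^ (j + 1)) - rearr μ F ((1 / 2) ^ j) = ENNReal.ofReal (b - a) := by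
    rw [ENNReal.ofReal_sub _ ENNReal.toReal_nonneg, ENNReal.ofReal_toReal (hfin _ (hp _)),
      ENNReal.ofReal_toReal (hfin _ (hp _))]
  rw [e, mul_comm, ← Real.volume_Ioo, ← setLIntegral_const]
  -- At these levels the distribution function lies between $2^{-j-1}$ and $2^{-j}\le1/2$, where $I$
  -- is monotone.
  refine setLIntegral_mono' measurableSet_Ioo fun τ hτ => ENNReal.ofReal_le_ofReal ?_
  have hτ0 : 0 ≤ τ := le_trans ENNReal.toReal_nonneg hτ.1.le
  exact hI.mono (hp _).le (lt_measureReal_superlevel h0 hτ0 hτ.2).le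
    ((measureReal_superlevel_le (hp j).le (hfin _ (hp j)) hτ.1.le).trans hj2)

end Bands

/-- Summing dyadic increments of an antitone function. -/
theorem antitone_le_add_lintegral_of_dyadic {a k : ℝ → ℝ≥0∞} (ha : Antitone a)
    (hstep : ∀ i : ℕ, 1 ≤ i → a ((1 / 2) ^ (i + 2)) ≤
      a ((1 / 2) ^ (i + 1)) + ∫⁻ s in dyadicIoc i, k s) {t : ℝ} (ht : t ∈ Ioo (0 : ℝ) (1 / 2)) :
    a t ≤ a (1 / 4) + ∫⁻ s in Ioo t (1 / 2), k s := by
  have key : ∀ n : ℕ, a ((1 / 2) ^ (n + 2)) ≤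
      a (1 / 4) + ∫⁻ s in Ioc ((1 / 2) ^ (n + 1)) (1 / 2), k s := by
    intro n
    induction n with
    | zero => norm_num
    | succ n ih =>
      refine (hstep (n + 1) (by omega)).trans ?_
      have h1 : (1 / 2 : ℝ) ^ (n + 2) ≤ (1 / 2) ^ (n + 1) :=
        pow_le_pow_of_le_one (by norm_num) (by norm_num) (by omega)
      have h2 : (1 / 2 : ℝ) ^ (n + 1) ≤ 1 / 2 := by
        simpa using pow_le_pow_of_le_one (a := (1 / 2 : ℝ)) (by norm_num) (by norm_num)
          (show 1 ≤ n + 1 by omega)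
      have hu : Ioc ((1 / 2 : ℝ) ^ (n + 2)) (1 / 2) =
          Ioc ((1 / 2 : ℝ) ^ (n + 1)) (1 / 2) ∪ dyadicIoc (n + 1) := by
        rw [union_comm]; exact (Ioc_union_Ioc_eq_Ioc h1 h2).symm
      have hd : Disjoint (Ioc ((1 / 2 : ℝ) ^ (n + 1)) (1 / 2)) (dyadicIoc (n + 1)) :=
        Set.disjoint_left.2 fun s hs hs' => absurd hs'.2 (not_le.2 hs.1)
      rw [show n + 1 + 1 = n + 2 from rfl, hu, lintegral_union (show MeasurableSet (dyadicIoc (n + 1)) from measurableSet_Ioc) hd, ← add_assoc]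
      exact add_le_add_left ih _
  obtain ⟨n, hn⟩ := exists_mem_dyadicIoc (s := t) ⟨ht.1, by linarith [ht.2]⟩
  -- Since $t<1/2$, the index $n$ is positive. The offset in `hstep` makes the bound for
  -- $a(2^{-n-1})\ge a(t)$ use only the interval $(2^{-n},1/2]$, which lies to the right of $t$.
  obtain ⟨m, rfl⟩ : ∃ m, n = m + 1 := by
    refine Nat.exists_eq_succ_of_ne_zero fun h0 => ?_
    rw [h0] at hn
    have := hn.1
    norm_num at this
    linarith [ht.2]
  refine (ha hn.1.le).trans ((key m).trans ?_)
  rw [restrict_Ioo_eq_restrict_Ioc]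
  gcongr
  exact hn.2

/-- The median is the infimum of the $t$ with $\mu\{g>t\}\le1/2$; both bounds follow by continuity
of measure along $m\pm1/(n+1)$. -/
theorem exists_median {Ω : Type*} [MeasurableSpace Ω] {μ : Measure Ω} [IsProbabilityMeasure μ]
    {g : Ω → ℝ} (hg : Measurable g) :
    ∃ m : ℝ, μ {x | m < g x} ≤ 1 / 2 ∧ μ {x | g x < m} ≤ 1 / 2 := by
  have hm : ∀ t, MeasurableSet {x | t < g x} := fun t => measurableSet_lt measurable_const hg
  set S : Set ℝ := {t | μ {x | t < g x} ≤ 1 / 2} with hS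
  have hanti : ∀ {s t : ℝ}, s ≤ t → μ {x | t < g x} ≤ μ {x | s < g x} := fun hst =>
    measure_mono fun x hx => lt_of_le_of_lt hst hx
  have hne : S.Nonempty := by
    have hT : Tendsto (μ ∘ fun n : ℕ => {x | (n : ℝ) < g x}) atTop
        (𝓝 (μ (⋂ n : ℕ, {x | (n : ℝ) < g x}))) :=
      tendsto_measure_iInter_atTop (fun n => (hm n).nullMeasurableSet)
        (fun a b hab x hx => lt_of_le_of_lt (b := (b : ℝ)) (by exact_mod_cast hab) hx)
        ⟨0, measure_ne_top _ _⟩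
    have he : (⋂ n : ℕ, {x | (n : ℝ) < g x}) = ∅ := by
      ext x
      simp only [mem_iInter, mem_ofPred_eq, mem_empty_iff_false, iff_false, not_forall, not_lt]
      exact exists_nat_ge (g x)
    rw [he, measure_empty] at hT
    obtain ⟨n, hn⟩ := (hT.eventually_lt_const (show (0 : ℝ≥0∞) < 1 / 2 by simp)).exists
    exact ⟨n, hn.le⟩
  have hbd : BddBelow S := by
    have hT : Tendsto (μ ∘ fun n : ℕ => {x | -(n : ℝ) < g x}) atTop
        (𝓝 (μ (⋃ n : ℕ, {x | -(n : ℝ) < g x}))) :=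
      tendsto_measure_iUnion_atTop fun a b hab x hx =>
        lt_of_le_of_lt (b := -(a : ℝ)) (neg_le_neg (by exact_mod_cast hab)) hx
    have he : (⋃ n : ℕ, {x | -(n : ℝ) < g x}) = univ := by
      ext x
      simp only [mem_iUnion, mem_ofPred_eq, mem_univ, iff_true]
      obtain ⟨n, hn⟩ := exists_nat_gt (-g x)
      exact ⟨n, by linarith⟩
    rw [he, measure_univ] at hT
    obtain ⟨n, hn⟩ := (hT.eventually_const_lt
      (show (1 / 2 : ℝ≥0∞) < 1 by simp)).exists
    refine ⟨-n, fun t ht => ?_⟩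
    by_contra hc
    exact absurd ((hanti (not_le.1 hc).le).trans ht) (not_le.2 hn)
  have hpos : ∀ n : ℕ, (0 : ℝ) < 1 / ((n : ℝ) + 1) := fun n => by positivity
  have hdecr : ∀ {a b : ℕ}, a ≤ b → 1 / ((b : ℝ) + 1) ≤ 1 / ((a : ℝ) + 1) := fun hab =>
    one_div_le_one_div_of_le (by positivity) (by exact_mod_cast Nat.succ_le_succ hab)
  refine ⟨sInf S, ?_, ?_⟩
  · have he : {x | sInf S < g x} = ⋃ n : ℕ, {x | sInf S + 1 / ((n : ℝ) + 1) < g x} := by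
      ext x
      simp only [mem_iUnion, mem_ofPred_eq]
      constructor
      · intro hx
        obtain ⟨n, hn⟩ := exists_nat_one_div_lt (sub_pos.2 hx)
        exact ⟨n, by linarith⟩
      · rintro ⟨n, hn⟩; linarith [hpos n]
    have hmon : Monotone fun n : ℕ => {x | sInf S + 1 / ((n : ℝ) + 1) < g x} :=
      fun a b hab x hx => lt_of_le_of_lt (add_le_add_right (hdecr hab) _) hx
    rw [he, hmon.measure_iUnion]
    refine iSup_le fun n => ?_
    obtain ⟨t, ht, hlt⟩ := exists_lt_of_csInf_lt hne (lt_add_of_pos_right (sInf S) (hpos n))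
    exact (hanti hlt.le).trans ht
  · have he : {x | g x < sInf S} = ⋃ n : ℕ, {x | g x ≤ sInf S - 1 / ((n : ℝ) + 1)} := by
      ext x
      simp only [mem_iUnion, mem_ofPred_eq]
      constructor
      · intro hx
        obtain ⟨n, hn⟩ := exists_nat_one_div_lt (sub_pos.2 hx)
        exact ⟨n, by linarith⟩
      · rintro ⟨n, hn⟩; linarith [hpos n]
    have hmon : Monotone fun n : ℕ => {x | g x ≤ sInf S - 1 / ((n : ℝ) + 1)} :=
      fun a b hab x hx => le_trans (show g x ≤ _ from hx) (sub_le_sub_left (hdecr hab) _)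
    rw [he, hmon.measure_iUnion]
    refine iSup_le fun n => ?_
    have hnot : sInf S - 1 / ((n : ℝ) + 1) ∉ S := fun h => by
      linarith [csInf_le hbd h, hpos n]
    have hgt : 1 / 2 < μ {x | sInf S - 1 / ((n : ℝ) + 1) < g x} := not_le.1 hnot
    have hc : {x | g x ≤ sInf S - 1 / ((n : ℝ) + 1)} =
        {x | sInf S - 1 / ((n : ℝ) + 1) < g x}ᶜ := by
      ext x; simp
    rw [hc, prob_compl_eq_one_sub (hm _), tsub_le_iff_right]
    calc (1 : ℝ≥0∞) = 1 / 2 + 1 / 2 := (ENNReal.add_halves 1).symm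
      _ ≤ _ := add_le_add_right hgt.le _

/-! ### Functions that vanish on half of the space. -/

section Poincare

variable {Ω : Type*} [MetricSpace Ω] [MeasurableSpace Ω] [BorelSpace Ω] {μ : Measure Ω}

/-- Nonnegative functions in `Lip(Ω)` that vanish on half of the space and whose gradient is
controlled by that of `g`. -/
structure IsMedianPart (μ : Measure Ω) (g f : Ω → ℝ) : Prop where
  lip : IsLip f
  nonneg : ∀ x, 0 ≤ f x
  half : μ {x | f x ≠ 0} ≤ ENNReal.ofReal (1 / 2)
  grad_le : ∀ x, gradNorm f x ≤ gradNorm g x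

/-- Splitting a function at its median. -/
theorem IsLip.exists_median_decomposition [IsProbabilityMeasure μ] {g : Ω → ℝ} (hg : IsLip g) :
    ∃ (m : ℝ) (f₁ f₂ : Ω → ℝ), (∀ x, |g x - m| = f₁ x + f₂ x) ∧ IsMedianPart μ g f₁ ∧
      IsMedianPart μ g f₂ := by
  obtain ⟨m, h1, h2⟩ := exists_median (μ := μ) hg.continuous.measurable
  have hhalf : ENNReal.ofReal (1 / 2) = 1 / 2 := by
    rw [ENNReal.ofReal_div_of_pos two_pos]; simp
  have hL1 : LipschitzWith 1 fun r : ℝ => max (r - m) 0 := by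
    refine LipschitzWith.of_dist_le_mul fun r s => ?_
    simpa [Real.dist_eq] using abs_max_sub_max_le_abs (r - m) (s - m) 0
  have hL2 : LipschitzWith 1 fun r : ℝ => max (m - r) 0 := by
    refine LipschitzWith.of_dist_le_mul fun r s => ?_
    simpa [Real.dist_eq, abs_sub_comm] using abs_max_sub_max_le_abs (m - r) (m - s) 0
  refine ⟨m, (fun r : ℝ => max (r - m) 0) ∘ g, (fun r : ℝ => max (m - r) 0) ∘ g, fun x => ?_,
    ⟨hg.comp_lipschitz hL1, fun x => le_max_right _ _, ?_, gradNorm_comp_le hL1⟩,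
    ⟨hg.comp_lipschitz hL2, fun x => le_max_right _ _, ?_, gradNorm_comp_le hL2⟩⟩
  · simp only [Function.comp]
    rcases le_total (g x) m with h | h
    · rw [abs_of_nonpos (by linarith), max_eq_right (by linarith), max_eq_left (by linarith)]; ring
    · rw [abs_of_nonneg (by linarith), max_eq_left (by linarith), max_eq_right (by linarith)]; ring
  · rw [hhalf]
    refine (measure_mono fun x hx => ?_).trans h1
    by_contra hc
    exact hx (max_eq_right (by simpa using hc))
  · rw [hhalf]
    refine (measure_mono fun x hx => ?_).trans h2
    by_contra hc
    exact hx (max_eq_right (by simpa using hc))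

/-- A function on `(0, 1/2)` whose isoperimetric Hardy transform controls `f^*`. -/
def hardyMajorant (μ : Measure Ω) (f : Ω → ℝ) : ℝ → ℝ≥0∞ :=
  (Ioo 0 (1 / 2)).indicator fun s => (4 : ℝ≥0) * bandAverage μ (fun x => ‖f x‖ₑ) (gradNorm f) s

omit [BorelSpace Ω] in
theorem measurable_hardyMajorant (f : Ω → ℝ) : Measurable (hardyMajorant μ f) :=
  ((measurable_bandAverage _ _).const_mul _).indicator measurableSet_Ioo

omit [BorelSpace Ω] in
theorem support_hardyMajorant (f : Ω → ℝ) :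
    Function.support (hardyMajorant μ f) ⊆ Ioo 0 (1 / 2) := support_indicator_subset

theorem RISpace.bar_hardyMajorant_le [IsProbabilityMeasure μ] (X : RISpace μ)
    (hμ : ∃ U : Ω → ℝ, MeasurePreserving U μ unitVol) {f : Ω → ℝ} (hf : IsLip f) :
    X.bar (hardyMajorant μ f) ≤ 4 * X.norm (gradNorm f) := by
  have hm := measurable_bandAverage (μ := μ) (fun x => ‖f x‖ₑ) (gradNorm f)
  calc X.bar (hardyMajorant μ f)
      ≤ X.bar (fun s => (4 : ℝ≥0) * bandAverage μ (fun x => ‖f x‖ₑ) (gradNorm f) s) :=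
        X.bar_mono hμ (measurable_hardyMajorant f) (hm.const_mul _) fun s _ =>
          indicator_le_self _ _ s
    _ = (4 : ℝ≥0) * X.bar (bandAverage μ (fun x => ‖f x‖ₑ) (gradNorm f)) := X.bar_smul hμ 4 hm
    _ ≤ 4 * X.norm (gradNorm f) := by
        gcongr
        · simp
        · exact X.bar_bandAverage_le hμ hf.continuous.measurable.enorm
            (measurable_gradNorm hf.continuous)

variable {I : ℝ → ℝ} (hΩ : IsMetricProbabilitySpace μ) (hI : IsIsoperimetricEstimator μ I)
include hΩ hI

/-- The sum of the dyadic increments of $f^*$, each written as an integral over a dyadic interval.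
This is the form to which $Q_I$ and $\tilde Q_I$ apply. -/
theorem rearr_le_lintegral_hardyMajorant {f : Ω → ℝ} (hf : IsLip f) (h0 : ∀ x, 0 ≤ f x)
    (hhalf : μ {x | f x ≠ 0} ≤ ENNReal.ofReal (1 / 2)) {t : ℝ} (ht : t ∈ Ioo (0 : ℝ) (1 / 2)) :
    rearr μ (fun x => ‖f x‖ₑ) t ≤ (∫⁻ x, gradNorm f x ∂μ) / ENNReal.ofReal (I (1 / 4)) +
      ∫⁻ s in Ioo t (1 / 2), hardyMajorant μ f s / ENNReal.ofReal (I s) := by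
  set F : Ω → ℝ≥0∞ := fun x => ‖f x‖ₑ with hF
  have hp : ∀ i : ℕ, (0 : ℝ) < (1 / 2) ^ i := fun i => by positivity
  -- As $f$ vanishes on half of the space, $f^*(1/2)=0$, and one increment reaches $1/4$.
  have hquarter : rearr μ F (1 / 4) ≤ (∫⁻ x, gradNorm f x ∂μ) / ENNReal.ofReal (I (1 / 4)) := by
    have h := rearr_dyadic_step hΩ hI hf h0 (j := 1) le_rfl
    have e : rearr μ F ((1 / 2) ^ 1) = 0 := rearr_eq_zero (by simpa [hF] using hhalf)
    rw [e, zero_add] at h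
    norm_num at h ⊢
    exact h.trans (ENNReal.div_le_div_right (setLIntegral_le_lintegral _ _) _)
  refine (antitone_le_add_lintegral_of_dyadic (rearr_antitone F)
    (k := fun s => hardyMajorant μ f s / ENNReal.ofReal (I s)) (fun i hi => ?_) ht).trans
    (add_le_add_left hquarter _)
  refine (rearr_dyadic_step hΩ hI hf h0 (j := i + 1) (by omega)).trans
    (add_le_add_right ?_ _)
  rw [show i + 1 + 1 = i + 2 from rfl]
  set γ := ∫⁻ x in dyadicBand μ F (i + 1), gradNorm f x ∂μ
  set κ := I ((1 / 2) ^ (i + 2))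
  have hi2 : (1 / 2 : ℝ) ^ i ≤ 1 / 2 := by
    simpa using pow_le_pow_of_le_one (a := (1 / 2 : ℝ)) (by norm_num) (by norm_num) hi
  have hpp : (1 / 2 : ℝ) ^ (i + 2) = (1 / 2) ^ i / 4 := by rw [pow_add]; norm_num; ring
  have hpp1 : (1 / 2 : ℝ) ^ (i + 1) = (1 / 2) ^ i / 2 := by rw [pow_succ]; ring
  have hκ : 0 < κ := hI.pos _ ⟨hp _, by rw [hpp]; linarith [hp i]⟩
  -- Concavity gives $I(2^{-i})\le4I(2^{-i-2})$; this is the factor $4$ in `hardyMajorant`.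
  have hI4 : ∀ s ∈ Ioo ((1 / 2 : ℝ) ^ (i + 1)) ((1 / 2) ^ i), I s ≤ 4 * κ := by
    intro s hs
    have h1 := hI.mono ((hp _).trans hs.1).le hs.2.le hi2
    have h2 := hI.mul_le (hp (i + 2)).le (t := (1 / 2) ^ i) (by rw [hpp]; linarith [hp i])
      (by linarith)
    rw [hpp] at h2
    have h3 : (1 / 2 : ℝ) ^ i * I ((1 / 2) ^ i) ≤ (1 / 2 : ℝ) ^ i * (4 * κ) := by
      have : I ((1 / 2) ^ i / 4) = κ := by rw [← hpp]
      rw [this] at h2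
      linarith
    exact h1.trans (le_of_mul_le_mul_left h3 (hp i))
  have h4 : (4 : ℝ≥0∞) * ENNReal.ofReal κ = ENNReal.ofReal (4 * κ) := by
    rw [ENNReal.ofReal_mul (by norm_num)]; simp
  calc γ / ENNReal.ofReal κ
      = (4 * (ENNReal.ofReal (2 ^ (i + 1)) * γ)) / (4 * ENNReal.ofReal κ) *
          volume (Ioo ((1 / 2 : ℝ) ^ (i + 1)) ((1 / 2) ^ i)) := by
        rw [ENNReal.mul_div_mul_left _ _ (by norm_num) (by norm_num), Real.volume_Ioo,
          mul_comm (ENNReal.ofReal (2 ^ (i + 1))) γ, mul_comm _ (ENNReal.ofReal (_ - _)),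
          ← mul_div_assoc, mul_left_comm, ← ENNReal.ofReal_mul (by rw [hpp1]; linarith [hp i])]
        have : ((1 / 2 : ℝ) ^ i - (1 / 2) ^ (i + 1)) * 2 ^ (i + 1) = 1 := by
          rw [hpp1, pow_succ, one_div, inv_pow]
          field_simp
          norm_num
        rw [this, ENNReal.ofReal_one, mul_one]
    _ = ∫⁻ s in Ioo ((1 / 2 : ℝ) ^ (i + 1)) ((1 / 2) ^ i),
          (4 * (ENNReal.ofReal (2 ^ (i + 1)) * γ)) / (4 * ENNReal.ofReal κ) := by
        rw [setLIntegral_const]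
    _ ≤ ∫⁻ s in Ioo ((1 / 2 : ℝ) ^ (i + 1)) ((1 / 2) ^ i),
          hardyMajorant μ f s / ENNReal.ofReal (I s) := by
        refine setLIntegral_mono' measurableSet_Ioo fun s hs => ?_
        have hs2 : s ∈ Ioo (0 : ℝ) (1 / 2) := ⟨(hp _).trans hs.1, hs.2.trans_le hi2⟩
        rw [hardyMajorant, indicator_of_mem hs2, bandAverage,
          dyadicGlue_of_mem _ (show s ∈ dyadicIoc i from ⟨hs.1, hs.2.le⟩), h4]
        exact ENNReal.div_le_div_left (ENNReal.ofReal_le_ofReal (hI4 s hs)) _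
    _ ≤ _ := lintegral_mono_set Ioo_subset_Ioc_self

/-- The Poincaré inequality for functions that vanish on half of the space. -/
theorem exists_poincare_of_vanishing (X Y : RISpace μ)
    (hQ : ∃ C : ℝ≥0, ∀ f : ℝ → ℝ≥0∞, Measurable f → Function.support f ⊆ Ioo 0 (1 / 2) →
      X.bar f < ∞ → Y.bar (hardyQ I f) ≤ C * X.bar f) :
    ∃ K : ℝ≥0, 0 < K ∧ ∀ f : Ω → ℝ, IsLip f → (∀ x, 0 ≤ f x) →
      μ {x | f x ≠ 0} ≤ ENNReal.ofReal (1 / 2) →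
      Y.fnNorm f ≤ K * X.norm (gradNorm f) := by
  have := hΩ.probability
  have hμ := hΩ.exists_uniform
  obtain ⟨C, hC⟩ := hQ
  obtain ⟨D, hD⟩ := X.embed
  have hIq : 0 < I (1 / 4) := hI.pos _ ⟨by norm_num, by norm_num⟩
  set κ : ℝ≥0 := (I (1 / 4)).toNNReal⁻¹ with hκ
  have hκe : (κ : ℝ≥0∞) = (ENNReal.ofReal (I (1 / 4)))⁻¹ := by
    rw [hκ, ENNReal.coe_inv (by simpa using hIq)]; rfl
  set N : ℝ≥0 := (Y.norm fun _ => 1).toNNReal with hN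
  have hNe : (N : ℝ≥0∞) = Y.norm fun _ => 1 := ENNReal.coe_toNNReal Y.norm_one.ne
  -- The summand $1$ makes the constant positive, so that the bound is trivial when the gradient
  -- norm is $\infty$ (in `ℝ≥0∞`, $0\cdot\infty=0$).
  refine ⟨D * κ * N + C * 4 + 1, by positivity, fun f hf h0 hhalf => ?_⟩
  rcases eq_or_ne (X.norm (gradNorm f)) ∞ with htop | hfin
  · rw [htop, ENNReal.mul_top (by positivity)]; exact le_top
  have hG := measurable_gradNorm hf.continuous
  have hint := hD _ hG.aemeasurable
  have hintfin : ∫⁻ x, gradNorm f x ∂μ ≠ ∞ :=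
    ne_top_of_le_ne_top (ENNReal.mul_ne_top ENNReal.coe_ne_top hfin) hint
  set c : ℝ≥0 := (∫⁻ x, gradNorm f x ∂μ).toNNReal * κ with hc
  have hcκ : (c : ℝ≥0∞) = (∫⁻ x, gradNorm f x ∂μ) * κ := by
    rw [hc, ENNReal.coe_mul, ENNReal.coe_toNNReal hintfin]
  have hce : (c : ℝ≥0∞) = (∫⁻ x, gradNorm f x ∂μ) / ENNReal.ofReal (I (1 / 4)) := by
    rw [hcκ, hκe]
    exact (div_eq_mul_inv _ _).symm
  have hφ := X.bar_hardyMajorant_le hμ hf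
  have hφfin : X.bar (hardyMajorant μ f) < ∞ :=
    hφ.trans_lt (ENNReal.mul_lt_top (by simp) hfin.lt_top)
  have hQm : Measurable (hardyQ I (hardyMajorant μ f)) :=
    Antitone.measurable fun a b hab => lintegral_mono_set (Ioo_subset_Ioo_left hab)
  have hFm : Measurable fun x => ‖f x‖ₑ := hf.continuous.measurable.enorm
  calc Y.fnNorm f = Y.bar (rearr μ fun x => ‖f x‖ₑ) := (Y.bar_rearr _ hFm.aemeasurable).symm
    _ ≤ Y.bar (fun t => c + hardyQ I (hardyMajorant μ f) t) := by
        refine Y.bar_mono hμ (measurable_rearr _) (measurable_const.add hQm) fun t ht => ?_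
        rcases lt_or_ge t (1 / 2) with h | h
        · rw [hce]
          refine (rearr_le_lintegral_hardyMajorant hΩ hI hf h0 hhalf ⟨ht.1, h⟩).trans ?_
          exact add_le_add_right (lintegral_mono_set (Ioo_subset_Ioo_right (by norm_num))) _
        · rw [rearr_eq_zero (s := t)]
          · exact zero_le
          · simpa using hhalf.trans (ENNReal.ofReal_le_ofReal h)
    _ ≤ Y.bar (fun _ => (c : ℝ≥0∞)) + Y.bar (hardyQ I (hardyMajorant μ f)) :=
        Y.bar_add hμ measurable_const hQm
    _ ≤ D * X.norm (gradNorm f) * κ * N + C * (4 * X.norm (gradNorm f)) := by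
        rw [Y.bar_const hμ, hNe, hcκ]
        gcongr
        exact (hC _ (measurable_hardyMajorant f) (support_hardyMajorant f) hφfin).trans
          (by gcongr)
    _ ≤ _ := by
        push_cast
        have : (D * κ * N + C * 4 + 1 : ℝ≥0∞) * X.norm (gradNorm f) =
          D * X.norm (gradNorm f) * κ * N + C * (4 * X.norm (gradNorm f)) +
            X.norm (gradNorm f) := by ring
        rw [this]
        exact le_self_add

end Poincare

section Centered

variable {Ω : Type*} [MeasurableSpace Ω] {μ : Measure Ω}

theorem enorm_centered_le {g f₁ f₂ : Ω → ℝ} {m : ℝ} (h : ∀ x, |g x - m| = f₁ x + f₂ x) (x : Ω) :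
    ‖centered μ g x‖ₑ ≤ ‖f₁ x‖ₑ + ‖f₂ x‖ₑ + ‖m - ∫ y, g y ∂μ‖ₑ := by
  have e : centered μ g x = (g x - m) + (m - ∫ y, g y ∂μ) := by rw [centered]; ring
  rw [e]
  refine (enorm_add_le _ _).trans (add_le_add_left ?_ _)
  calc ‖g x - m‖ₑ = ‖f₁ x + f₂ x‖ₑ := by rw [← h x]; simp
    _ ≤ _ := enorm_add_le _ _

theorem lintegral_enorm_sub_le {g f₁ f₂ : Ω → ℝ} (hf₁ : Measurable f₁) {m : ℝ}
    (h : ∀ x, |g x - m| = f₁ x + f₂ x) :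
    ∫⁻ x, ‖g x - m‖ₑ ∂μ ≤ ∫⁻ x, ‖f₁ x‖ₑ ∂μ + ∫⁻ x, ‖f₂ x‖ₑ ∂μ := by
  rw [← lintegral_add_left hf₁.enorm]
  refine lintegral_mono fun x => ?_
  calc ‖g x - m‖ₑ = ‖f₁ x + f₂ x‖ₑ := by rw [← h x]; simp
    _ ≤ _ := enorm_add_le _ _

theorem enorm_sub_integral_le [IsProbabilityMeasure μ] {g : Ω → ℝ} (hg : Integrable g μ) (m : ℝ) :
    ‖m - ∫ y, g y ∂μ‖ₑ ≤ ∫⁻ x, ‖g x - m‖ₑ ∂μ := by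
  have e : m - ∫ y, g y ∂μ = -∫ y, (g y - m) ∂μ := by
    rw [integral_sub hg (integrable_const m)]; simp
  rw [e, enorm_neg]
  exact enorm_integral_le_lintegral_enorm _

end Centered

/-! ### The Poincaré inequality. -/

section Poincare

variable {Ω : Type*} [MetricSpace Ω] [MeasurableSpace Ω] [BorelSpace Ω] {μ : Measure Ω}
variable {I : ℝ → ℝ} (hΩ : IsMetricProbabilitySpace μ) (hI : IsIsoperimetricEstimator μ I)
include hΩ hI

/-- Both median parts satisfy the inequality for vanishing functions. Since $Y\subseteq L^1$, this
bounds $\int|g-m|$, hence gives integrability and bounds $|m-\int g|$; the latter bound is recorded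
because (a) uses it. -/
theorem exists_poincare (X Y : RISpace μ)
    (hQ : ∃ C : ℝ≥0, ∀ f : ℝ → ℝ≥0∞, Measurable f → Function.support f ⊆ Ioo 0 (1 / 2) →
      X.bar f < ∞ → Y.bar (hardyQ I f) ≤ C * X.bar f) :
    ∃ K : ℝ≥0, 0 < K ∧ ∀ g : Ω → ℝ, IsLip g →
      (X.norm (gradNorm g) < ∞ → Integrable g μ) ∧
      (Integrable g μ → Y.fnNorm (centered μ g) ≤ K * X.norm (gradNorm g) ∧
        ∫⁻ x, ‖centered μ g x‖ₑ ∂μ ≤ K * X.norm (gradNorm g) ∧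
        ∀ m f₁ f₂, (∀ x, |g x - m| = f₁ x + f₂ x) → IsMedianPart μ g f₁ → IsMedianPart μ g f₂ →
          ‖m - ∫ y, g y ∂μ‖ₑ ≤ K * X.norm (gradNorm g)) := by
  have := hΩ.probability
  have hμ := hΩ.exists_uniform
  obtain ⟨K, hK0, hK⟩ := exists_poincare_of_vanishing hΩ hI X Y hQ
  obtain ⟨D, hD⟩ := Y.embed
  set N : ℝ≥0 := (Y.norm fun _ => 1).toNNReal with hN
  have hNe : (N : ℝ≥0∞) = Y.norm fun _ => 1 := ENNReal.coe_toNNReal Y.norm_one.ne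
  set L : ℝ≥0 := 2 * K + 2 * (D * K) * N with hL
  have hpart : ∀ g f : Ω → ℝ, IsLip g → IsMedianPart μ g f →
      Y.fnNorm f ≤ K * X.norm (gradNorm g) ∧
        ∫⁻ x, ‖f x‖ₑ ∂μ ≤ D * K * X.norm (gradNorm g) := by
    intro g f hg hf
    have h1 : Y.fnNorm f ≤ K * X.norm (gradNorm g) :=
      (hK f hf.lip hf.nonneg hf.half).trans (by
        gcongr
        exact X.norm_mono _ _ (measurable_gradNorm hf.lip.continuous).aemeasurable
          (measurable_gradNorm hg.continuous).aemeasurable (Eventually.of_forall hf.grad_le))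
    refine ⟨h1, (hD _ hf.lip.continuous.measurable.enorm.aemeasurable).trans ?_⟩
    rw [mul_assoc]
    gcongr
    exact h1
  have hmean : ∀ g : Ω → ℝ, IsLip g → ∀ m f₁ f₂, (∀ x, |g x - m| = f₁ x + f₂ x) →
      IsMedianPart μ g f₁ → IsMedianPart μ g f₂ →
      ∫⁻ x, ‖g x - m‖ₑ ∂μ ≤ (2 * (D * K) : ℝ≥0) * X.norm (gradNorm g) := by
    intro g hg m f₁ f₂ h hf₁ hf₂
    refine (lintegral_enorm_sub_le hf₁.lip.continuous.measurable h).trans ?_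
    refine (add_le_add (hpart g f₁ hg hf₁).2 (hpart g f₂ hg hf₂).2).trans (le_of_eq ?_)
    push_cast
    ring
  refine ⟨L + D * L + 2 * (D * K), by positivity, fun g hg => ⟨fun hfin => ?_, fun hgi => ?_⟩⟩
  · obtain ⟨m, f₁, f₂, h, hf₁, hf₂⟩ := hg.exists_median_decomposition (μ := μ)
    have hlt : ∫⁻ x, ‖g x - m‖ₑ ∂μ < ∞ :=
      (hmean g hg m f₁ f₂ h hf₁ hf₂).trans_lt (ENNReal.mul_lt_top ENNReal.coe_lt_top hfin)
    have hi : Integrable (fun x => g x - m) μ :=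
      ⟨(hg.continuous.measurable.sub_const m).aestronglyMeasurable, hlt⟩
    exact (hi.add (integrable_const m)).congr (Eventually.of_forall fun x => by simp)
  · have hcm : Measurable (centered μ g) := hg.continuous.measurable.sub_const _
    have hY : Y.fnNorm (centered μ g) ≤ L * X.norm (gradNorm g) := by
      obtain ⟨m, f₁, f₂, h, hf₁, hf₂⟩ := hg.exists_median_decomposition (μ := μ)
      have hm₁ := hf₁.lip.continuous.measurable.enorm
      have hm₂ := hf₂.lip.continuous.measurable.enorm
      have hc := (enorm_sub_integral_le hgi m).trans (hmean g hg m f₁ f₂ h hf₁ hf₂)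
      calc Y.fnNorm (centered μ g)
          ≤ Y.norm (fun x => (‖f₁ x‖ₑ + ‖f₂ x‖ₑ) + ‖m - ∫ y, g y ∂μ‖ₑ * 1) := by
            refine Y.norm_mono _ _ hcm.enorm.aemeasurable (by fun_prop)
              (Eventually.of_forall fun x => ?_)
            simpa using enorm_centered_le h x
        _ ≤ Y.norm (fun x => ‖f₁ x‖ₑ + ‖f₂ x‖ₑ) +
            Y.norm (fun _ => ‖m - ∫ y, g y ∂μ‖ₑ * 1) :=
          Y.norm_add _ _ (by fun_prop) (by fun_prop)
        _ ≤ (Y.fnNorm f₁ + Y.fnNorm f₂) + ‖m - ∫ y, g y ∂μ‖ₑ * N := by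
          rw [hNe]
          exact add_le_add (Y.norm_add _ _ hm₁.aemeasurable hm₂.aemeasurable)
            (Y.norm_smul _ (fun _ => 1) aemeasurable_const).le
        _ ≤ (K * X.norm (gradNorm g) + K * X.norm (gradNorm g)) +
            (2 * (D * K) : ℝ≥0) * X.norm (gradNorm g) * N := by
          gcongr
          exacts [(hpart g f₁ hg hf₁).1, (hpart g f₂ hg hf₂).1]
        _ = L * X.norm (gradNorm g) := by
          rw [hL]; push_cast; ring
    refine ⟨hY.trans ?_, ?_, fun m f₁ f₂ h hf₁ hf₂ => ?_⟩
    · gcongr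
      rw [add_assoc]
      exact le_self_add
    · refine (hD _ hcm.enorm.aemeasurable).trans ?_
      calc D * Y.norm (fun x => ‖centered μ g x‖ₑ) ≤ D * (L * X.norm (gradNorm g)) := by
            gcongr
            exact hY
        _ = ((D * L : ℝ≥0) : ℝ≥0∞) * X.norm (gradNorm g) := by push_cast; ring
        _ ≤ _ := by
            gcongr
            rw [add_right_comm]
            exact le_add_self
    · refine ((enorm_sub_integral_le hgi m).trans (hmean g hg m f₁ f₂ h hf₁ hf₂)).trans ?_
      gcongr
      exact le_add_self

end Poincare

/-! ### Part (a): the weighted norm. -/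

section Weighted

variable {Ω : Type*} [MetricSpace Ω] [MeasurableSpace Ω] [BorelSpace Ω] {μ : Measure Ω}
variable {I : ℝ → ℝ} (hΩ : IsMetricProbabilitySpace μ) (hI : IsIsoperimetricEstimator μ I)
  (hIm : Measurable I)
include hΩ hI hIm

/-- The Hardy operator recovers `f^*` from the weighted function `f^*(t) I(t) / t`. -/
theorem exists_fnNorm_le_weightedNorm (X Y : RISpace μ)
    (hQ : ∃ C : ℝ≥0, ∀ f : ℝ → ℝ≥0∞, Measurable f → Function.support f ⊆ Ioo 0 (1 / 2) →
      X.bar f < ∞ → Y.bar (hardyQ I f) ≤ C * X.bar f) :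
    ∃ K : ℝ≥0, ∀ v : Ω → ℝ, Measurable v → Y.fnNorm v ≤ K * X.weightedNorm I v := by
  have := hΩ.probability
  have hμ := hΩ.exists_uniform
  obtain ⟨C, hC⟩ := hQ
  refine ⟨8 * C + 1, fun v hv => ?_⟩
  set p := rearr μ fun x => ‖v x‖ₑ with hp
  have hpm : Measurable p := measurable_rearr _
  have hpa : Antitone p := rearr_antitone _
  have hWm : Measurable fun t => ENNReal.ofReal (I t / t) :=
    (hIm.div measurable_id).ennreal_ofReal
  set f : ℝ → ℝ≥0∞ := (Ioo 0 (1 / 2)).indicator fun t => p t * ENNReal.ofReal (I t / t) with hf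
  have hfm : Measurable f := (hpm.mul hWm).indicator measurableSet_Ioo
  have hfle : X.bar f ≤ X.weightedNorm I v :=
    X.bar_mono hμ hfm (hpm.mul hWm) fun t _ => indicator_le_self _ _ t
  rcases eq_or_ne (X.weightedNorm I v) ∞ with htop | hfin
  · rw [htop, ENNReal.mul_top (by positivity)]; exact le_top
  set q : ℝ → ℝ≥0∞ := (Ioo 0 (1 / 2)).indicator p with hq
  have hqm : Measurable q := hpm.indicator measurableSet_Ioo
  -- As $p$ decreases, $p(2s)\le p(s)$: passing to the restriction to $(0,1/2)$ costs a factor $2$.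
  have h1 : Y.bar p ≤ 2 * Y.bar q := by
    refine (Y.bar_le_two_mul_compress hμ hpm).trans ?_
    gcongr
    refine Y.bar_mono hμ (measurable_compress hpm) hqm fun s _ => ?_
    by_cases hs : s ∈ Ioo (0 : ℝ) (1 / 2)
    · rw [compress, hq, indicator_of_mem hs, indicator_of_mem hs]
      exact hpa (by linarith [hs.1])
    · rw [compress, indicator_of_notMem hs]; exact zero_le
  have hQm : Measurable (hardyQ I f) :=
    Antitone.measurable fun a b hab => lintegral_mono_set (Ioo_subset_Ioo_left hab)
  -- For $2s<1/2$, $Q_If(s)\ge\int_s^{2s}p(r)\,dr/r\ge p(2s)/2$; the doubled argument is absorbed by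
  -- a compression.
  have h2 : Y.bar q ≤ 2 * Y.bar (fun s => (2 : ℝ≥0) * hardyQ I f s) := by
    refine (Y.bar_le_two_mul_compress hμ hqm).trans ?_
    gcongr
    refine Y.bar_mono hμ (measurable_compress hqm) (hQm.const_mul _) fun s hs0 => ?_
    by_cases hs : 2 * s ∈ Ioo (0 : ℝ) (1 / 2)
    · rw [compress, indicator_of_mem (show s ∈ Ioo (0 : ℝ) (1 / 2) from
        ⟨hs0.1, by linarith [hs.2, hs0.1]⟩), hq, indicator_of_mem hs]
      have h2s : (0 : ℝ) < 2 * s := hs.1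
      calc p (2 * s) = (2 : ℝ≥0) * (p (2 * s) * ENNReal.ofReal (1 / (2 * s)) *
            volume (Ioo s (2 * s))) := by
            rw [Real.volume_Ioo, mul_assoc, ← ENNReal.ofReal_mul (by positivity),
              mul_left_comm]
            have : 1 / (2 * s) * (2 * s - s) = 2⁻¹ := by
              have := hs0.1.ne'
              field_simp
              norm_num
            rw [this, ENNReal.ofReal_inv_of_pos two_pos]
            simp [ENNReal.mul_inv_cancel]
        _ = (2 : ℝ≥0) * ∫⁻ r in Ioo s (2 * s), p (2 * s) * ENNReal.ofReal (1 / (2 * s)) := by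
            rw [setLIntegral_const]
        _ ≤ (2 : ℝ≥0) * ∫⁻ r in Ioo s (2 * s), f r / ENNReal.ofReal (I r) := by
            refine mul_le_mul_right (setLIntegral_mono' measurableSet_Ioo fun r hr => ?_) _
            have hr0 : 0 < r := hs0.1.trans hr.1
            have hr2 : r < 1 / 2 := hr.2.trans hs.2
            have hIr : 0 < I r := hI.pos r ⟨hr0, by linarith⟩
            rw [hf, indicator_of_mem (show r ∈ Ioo (0 : ℝ) (1 / 2) from ⟨hr0, hr2⟩),
              mul_div_assoc, ← ENNReal.ofReal_div_of_pos hIr, div_right_comm, div_self hIr.ne']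
            exact mul_le_mul' (hpa hr.2.le) (ENNReal.ofReal_le_ofReal
              (one_div_le_one_div_of_le hr0 hr.2.le))
        _ ≤ (2 : ℝ≥0) * hardyQ I f s := by
            gcongr
            exact lintegral_mono_set (Ioo_subset_Ioo_right (by linarith [hs.2]))
    · have : compress q s = 0 := by
        rw [compress]
        refine indicator_apply_eq_zero.2 fun _ => ?_
        rw [hq, indicator_of_notMem hs]
      rw [this]; exact zero_le
  calc Y.fnNorm v = Y.bar p := (Y.bar_rearr _ hv.enorm.aemeasurable).symm
    _ ≤ 2 * (2 * (2 * (C * X.weightedNorm I v))) := by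
        refine h1.trans ?_
        gcongr
        refine h2.trans ?_
        gcongr
        rw [Y.bar_smul hμ 2 hQm]
        push_cast
        gcongr
        exact (hC f hfm support_indicator_subset (hfle.trans_lt hfin.lt_top)).trans (by gcongr)
    _ ≤ _ := by
        have : ((8 * C + 1 : ℝ≥0) : ℝ≥0∞) * X.weightedNorm I v =
          2 * (2 * (2 * (C * X.weightedNorm I v))) + X.weightedNorm I v := by push_cast; ring
        rw [this]
        exact le_self_add

/-- For $t<1/4$, $\tilde
Q_I1(t)\ge\frac{I(t)}t\int_{1/4}^{1/2}\frac{ds}{I(s)}\ge\frac{I(t)}t\cdot\frac1{4I(1/2)}$, and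
elsewhere the weight is bounded. Thus the additive constants in the bounds for $f^*$ survive
multiplication by the weight. -/
theorem bar_weight_lt_top (X : RISpace μ)
    (hQ : ∃ C : ℝ≥0, ∀ f : ℝ → ℝ≥0∞, Measurable f → X.bar f < ∞ →
        X.bar (hardyQTilde I f) ≤ C * X.bar f) :
    X.bar (fun t => ENNReal.ofReal (I t / t)) < ∞ := by
  have := hΩ.probability
  have hμ := hΩ.exists_uniform
  obtain ⟨C, hC⟩ := hQ
  have hWm : Measurable fun t => ENNReal.ofReal (I t / t) :=
    (hIm.div measurable_id).ennreal_ofReal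
  have hone : X.bar (fun _ => ((1 : ℝ≥0) : ℝ≥0∞)) < ∞ := by
    rw [X.bar_const hμ]
    exact ENNReal.mul_lt_top (by simp) X.norm_one
  set f : ℝ → ℝ≥0∞ := fun _ => ((1 : ℝ≥0) : ℝ≥0∞) with hf
  have hT := hC f measurable_const hone
  have hTfin : X.bar (hardyQTilde I f) < ∞ :=
    hT.trans_lt (ENNReal.mul_lt_top (by simp) hone)
  have hTm : Measurable (hardyQTilde I f) := hWm.mul
    (Antitone.measurable fun a b hab => lintegral_mono_set (Ioo_subset_Ioo_left hab))
  set c₁ : ℝ≥0 := (4 * I (1 / 2)).toNNReal with hc₁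
  set c₂ : ℝ≥0 := (I (1 / 4) / (1 / 4)).toNNReal with hc₂
  have hIh : 0 < I (1 / 2) := hI.pos _ ⟨by norm_num, by norm_num⟩
  refine lt_of_le_of_lt (X.bar_mono hμ hWm
    (k := fun t => c₁ * hardyQTilde I f t + c₂)
    ((hTm.const_mul _).add measurable_const) fun t ht => ?_) (lt_of_le_of_lt
      (X.bar_add hμ (hTm.const_mul _) measurable_const) ?_)
  · rcases lt_or_ge t (1 / 4) with h | h
    · refine le_add_right ?_
      have hlow : ENNReal.ofReal (1 / (4 * I (1 / 2))) ≤
          ∫⁻ s in Ioo t (1 / 2), f s / ENNReal.ofReal (I s) := by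
        calc ENNReal.ofReal (1 / (4 * I (1 / 2)))
            = ENNReal.ofReal (1 / I (1 / 2)) * volume (Ioo (1 / 4 : ℝ) (1 / 2)) := by
              rw [Real.volume_Ioo, ← ENNReal.ofReal_mul (by positivity)]
              congr 1
              field_simp
              norm_num
          _ = ∫⁻ s in Ioo (1 / 4 : ℝ) (1 / 2), ENNReal.ofReal (1 / I (1 / 2)) := by
              rw [setLIntegral_const]
          _ ≤ ∫⁻ s in Ioo (1 / 4 : ℝ) (1 / 2), f s / ENNReal.ofReal (I s) := by
              refine setLIntegral_mono' measurableSet_Ioo fun s hs => ?_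
              rw [hf, ENNReal.ofReal_div_of_pos hIh, ENNReal.ofReal_one, ENNReal.coe_one]
              exact ENNReal.div_le_div_left (ENNReal.ofReal_le_ofReal
                (hI.le_half ⟨by linarith [hs.1], by linarith [hs.2]⟩)) _
          _ ≤ _ := lintegral_mono_set (Ioo_subset_Ioo_left h.le)
      calc ENNReal.ofReal (I t / t)
          = c₁ * (ENNReal.ofReal (I t / t) * ENNReal.ofReal (1 / (4 * I (1 / 2)))) := by
            rw [mul_left_comm, hc₁]
            change _ = _ * (ENNReal.ofReal _ * _)
            rw [← ENNReal.ofReal_mul (by positivity), mul_one_div_cancel (by positivity)]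
            simp
        _ ≤ _ := by
            rw [hardyQTilde]
            gcongr
    · refine le_add_left (ENNReal.ofReal_le_ofReal ?_)
      exact hI.div_le_div (by norm_num) h ht.2.le
  · rw [X.bar_smul hμ _ hTm, X.bar_const hμ]
    exact ENNReal.add_lt_top.2 ⟨ENNReal.mul_lt_top (by simp) hTfin,
      ENNReal.mul_lt_top (by simp) X.norm_one⟩

/-- The weighted norm is controlled by the gradient. -/
theorem exists_weightedNorm_le (X Y : RISpace μ)
    (hQ : ∃ C : ℝ≥0, ∀ f : ℝ → ℝ≥0∞, Measurable f → Function.support f ⊆ Ioo 0 (1 / 2) →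
      X.bar f < ∞ → Y.bar (hardyQ I f) ≤ C * X.bar f)
    (hQ' : ∃ C : ℝ≥0, ∀ f : ℝ → ℝ≥0∞, Measurable f → X.bar f < ∞ →
        X.bar (hardyQTilde I f) ≤ C * X.bar f) :
    ∃ K : ℝ≥0, ∀ g : Ω → ℝ, IsLip g → Integrable g μ →
      X.weightedNorm I (centered μ g) ≤ K * X.norm (gradNorm g) := by
  have := hΩ.probability
  have hμ := hΩ.exists_uniform
  have hB := bar_weight_lt_top hΩ hI hIm X hQ'
  obtain ⟨L, hL0, hL⟩ := exists_poincare hΩ hI X Y hQ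
  obtain ⟨C, hC⟩ := hQ'
  obtain ⟨D, hD⟩ := X.embed
  set W : ℝ → ℝ≥0∞ := fun t => ENNReal.ofReal (I t / t) with hW
  have hWm : Measurable W := (hIm.div measurable_id).ennreal_ofReal
  set B : ℝ≥0 := (X.bar W).toNNReal with hBdef
  have hBe : X.bar W = B := (ENNReal.coe_toNNReal hB.ne).symm
  have hIq : 0 < I (1 / 4) := hI.pos _ ⟨by norm_num, by norm_num⟩
  set κ : ℝ≥0 := (I (1 / 4)).toNNReal⁻¹ with hκ
  have hκe : (κ : ℝ≥0∞) = (ENNReal.ofReal (I (1 / 4)))⁻¹ := by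
    rw [hκ, ENNReal.coe_inv (by simpa using hIq)]; rfl
  refine ⟨4 * (D * κ * B + 4 * C) + L * B + 1, fun g hg hgi => ?_⟩
  rcases eq_or_ne (X.norm (gradNorm g)) ∞ with htop | hfin
  · rw [htop, ENNReal.mul_top (by positivity)]; exact le_top
  set Γ := X.norm (gradNorm g) with hΓ
  have hpart : ∀ f, IsMedianPart μ g f →
      X.bar (fun t => rearr μ (fun x => ‖f x‖ₑ) t * W t) ≤ (D * κ * B + 4 * C) * Γ := by
    intro f hf
    have hGm := measurable_gradNorm hf.lip.continuous
    have hGΓ : X.norm (gradNorm f) ≤ Γ := X.norm_mono _ _ hGm.aemeasurable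
      (measurable_gradNorm hg.continuous).aemeasurable (Eventually.of_forall hf.grad_le)
    have hint : ∫⁻ x, gradNorm f x ∂μ ≤ D * Γ :=
      (hD _ hGm.aemeasurable).trans (by gcongr)
    have hintfin : ∫⁻ x, gradNorm f x ∂μ ≠ ∞ :=
      ne_top_of_le_ne_top (ENNReal.mul_ne_top ENNReal.coe_ne_top hfin) hint
    set c : ℝ≥0 := (∫⁻ x, gradNorm f x ∂μ).toNNReal * κ with hc
    have hcκ : (c : ℝ≥0∞) = (∫⁻ x, gradNorm f x ∂μ) * κ := by
      rw [hc, ENNReal.coe_mul, ENNReal.coe_toNNReal hintfin]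
    have hce : (c : ℝ≥0∞) = (∫⁻ x, gradNorm f x ∂μ) / ENNReal.ofReal (I (1 / 4)) := by
      rw [hcκ, hκe]
      exact (div_eq_mul_inv _ _).symm
    set φ := hardyMajorant μ f with hφ
    have hφle : X.bar φ ≤ 4 * Γ := (X.bar_hardyMajorant_le hμ hf.lip).trans (by gcongr)
    have hφfin : X.bar φ < ∞ := hφle.trans_lt (ENNReal.mul_lt_top (by simp) hfin.lt_top)
    have hTm : Measurable (hardyQTilde I φ) := hWm.mul
      (Antitone.measurable fun a b hab => lintegral_mono_set (Ioo_subset_Ioo_left hab))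
    calc X.bar (fun t => rearr μ (fun x => ‖f x‖ₑ) t * W t)
        ≤ X.bar (fun t => c * W t + hardyQTilde I φ t) := by
          refine X.bar_mono hμ ((measurable_rearr _).mul hWm) ((hWm.const_mul _).add hTm)
            fun t ht => ?_
          rcases lt_or_ge t (1 / 2) with h | h
          · rw [hardyQTilde, mul_comm (ENNReal.ofReal (I t / t)), ← add_mul, hce]
            gcongr
            exact rearr_le_lintegral_hardyMajorant hΩ hI hf.lip hf.nonneg hf.half ⟨ht.1, h⟩
          · rw [rearr_eq_zero (s := t), zero_mul]
            · exact zero_le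
            · simpa using hf.half.trans (ENNReal.ofReal_le_ofReal h)
      _ ≤ c * X.bar W + X.bar (hardyQTilde I φ) := by
          rw [← X.bar_smul hμ c hWm]
          exact X.bar_add hμ (hWm.const_mul _) hTm
      _ ≤ D * Γ * κ * B + C * (4 * Γ) := by
          rw [hBe, hcκ]
          gcongr
          exact (hC φ (measurable_hardyMajorant f) hφfin).trans (by gcongr)
      _ = _ := by ring
  obtain ⟨m, f₁, f₂, h, hf₁, hf₂⟩ := hg.exists_median_decomposition (μ := μ)
  obtain ⟨-, hL⟩ := hL g hg
  have hmean := (hL hgi).2.2 m f₁ f₂ h hf₁ hf₂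
  set c : ℝ≥0 := ‖m - ∫ y, g y ∂μ‖₊ with hc
  have hce : ‖m - ∫ y, g y ∂μ‖ₑ = c := rfl
  set h₁ : ℝ → ℝ≥0∞ := fun t => rearr μ (fun x => ‖f₁ x‖ₑ) t * W t with hh₁
  set h₂ : ℝ → ℝ≥0∞ := fun t => rearr μ (fun x => ‖f₂ x‖ₑ) t * W t with hh₂
  have hm₁ : Measurable h₁ := (measurable_rearr _).mul hWm
  have hm₂ : Measurable h₂ := (measurable_rearr _).mul hWm
  have hhalf : Measurable fun t : ℝ => t / 2 := measurable_id.div_const 2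
  calc X.weightedNorm I (centered μ g)
      ≤ X.bar (fun t => (h₁ (t / 2) + h₂ (t / 2)) + c * W t) := by
        refine X.bar_mono hμ ((measurable_rearr _).mul hWm)
          (((hm₁.comp hhalf).add (hm₂.comp hhalf)).add (hWm.const_mul _)) fun t ht => ?_
        -- $I(t)/t$ is nonincreasing, so the weight may be moved to $t/2$, and the dilation then
        -- acts on the whole product.
        have hWt : W t ≤ W (t / 2) := ENNReal.ofReal_le_ofReal
          (hI.div_le_div (by linarith [ht.1]) (by linarith [ht.1]) ht.2.le)
        calc rearr μ (fun x => ‖centered μ g x‖ₑ) t * W t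
            ≤ (rearr μ (fun x => ‖f₁ x‖ₑ) (t / 2) + rearr μ (fun x => ‖f₂ x‖ₑ) (t / 2) + c) *
                W t := by
              gcongr
              exact rearr_add_le (fun x => by rw [← hce]; exact enorm_centered_le h x) ht.1.le
          _ ≤ _ := by
              rw [add_mul, add_mul]
              exact add_le_add_left (add_le_add (mul_le_mul_right hWt _) (mul_le_mul_right hWt _)) _
    _ ≤ (X.bar (fun t => h₁ (t / 2)) + X.bar (fun t => h₂ (t / 2))) + X.bar (fun t => c * W t) :=
        (X.bar_add hμ ((hm₁.comp hhalf).add (hm₂.comp hhalf)) (hWm.const_mul _)).trans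
          (add_le_add_left (X.bar_add hμ (hm₁.comp hhalf) (hm₂.comp hhalf)) _)
    _ ≤ (2 * ((D * κ * B + 4 * C) * Γ) + 2 * ((D * κ * B + 4 * C) * Γ)) + L * Γ * B := by
        rw [X.bar_smul hμ c hWm, hBe]
        gcongr
        · refine (X.bar_comp_half_le hμ hm₁).trans ?_
          gcongr
          exact hpart f₁ hf₁
        · refine (X.bar_comp_half_le hμ hm₂).trans ?_
          gcongr
          exact hpart f₂ hf₂
        · exact hmean
    _ ≤ _ := by
        have : ((4 * (D * κ * B + 4 * C) + L * B + 1 : ℝ≥0) : ℝ≥0∞) * Γ =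
          (2 * ((D * κ * B + 4 * C) * Γ) + 2 * ((D * κ * B + 4 * C) * Γ)) + L * Γ * B + Γ := by
            push_cast; ring
        rw [this]
        exact le_self_add

end Weighted

/-! ### Part (b): increments of $f^*$ and the oscillation. -/

section Oscillation

variable {Ω : Type*} [MeasurableSpace Ω] {μ : Measure Ω}

/-- The increments of `f^*` are controlled by the oscillation `f^{**} - f^*`. -/
theorem rearr_half_le_add_lintegral (F : Ω → ℝ≥0∞) (hfin : ∀ s, 0 < s → rearr μ F s ≠ ∞) {r : ℝ}
    (hr : 0 < r) :
    rearr μ F (r / 2) ≤ rearr μ F r +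
      ∫⁻ s in Ioc r (2 * r), 8 * ((rearrAvg μ F s - rearr μ F s) / ENNReal.ofReal s) := by
  set a := rearr μ F with ha
  -- $m(s)=s(f^{**}(s)-f^*(s))$ is nondecreasing, so its value at $r$ bounds it from below on
  -- $(r,2r]$.
  set m : ℝ → ℝ≥0∞ := fun s => ∫⁻ u in Ioo 0 s, (a u - a s) with hm
  have hanti : Antitone a := rearr_antitone F
  have hmono : Monotone m := fun s t hst =>
    (lintegral_mono fun u => tsub_le_tsub_left (hanti hst) _).trans
      (lintegral_mono_set (Ioo_subset_Ioo_right hst))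
  have hinv : ∀ s : ℝ, 0 < s → ENNReal.ofReal (1 / s) * ENNReal.ofReal s = 1 := fun s hs => by
    rw [← ENNReal.ofReal_mul (by positivity), one_div_mul_cancel hs.ne', ENNReal.ofReal_one]
  have hδ : ∀ s, 0 < s → rearrAvg μ F s - a s = ENNReal.ofReal (1 / s) * m s := fun s hs => by
    have e : m s = ENNReal.ofReal s * (rearrAvg μ F s - a s) :=
      (mul_rearrAvg_sub F hs (hfin s hs)).symm
    rw [e, ← mul_assoc, hinv s hs, one_mul]
  have h1 : a (r / 2) - a r ≤ ENNReal.ofReal (2 / r) * m r := by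
    have : ENNReal.ofReal (r / 2) * (a (r / 2) - a r) ≤ m r := by
      calc ENNReal.ofReal (r / 2) * (a (r / 2) - a r)
          = ∫⁻ u in Ioo 0 (r / 2), (a (r / 2) - a r) := by simp [mul_comm]
        _ ≤ ∫⁻ u in Ioo 0 (r / 2), (a u - a r) :=
            setLIntegral_mono' measurableSet_Ioo fun u hu => tsub_le_tsub_right (hanti hu.2.le) _
        _ ≤ m r := lintegral_mono_set (Ioo_subset_Ioo_right (by linarith))
    calc a (r / 2) - a r = ENNReal.ofReal (2 / r) * (ENNReal.ofReal (r / 2) * (a (r / 2) - a r)) := by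
          rw [← mul_assoc, ← ENNReal.ofReal_mul (by positivity)]
          have : 2 / r * (r / 2) = 1 := by field_simp
          rw [this, ENNReal.ofReal_one, one_mul]
      _ ≤ _ := by gcongr
  -- The constant: $\frac2r\,m(r)=8\cdot(2r)^{-2}m(r)\cdot r$, where $r$ is the length of the
  -- interval and $(2r)^{-2}\le s^{-2}$ on it.
  have h2 : ENNReal.ofReal (2 / r) * m r ≤
      ∫⁻ s in Ioc r (2 * r), 8 * ((rearrAvg μ F s - a s) / ENNReal.ofReal s) := by
    calc ENNReal.ofReal (2 / r) * m r
        = 8 * (ENNReal.ofReal (1 / (2 * r)) * (ENNReal.ofReal (1 / (2 * r)) * m r)) *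
            volume (Ioc r (2 * r)) := by
          rw [Real.volume_Ioc, show (8 : ℝ≥0∞) = ENNReal.ofReal 8 by simp, ← mul_assoc, ← mul_assoc,
            mul_right_comm, ← ENNReal.ofReal_mul (by positivity),
            ← ENNReal.ofReal_mul (by positivity), ← ENNReal.ofReal_mul (by positivity)]
          congr 2
          field_simp
          norm_num
      _ = ∫⁻ s in Ioc r (2 * r),
            8 * (ENNReal.ofReal (1 / (2 * r)) * (ENNReal.ofReal (1 / (2 * r)) * m r)) := by
          rw [setLIntegral_const]
      _ ≤ _ := by
          refine setLIntegral_mono' measurableSet_Ioc fun s hs => mul_le_mul_right ?_ _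
          have hs0 : 0 < s := hr.trans hs.1
          have hle : ENNReal.ofReal (1 / (2 * r)) ≤ ENNReal.ofReal (1 / s) :=
            ENNReal.ofReal_le_ofReal (one_div_le_one_div_of_le hs0 hs.2)
          rw [hδ s hs0, ENNReal.div_eq_inv_mul, ← ENNReal.ofReal_inv_of_pos hs0, ← one_div]
          exact mul_le_mul' hle (mul_le_mul' hle (hmono hs.1.le))
  rw [← tsub_le_iff_left]
  exact h1.trans h2

end Oscillation

/-! ### Part (b): the norm $LS(X)$. -/

section LS

variable {Ω : Type*} [MetricSpace Ω] [MeasurableSpace Ω] [BorelSpace Ω] {μ : Measure Ω}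
variable {I : ℝ → ℝ} (hΩ : IsMetricProbabilitySpace μ) (hI : IsIsoperimetricEstimator μ I)
include hΩ hI

/-- The Hardy operator recovers `f^*` from the oscillation `(f^{**}(t) - f^*(t)) I(t) / t`. -/
theorem exists_fnNorm_le_lsNorm (hIm : Measurable I) (X Y : RISpace μ)
    (hQ : ∃ C : ℝ≥0, ∀ f : ℝ → ℝ≥0∞, Measurable f → Function.support f ⊆ Ioo 0 (1 / 2) →
      X.bar f < ∞ → Y.bar (hardyQ I f) ≤ C * X.bar f) :
    ∃ K : ℝ≥0, ∀ v : Ω → ℝ, Measurable v →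
      Y.fnNorm v ≤ K * (X.lsNorm I v + ∫⁻ x, ‖v x‖ₑ ∂μ) := by
  have := hΩ.probability
  have hμ := hΩ.exists_uniform
  obtain ⟨C, hC⟩ := hQ
  set N : ℝ≥0 := (Y.norm fun _ => 1).toNNReal with hN
  have hNe : (N : ℝ≥0∞) = Y.norm fun _ => 1 := ENNReal.coe_toNNReal Y.norm_one.ne
  refine ⟨8 * C + 4 * N + 1, fun v hv => ?_⟩
  set F : Ω → ℝ≥0∞ := fun x => ‖v x‖ₑ with hF
  have hFm : Measurable F := hv.enorm
  have hfin : ∀ s, 0 < s → rearr μ F s ≠ ∞ := fun s hs =>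
    (rearr_lt_top hFm (fun x => enorm_ne_top) hs).ne
  rcases eq_or_ne (X.lsNorm I v + ∫⁻ x, ‖v x‖ₑ ∂μ) ∞ with htop | htop
  · rw [htop, ENNReal.mul_top (by positivity)]; exact le_top
  obtain ⟨hls, hL1⟩ := ENNReal.add_ne_top.1 htop
  set ℓ : ℝ≥0 := (∫⁻ x, ‖v x‖ₑ ∂μ).toNNReal with hℓ
  have hℓe : ∫⁻ x, ‖v x‖ₑ ∂μ = ℓ := (ENNReal.coe_toNNReal hL1).symm
  have hWm : Measurable fun t => ENNReal.ofReal (I t / t) :=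
    (hIm.div measurable_id).ennreal_ofReal
  have hδm : Measurable fun t => rearrAvg μ F t - rearr μ F t :=
    (measurable_rearrAvg F).sub (measurable_rearr F)
  set f : ℝ → ℝ≥0∞ := (Ioo 0 (1 / 2)).indicator fun t =>
    (rearrAvg μ F t - rearr μ F t) * ENNReal.ofReal (I t / t) with hf
  have hfm : Measurable f := (hδm.mul hWm).indicator measurableSet_Ioo
  have hfle : X.bar f ≤ X.lsNorm I v :=
    X.bar_mono hμ hfm (hδm.mul hWm) fun t _ => indicator_le_self _ _ t
  have hQm : Measurable (hardyQ I f) :=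
    Antitone.measurable fun a b hab => lintegral_mono_set (Ioo_subset_Ioo_left hab)
  -- Nothing forces $v$ to vanish on half of the space, so the value at $1/4$ is paid for by the
  -- $L^1$ norm.
  have hquarter : rearr μ F (1 / 4) ≤ (4 * ℓ : ℝ≥0) := by
    refine (rearr_le_rearrAvg F (by norm_num)).trans ((rearrAvg_le hFm (by norm_num)).trans ?_)
    rw [hF, hℓe, ENNReal.ofReal_div_of_pos (by norm_num), div_eq_mul_inv,
      ENNReal.inv_div (by simp) (by simp)]
    push_cast
    simp [mul_comm]
  have hlow : ∀ t ∈ Ioo (0 : ℝ) (1 / 2),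
      rearr μ F t ≤ (4 * ℓ : ℝ≥0) + (8 : ℝ≥0) * hardyQ I f t := by
    intro t ht
    refine (antitone_le_add_lintegral_of_dyadic (rearr_antitone F)
      (k := fun s => 8 * ((rearrAvg μ F s - rearr μ F s) / ENNReal.ofReal s))
      (fun i hi => ?_) ht).trans (add_le_add hquarter ?_)
    · have h := rearr_half_le_add_lintegral F hfin (r := (1 / 2) ^ (i + 1)) (by positivity)
      have e1 : (1 / 2 : ℝ) ^ (i + 1) / 2 = (1 / 2) ^ (i + 2) := by rw [pow_succ _ (i + 1)]; ring
      have e2 : 2 * (1 / 2 : ℝ) ^ (i + 1) = (1 / 2) ^ i := by rw [pow_succ]; ring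
      rwa [e1, e2] at h
    · rw [lintegral_const_mul' _ _ (by norm_num)]
      push_cast
      gcongr
      refine le_trans (setLIntegral_mono' measurableSet_Ioo fun s hs => ?_)
        (lintegral_mono_set (Ioo_subset_Ioo_right (by norm_num : (1 / 2 : ℝ) ≤ 1)))
      have hs0 : 0 < s := ht.1.trans hs.1
      have hIs : 0 < I s := hI.pos s ⟨hs0, by linarith [hs.2]⟩
      rw [hf, indicator_of_mem (show s ∈ Ioo (0 : ℝ) (1 / 2) from ⟨hs0, hs.2⟩), mul_div_assoc,
        ← ENNReal.ofReal_div_of_pos hIs, div_right_comm, div_self hIs.ne', one_div,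
        ENNReal.ofReal_inv_of_pos hs0, ← div_eq_mul_inv]
  calc Y.fnNorm v = Y.bar (rearr μ F) := (Y.bar_rearr _ hFm.aemeasurable).symm
    _ ≤ Y.bar (fun t => (4 * ℓ : ℝ≥0) + (8 : ℝ≥0) * hardyQ I f t) := by
        refine Y.bar_mono hμ (measurable_rearr _) (measurable_const.add (hQm.const_mul _))
          fun t ht => ?_
        rcases lt_or_ge t (1 / 2) with h | h
        · exact hlow t ⟨ht.1, h⟩
        · exact (rearr_antitone F (by linarith)).trans (hquarter.trans le_self_add)
    _ ≤ (4 * ℓ : ℝ≥0) * N + 8 * (C * X.lsNorm I v) := by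
        refine (Y.bar_add hμ measurable_const (hQm.const_mul _)).trans ?_
        rw [Y.bar_const hμ, ← hNe, Y.bar_smul hμ _ hQm]
        push_cast
        gcongr
        exact (hC f hfm support_indicator_subset (hfle.trans_lt hls.lt_top)).trans (by gcongr)
    _ ≤ _ := by
        rw [hℓe]
        have : ((8 * C + 4 * N + 1 : ℝ≥0) : ℝ≥0∞) * (X.lsNorm I v + ℓ) =
          ((4 * ℓ : ℝ≥0) * N + 8 * (C * X.lsNorm I v)) +
            (8 * C * ℓ + 4 * N * X.lsNorm I v + X.lsNorm I v + ℓ) := by push_cast; ring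
        rw [this]
        exact le_self_add

/-- `(f^{**}(t) - f^*(t)) I(t) / t ≤ |∇ f|^{**}(t)`. -/
theorem rearrAvg_sub_mul_le {f : Ω → ℝ} (hf : IsLip f) (h0 : ∀ x, 0 ≤ f x) {t : ℝ}
    (ht : t ∈ Ioo (0 : ℝ) 1) :
    (rearrAvg μ (fun x => ‖f x‖ₑ) t - rearr μ (fun x => ‖f x‖ₑ) t) * ENNReal.ofReal (I t / t) ≤
      rearrAvg μ (gradNorm f) t := by
  have := hΩ.probability
  set F : Ω → ℝ≥0∞ := fun x => ‖f x‖ₑ with hF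
  have hFm : Measurable F := hf.continuous.measurable.enorm
  have hfin : rearr μ F t ≠ ∞ := (rearr_lt_top hFm (fun x => enorm_ne_top) ht.1).ne
  set c := (rearr μ F t).toReal with hc
  have hc0 : 0 ≤ c := ENNReal.toReal_nonneg
  have hDm : Measurable fun τ : ℝ => μ {x | τ < f x} :=
    Antitone.measurable fun a b hab => measure_mono fun x hx => lt_of_le_of_lt hab hx
  have h1 := lintegral_rearr_sub_le hf.continuous.measurable h0 ht.2.le hc0
    (ENNReal.ofReal_toReal hfin).le
  -- Above the level $f^*(t)$ the distribution function is at most $t$, and $\lambda\,I(t)/t\le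
  -- I(\lambda)$ for $0\le\lambda\le t$.
  have h2 : (∫⁻ τ in Ioi c, μ {x | τ < f x}) * ENNReal.ofReal (I t / t) ≤
      ∫⁻ τ in Ioi c, ENNReal.ofReal (I (μ.real {x | τ < f x})) := by
    rw [← lintegral_mul_const _ hDm]
    refine setLIntegral_mono' measurableSet_Ioi fun τ hτ => ?_
    rw [← ofReal_measureReal, ← ENNReal.ofReal_mul measureReal_nonneg]
    refine ENNReal.ofReal_le_ofReal ?_
    rw [← mul_div_assoc, div_le_iff₀ ht.1, mul_comm (I _)]
    exact hI.mul_le measureReal_nonneg (measureReal_superlevel_le ht.1.le hfin (le_of_lt hτ))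
      ht.2.le
  have h3 : ∫⁻ τ in Ioi c, ENNReal.ofReal (I (μ.real {x | τ < f x})) ≤
      ∫⁻ x in {x | rearr μ F t < F x}, gradNorm f x ∂μ := by
    have hU : Ioi c = ⋃ n : ℕ, Ioo c (c + n) := by
      ext τ
      simp only [mem_Ioi, mem_iUnion, mem_Ioo]
      constructor
      · intro h
        obtain ⟨n, hn⟩ := exists_nat_gt (τ - c)
        exact ⟨n, h, by linarith⟩
      · rintro ⟨n, h, -⟩; exact h
    have hdir : Directed (· ⊆ ·) fun n : ℕ => Ioo c (c + n) :=
      Monotone.directed_le fun a b hab => Ioo_subset_Ioo_right (by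
        have : (a : ℝ) ≤ b := by exact_mod_cast hab
        linarith)
    rw [hU, setLIntegral_iUnion_of_directed _ hdir]
    refine iSup_le fun n => (hI.lintegral_le_setLIntegral_gradNorm hΩ hf (by simp)).trans
      (lintegral_mono_set fun x hx => ?_)
    rw [mem_ofPred_eq, hF]
    simp only [Real.enorm_of_nonneg (h0 x)]
    exact (ENNReal.lt_ofReal_iff_toReal_lt hfin).2 hx.1
  have h4 := setLIntegral_le_rearr (measurable_gradNorm hf.continuous)
    (measurableSet_lt measurable_const hFm) (measure_rearr_lt_le (μ := μ) F t)
  rw [rearrAvg, rearrAvg, ENNReal.le_div_iff_mul_le (by simp [ht.1]) (by simp), ← rearrAvg,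
    mul_right_comm, mul_comm _ (ENNReal.ofReal t), mul_rearrAvg_sub F ht.1 hfin]
  exact (mul_le_mul_left h1 _).trans (h2.trans (h3.trans h4))

end LS

/-! ### The upper Boyd index and Hardy averages. -/

section Boyd

variable {Ω : Type*} [MeasurableSpace Ω] {μ : Measure Ω}

theorem rearr_const_mul (f : Ω → ℝ≥0∞) {c : ℝ≥0} (hc : c ≠ 0) (s : ℝ) :
    rearr μ (fun x => c * f x) s = c * rearr μ f s := by
  have hc0 : (c : ℝ≥0∞) ≠ 0 := by simpa using hc
  refine eq_of_forall_ge_iff fun t => ?_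
  rw [rearr_le_iff, mul_comm, ← ENNReal.le_div_iff_mul_le (Or.inl hc0) (Or.inl ENNReal.coe_ne_top),
    rearr_le_iff]
  have : {x | t < c * f x} = {x | t / c < f x} := by
    ext x
    simp only [mem_ofPred_eq]
    rw [ENNReal.div_lt_iff (Or.inl hc0) (Or.inl ENNReal.coe_ne_top), mul_comm]
  rw [this]

/-- A dilated rearrangement is its own rearrangement on $[0,1)$, so iterated dilations can be
computed. -/
theorem rearr_unitVol_rearr_div [IsProbabilityMeasure μ] (G : Ω → ℝ≥0∞) {a : ℝ} (ha : 0 < a)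
    {y : ℝ} (hy : y ∈ Ico (0 : ℝ) 1) :
    rearr unitVol (fun t => rearr μ G (t / a)) y = rearr μ G (y / a) := by
  refine eq_of_forall_lt_iff fun τ => ?_
  rw [lt_rearr_iff, lt_rearr_iff]
  set α := μ {x | τ < G x} with hα
  have hαfin : α ≠ ∞ := measure_ne_top _ _
  have hset : {t | τ < rearr μ G (t / a)} ∩ Ioo 0 1 = Ioo 0 (min (a * α.toReal) 1) := by
    ext t
    simp only [lt_rearr_iff, ← hα, mem_inter_iff, mem_ofPred_eq, mem_Ioo, lt_min_iff]
    constructor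
    · rintro ⟨h1, h2, h3⟩
      rw [ENNReal.ofReal_lt_iff_lt_toReal (by positivity) hαfin, div_lt_iff₀ ha] at h1
      exact ⟨h2, by linarith, h3⟩
    · rintro ⟨h2, h1, h3⟩
      refine ⟨?_, h2, h3⟩
      rw [ENNReal.ofReal_lt_iff_lt_toReal (by positivity) hαfin, div_lt_iff₀ ha]
      linarith
  rw [unitVol_apply, hset, Real.volume_Ioo, sub_zero, ENNReal.ofReal_lt_ofReal_iff_of_nonneg hy.1,
    lt_min_iff, ENNReal.ofReal_lt_iff_lt_toReal (div_nonneg hy.1 ha.le) hαfin, div_lt_iff₀ ha,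
    mul_comm]
  exact and_iff_left hy.2

namespace RISpace

variable (X : RISpace μ) (hμ : ∃ U : Ω → ℝ, MeasurePreserving U μ unitVol)

theorem measurable_dilation (s : ℝ) (h : ℝ → ℝ≥0∞) : Measurable (dilation s h) :=
  Measurable.indicator ((measurable_rearr h).comp (measurable_id.div_const s)) measurableSet_Ioo

include hμ

/-- $E_s$ is dominated by $n$ doublings when $s<2^n$. Finiteness matters because `upperBoydIndex`
uses `toReal`, which sends $\infty$ to $0$. -/
theorem dilationNorm_lt_top {s : ℝ} (hs : 1 < s) : X.dilationNorm s < ∞ := by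
  obtain ⟨n, hn⟩ := pow_unbounded_of_one_lt s (one_lt_two (α := ℝ))
  refine lt_of_le_of_lt (iSup₂_le fun h hh => ?_) 
    (show (2 : ℝ≥0∞) ^ n < ∞ from ENNReal.pow_lt_top (by simp))
  calc X.bar (dilation s h) ≤ X.bar (fun t => rearr unitVol h (t / 2 ^ n)) := by
        refine X.bar_mono hμ (measurable_dilation s h)
          ((measurable_rearr h).comp (measurable_id.div_const _)) fun t ht => ?_
        refine indicator_apply_le' (fun _ => rearr_antitone h ?_) fun _ => zero_le
        exact div_le_div_of_nonneg_left ht.1.le (by linarith) hn.le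
    _ ≤ 2 ^ n * X.bar (rearr unitVol h) := X.bar_comp_div_pow_le hμ (measurable_rearr h) n
    _ ≤ 2 ^ n := by
        rw [X.bar_rearr_unitVol]
        exact mul_le_of_le_one_right zero_le hh.2

theorem bar_dilation_le {s : ℝ} (hs : 1 < s) {h : ℝ → ℝ≥0∞} (hh : Measurable h)
    (hfin : X.bar h ≠ ∞) : X.bar (dilation s h) ≤ X.dilationNorm s * X.bar h := by
  have key : ∀ c : ℝ≥0, c ≠ 0 → c * X.bar h ≤ 1 → c * X.bar (dilation s h) ≤ X.dilationNorm s := by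
    intro c hc hle
    rw [← X.bar_smul hμ c (measurable_dilation s h)]
    have e : (fun t => c * dilation s h t) = dilation s (fun t => c * h t) := by
      funext t
      simp only [dilation, indicator]
      split_ifs
      · rw [rearr_const_mul h hc]
      · simp
    rw [e]
    refine le_iSup₂ (f := fun (h : ℝ → ℝ≥0∞) (_ : Measurable h ∧ X.bar h ≤ 1) =>
      X.bar (dilation s h)) _ ⟨hh.const_mul _, ?_⟩
    rwa [X.bar_smul hμ c hh]
  rcases eq_or_ne (X.bar h) 0 with h0 | h0
  · rw [h0, mul_zero, nonpos_iff_eq_zero]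
    by_contra hne
    -- If $h$ has norm zero, all its multiples lie in the unit ball, so every multiple of $\|E_sh\|$
    -- is at most the finite dilation norm.
    obtain ⟨n, hn⟩ := ENNReal.exists_nat_mul_gt hne (X.dilationNorm_lt_top hμ hs).ne
    rcases eq_or_ne n 0 with rfl | hn0
    · simp at hn
    · have := key n (by simpa using hn0) (by simp [h0])
      exact absurd hn (not_lt.2 (by simpa using this))
  · have hcoe : ((X.bar h).toNNReal⁻¹ : ℝ≥0) = (X.bar h)⁻¹ := by
      rw [ENNReal.coe_inv (by simp [ENNReal.toNNReal_eq_zero_iff, h0, hfin]),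
        ENNReal.coe_toNNReal hfin]
    have := key (X.bar h).toNNReal⁻¹ (by simp [ENNReal.toNNReal_eq_zero_iff, h0, hfin])
      (by rw [hcoe, ENNReal.inv_mul_cancel h0 hfin])
    rw [hcoe, ← ENNReal.div_eq_inv_mul, ENNReal.div_le_iff h0 hfin] at this
    exact this

theorem exists_dilationNorm_lt_of_upperBoydIndex_lt_one (h : X.upperBoydIndex < 1) :
    ∃ s : ℝ, 1 < s ∧ X.dilationNorm s < ENNReal.ofReal s := by
  obtain ⟨_, ⟨s, hs, rfl⟩, hlt⟩ := exists_lt_of_csInf_lt (nonempty_Ioi.image _) h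
  have hs1 : 1 < s := hs
  refine ⟨s, hs1, ?_⟩
  rw [div_lt_one (Real.log_pos hs1)] at hlt
  have hN := (X.dilationNorm_lt_top hμ hs1).ne
  rw [ENNReal.lt_ofReal_iff_toReal_lt hN]
  -- The value `Real.log 0 = 0` carries no information, so a zero norm is treated apart.
  rcases (ENNReal.toReal_nonneg (a := X.dilationNorm s)).eq_or_lt with h0 | h0
  · rw [← h0]; linarith
  · exact (Real.log_lt_log_iff h0 (by linarith)).1 hlt

/-- If the upper Boyd index is less than `1`, then the Hardy averages `f^{**}` are bounded. -/
theorem exists_bar_rearrAvg_le [IsProbabilityMeasure μ] (h : X.upperBoydIndex < 1) :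
    ∃ K : ℝ≥0, ∀ G : Ω → ℝ≥0∞, Measurable G → X.norm G ≠ ∞ →
      X.bar (rearrAvg μ G) ≤ K * X.norm G := by
  obtain ⟨s, hs, hN⟩ := X.exists_dilationNorm_lt_of_upperBoydIndex_lt_one hμ h
  have hs0 : 0 < s := by linarith
  set N := X.dilationNorm s with hNdef
  set q : ℝ≥0∞ := ENNReal.ofReal s⁻¹ with hq
  -- The ratio $h_X(s)/s$ of the geometric series below; a single $s$ with ratio less than $1$
  -- suffices.
  have hqN : q * N < 1 := by
    calc q * N < q * ENNReal.ofReal s :=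
          ENNReal.mul_lt_mul_right (by simp [hq, hs0]) (by simp [hq]) hN
      _ = 1 := by rw [hq, ← ENNReal.ofReal_mul (by positivity), inv_mul_cancel₀ hs0.ne']; simp
  have hNfin : N ≠ ∞ := hN.ne_top
  have hgeo : (1 - q * N)⁻¹ ≠ ∞ := ENNReal.inv_ne_top.2 (tsub_pos_of_lt hqN).ne'
  set K : ℝ≥0 := (N * (1 - q * N)⁻¹).toNNReal with hK
  have hKe : (K : ℝ≥0∞) = N * (1 - q * N)⁻¹ := ENNReal.coe_toNNReal (ENNReal.mul_ne_top hNfin hgeo)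
  refine ⟨K, fun G hG hGfin => ?_⟩
  set g : ℕ → ℝ → ℝ≥0∞ := fun k t => rearr μ G (t / s ^ k) with hg
  have hgm : ∀ k, Measurable (g k) := fun k =>
    (measurable_rearr G).comp (measurable_id.div_const _)
  have hgle : ∀ k, X.bar (g k) ≤ N ^ k * X.norm G := by
    intro k
    induction k with
    | zero => simp only [hg, pow_zero, div_one, one_mul]; exact (X.bar_rearr G hG.aemeasurable).le
    | succ k ih =>
      have hfin : X.bar (g k) ≠ ∞ :=
        ne_top_of_le_ne_top (ENNReal.mul_ne_top (ENNReal.pow_ne_top hNfin) hGfin) ih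
      calc X.bar (g (k + 1)) = X.bar (dilation s (g k)) := by
            refine X.bar_congr hμ (hgm _) (measurable_dilation s _) fun t ht => ?_
            rw [dilation, indicator_of_mem (show t ∈ Ioo 0 s from ⟨ht.1, ht.2.trans hs⟩), hg]
            simp only
            rw [rearr_unitVol_rearr_div G (by positivity) ⟨div_nonneg ht.1.le hs0.le, by
              rw [div_lt_one hs0]; linarith [ht.2]⟩, div_div, pow_succ']
        _ ≤ N * X.bar (g k) := X.bar_dilation_le hμ hs (hgm k) hfin
        _ ≤ N * (N ^ k * X.norm G) := by gcongr
        _ = N ^ (k + 1) * X.norm G := by rw [pow_succ']; ring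
  -- Cut $(0,t)$ at the points $ts^{-k}$ and bound $G^*$ on each piece by its value at the left end.
  have hpt : ∀ t ∈ Ioo (0 : ℝ) 1,
      rearrAvg μ G t ≤ ∑' k : ℕ, ((Real.toNNReal s⁻¹ ^ k : ℝ≥0) : ℝ≥0∞) * g (k + 1) t := by
    intro t ht
    rw [rearrAvg, ENNReal.div_le_iff_le_mul (by simp [ht.1]) (by simp)]
    have hs1 : s⁻¹ < 1 := inv_lt_one_of_one_lt₀ hs
    have hsi : 0 < s⁻¹ := inv_pos.2 hs0
    have hcov : Ioo 0 t ⊆ ⋃ k : ℕ, Ioc (t * s⁻¹ ^ (k + 1)) (t * s⁻¹ ^ k) := by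
      intro u hu
      obtain ⟨k, h1, h2⟩ := exists_nat_pow_near_of_lt_one (x := u / t) (div_pos hu.1 ht.1)
        ((div_le_one ht.1).2 hu.2.le) hsi hs1
      rw [lt_div_iff₀ ht.1] at h1
      rw [div_le_iff₀ ht.1] at h2
      exact mem_iUnion.2 ⟨k, by linarith, by linarith⟩
    calc ∫⁻ u in Ioo 0 t, rearr μ G u
        ≤ ∫⁻ u in ⋃ k : ℕ, Ioc (t * s⁻¹ ^ (k + 1)) (t * s⁻¹ ^ k), rearr μ G u :=
          lintegral_mono_set hcov
      _ ≤ ∑' k : ℕ, ∫⁻ u in Ioc (t * s⁻¹ ^ (k + 1)) (t * s⁻¹ ^ k), rearr μ G u :=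
          lintegral_iUnion_le _ _
      _ ≤ ∑' k : ℕ, ((Real.toNNReal s⁻¹ ^ k : ℝ≥0) : ℝ≥0∞) * g (k + 1) t * ENNReal.ofReal t := by
          refine ENNReal.tsum_le_tsum fun k => ?_
          have hgk : g (k + 1) t = rearr μ G (t * s⁻¹ ^ (k + 1)) := by
            simp only [hg, inv_pow, div_eq_mul_inv]
          calc ∫⁻ u in Ioc (t * s⁻¹ ^ (k + 1)) (t * s⁻¹ ^ k), rearr μ G u
              ≤ ∫⁻ u in Ioc (t * s⁻¹ ^ (k + 1)) (t * s⁻¹ ^ k), g (k + 1) t := by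
                refine setLIntegral_mono' measurableSet_Ioc fun u hu => ?_
                rw [hgk]
                exact rearr_antitone G hu.1.le
            _ = g (k + 1) t * ENNReal.ofReal (t * s⁻¹ ^ k - t * s⁻¹ ^ (k + 1)) := by
                rw [setLIntegral_const, Real.volume_Ioc]
            _ ≤ g (k + 1) t * ENNReal.ofReal (s⁻¹ ^ k * t) := by
                gcongr
                have : 0 ≤ t * s⁻¹ ^ (k + 1) := mul_nonneg ht.1.le (by positivity)
                linarith
            _ = _ := by
                rw [ENNReal.ofReal_mul (by positivity), ENNReal.ofReal_pow hsi.le, ENNReal.coe_pow,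
                  ENNReal.ofReal]
                ring
      _ = _ := ENNReal.tsum_mul_right
  have hterm : ∀ k : ℕ, Measurable fun t =>
      ((Real.toNNReal s⁻¹ ^ k : ℝ≥0) : ℝ≥0∞) * g (k + 1) t := fun k => (hgm _).const_mul _
  calc X.bar (rearrAvg μ G)
      ≤ X.bar (fun t => ∑' k : ℕ, ((Real.toNNReal s⁻¹ ^ k : ℝ≥0) : ℝ≥0∞) * g (k + 1) t) :=
        X.bar_mono hμ (measurable_rearrAvg G) (Measurable.tsum hterm) hpt
    _ ≤ ∑' k : ℕ, X.bar (fun t => ((Real.toNNReal s⁻¹ ^ k : ℝ≥0) : ℝ≥0∞) * g (k + 1) t) :=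
        X.bar_tsum_le hμ hterm
    _ ≤ ∑' k : ℕ, (q * N) ^ k * (N * X.norm G) := by
        refine ENNReal.tsum_le_tsum fun k => ?_
        rw [X.bar_smul hμ _ (hgm _)]
        calc ((Real.toNNReal s⁻¹ ^ k : ℝ≥0) : ℝ≥0∞) * X.bar (g (k + 1))
            ≤ q ^ k * (N ^ (k + 1) * X.norm G) := by
              rw [ENNReal.coe_pow]
              gcongr
              · exact le_rfl
              · exact hgle _
          _ = _ := by rw [mul_pow, pow_succ]; ring
    _ = K * X.norm G := by
        rw [ENNReal.tsum_mul_right, ENNReal.tsum_geometric, hKe]; ring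

end RISpace

end Boyd

/-! ### Geometric growth of $I(t)/t$ under the integral condition. -/

section Weights

variable {Ω : Type*} [MetricSpace Ω] [MeasurableSpace Ω] {μ : Measure Ω} {I : ℝ → ℝ}
variable (hI : IsIsoperimetricEstimator μ I)
include hI

/-- On $[2^{-j-1},2^{-j}]$ the integrand is at least its value at the right end, and the length is
half of $2^{-j}$; hence the factor $2$. -/
theorem sum_dyadic_le_integral (j : ℕ) :
    ∑ k ∈ Finset.range j, I ((1 / 2) ^ k) / (1 / 2) ^ k ≤
      2 * ∫ s in ((1 / 2 : ℝ) ^ j)..1, I s / s / s := by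
  have hp : ∀ i : ℕ, (0 : ℝ) < (1 / 2) ^ i := fun i => by positivity
  have hp1 : ∀ i : ℕ, (1 / 2 : ℝ) ^ i ≤ 1 := fun i => pow_le_one₀ (by norm_num) (by norm_num)
  have hint : ∀ a b : ℝ, 0 < a → a ≤ b → b ≤ 1 →
      IntervalIntegrable (fun s => I s / s / s) volume a b := by
    intro a b ha hab hb
    refine ContinuousOn.intervalIntegrable ?_
    rw [uIcc_of_le hab]
    have hne : ∀ s ∈ Icc a b, s ≠ 0 := fun s hs => (ha.trans_le hs.1).ne'
    exact ((hI.continuousOn.mono (Icc_subset_Icc ha.le hb)).div continuousOn_id hne).div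
      continuousOn_id hne
  induction j with
  | zero => simp
  | succ j ih =>
    have hlt : (1 / 2 : ℝ) ^ (j + 1) ≤ (1 / 2) ^ j := by rw [pow_succ]; linarith [hp j]
    have hlow : I ((1 / 2) ^ j) / (1 / 2) ^ j ≤
        2 * ∫ s in ((1 / 2 : ℝ) ^ (j + 1))..((1 / 2) ^ j), I s / s / s := by
      have h := intervalIntegral.integral_mono_on hlt
        (f := fun _ => I ((1 / 2) ^ j) / (1 / 2) ^ j / (1 / 2) ^ j) (by simp)
        (hint _ _ (hp _) hlt (hp1 _)) fun s hs => by
          have hs0 : 0 < s := (hp _).trans_le hs.1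
          refine div_le_div₀ (div_nonneg (hI.nonneg ⟨hs0.le, hs.2.trans (hp1 j)⟩) hs0.le)
            (hI.div_le_div hs0 hs.2 (hp1 j)) hs0 hs.2
      rw [intervalIntegral.integral_const, smul_eq_mul] at h
      have e : ((1 / 2 : ℝ) ^ j - (1 / 2) ^ (j + 1)) *
          (I ((1 / 2) ^ j) / (1 / 2) ^ j / (1 / 2) ^ j) = I ((1 / 2) ^ j) / (1 / 2) ^ j / 2 := by
        have := (hp j).ne'
        rw [pow_succ]
        field_simp
        ring
      linarith
    rw [Finset.sum_range_succ, ← intervalIntegral.integral_add_adjacent_intervals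
      (hint _ _ (hp _) hlt (hp1 _)) (hint _ _ (hp j) (hp1 _) le_rfl)]
    linarith

/-- The integral condition makes the dyadic values of `I(t) / t` grow geometrically. -/
theorem HasIntegralCondition.exists_dyadic_growth (hc : HasIntegralCondition I) :
    ∃ M θ : ℝ, 0 ≤ M ∧ 0 ≤ θ ∧ θ < 1 ∧ ∀ k m : ℕ,
      I ((1 / 2) ^ k) / (1 / 2) ^ k ≤ M * θ ^ m * (I ((1 / 2) ^ (k + m)) / (1 / 2) ^ (k + m)) := by
  obtain ⟨c, hc0, hc⟩ := hc
  set w : ℕ → ℝ := fun k => I ((1 / 2) ^ k) / (1 / 2) ^ k with hw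
  set S : ℕ → ℝ := fun j => ∑ k ∈ Finset.range j, w k with hS
  have hw0 : ∀ k, 0 ≤ w k := fun k => div_nonneg (hI.nonneg ⟨by positivity,
    pow_le_one₀ (by norm_num) (by norm_num)⟩) (by positivity)
  -- At $j=0$ the sum is empty; the integral condition is available only for $t<1$.
  have hSw : ∀ j, S j ≤ 2 * c * w j := by
    intro j
    rcases j with _ | j
    · simpa [hS] using mul_nonneg (mul_nonneg zero_le_two hc0.le) (hw0 0)
    · refine (sum_dyadic_le_integral hI (j + 1)).trans ?_
      have h1 : (1 / 2 : ℝ) ^ (j + 1) < 1 :=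
        pow_lt_one₀ (by norm_num) (by norm_num) (Nat.succ_ne_zero j)
      have := hc ((1 / 2) ^ (j + 1)) ⟨by positivity, h1⟩
      rw [hw]
      linarith
  -- From `hSw`, $S_{j+1}=S_j+w_j\ge(1+\frac1{2c})S_j$: the partial sums grow geometrically, and
  -- each $w_k$ is comparable to $S_{k+1}$.
  set θ : ℝ := 2 * c / (2 * c + 1) with hθ
  have hθ0 : 0 ≤ θ := by positivity
  have hstep : ∀ j, S j ≤ θ * S (j + 1) := by
    intro j
    have e : S (j + 1) = S j + w j := Finset.sum_range_succ _ _
    rw [e, hθ, div_mul_eq_mul_div, le_div_iff₀ (by positivity)]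
    linarith [hSw j]
  have hpow : ∀ j m, S j ≤ θ ^ m * S (j + m) := by
    intro j m
    induction m with
    | zero => simp
    | succ m ih =>
      refine ih.trans ?_
      rw [pow_succ, mul_assoc]
      exact mul_le_mul_of_nonneg_left (hstep _) (by positivity)
  refine ⟨2 * c + 1, θ, by positivity, hθ0, ?_, fun k m => ?_⟩
  · rw [hθ, div_lt_one (by positivity)]; linarith
  · have h1 : w k ≤ S (k + 1) := by
      have e : S (k + 1) = S k + w k := Finset.sum_range_succ _ _
      have : 0 ≤ S k := Finset.sum_nonneg fun i _ => hw0 i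
      linarith
    have h2 : S (k + m + 1) ≤ (2 * c + 1) * w (k + m) := by
      have e : S (k + m + 1) = S (k + m) + w (k + m) := Finset.sum_range_succ _ _
      linarith [hSw (k + m)]
    calc w k ≤ θ ^ m * S (k + 1 + m) := h1.trans (hpow _ _)
      _ ≤ θ ^ m * ((2 * c + 1) * w (k + m)) := by
          rw [show k + 1 + m = k + m + 1 by ring]
          exact mul_le_mul_of_nonneg_left h2 (by positivity)
      _ = _ := by ring

end Weights

/-! ### Part (b) under the integral condition. -/

section

variable {Ω : Type*} [MetricSpace Ω] [MeasurableSpace Ω] [BorelSpace Ω] {μ : Measure Ω} {I : ℝ → ℝ}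
variable (hΩ : IsMetricProbabilitySpace μ) (hI : IsIsoperimetricEstimator μ I)
include hΩ hI

/-- In the band $j=k+m$ the distribution function is at most $2^{-j}$, so $I(2^{-j})/2^{-j}$ times
it is at most its image under $I$, whose integral the coarea inequality bounds. -/
theorem lintegral_superlevel_le_tsum {f : Ω → ℝ} (hf : IsLip f) (h0 : ∀ x, 0 ≤ f x) {k : ℕ}
    (hk : 1 ≤ k) :
    ∫⁻ τ in Ioi (rearr μ (fun x => ‖f x‖ₑ) ((1 / 2) ^ k)).toReal, μ {x | τ < f x} ≤
      ∑' m : ℕ, (∫⁻ x in dyadicBand μ (fun x => ‖f x‖ₑ) (k + m), gradNorm f x ∂μ) *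
        (ENNReal.ofReal (I ((1 / 2) ^ (k + m)) / (1 / 2) ^ (k + m)))⁻¹ := by
  have := hΩ.probability
  set F : Ω → ℝ≥0∞ := fun x => ‖f x‖ₑ with hF
  set a : ℕ → ℝ := fun j => (rearr μ F ((1 / 2) ^ j)).toReal with ha
  have hp : ∀ i : ℕ, (0 : ℝ) < (1 / 2) ^ i := fun i => by positivity
  have hfin : ∀ r, 0 < r → rearr μ F r ≠ ∞ := fun r hr =>
    (rearr_lt_top hf.continuous.measurable.enorm (fun x => enorm_ne_top) hr).ne
  have hDm : Measurable fun τ : ℝ => μ {x | τ < f x} :=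
    Antitone.measurable fun a b hab => measure_mono fun x hx => lt_of_le_of_lt hab hx
  -- A level that no $a_j$ exceeds has a null superlevel set and contributes nothing.
  have hcov : Ioi (a k) ⊆ (⋃ m : ℕ, Ico (a (k + m)) (a (k + m + 1))) ∪
      {τ | μ {x | τ < f x} = 0} := by
    intro τ hτ
    have hτ0 : 0 ≤ τ := le_trans ENNReal.toReal_nonneg (le_of_lt hτ)
    rcases eq_or_ne (μ {x | τ < f x}) 0 with h | h
    · exact Or.inr h
    left
    have hex : ∃ j, τ < a j := by
      obtain ⟨j, hj⟩ := exists_pow_lt_of_lt_one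
        (ENNReal.toReal_pos h (measure_ne_top _ _)) (show (1 / 2 : ℝ) < 1 by norm_num)
      refine ⟨j, not_le.1 fun hle => ?_⟩
      exact absurd (measureReal_superlevel_le (hp j).le (hfin _ (hp j)) hle) (not_le.2 hj)
    classical
    have hmin := Nat.find_spec hex
    have hgt : k < Nat.find hex := by
      by_contra hle
      have : a (Nat.find hex) ≤ a k := ENNReal.toReal_mono (hfin _ (hp _))
        (rearr_antitone F (pow_le_pow_of_le_one (by norm_num) (by norm_num) (not_lt.1 hle)))
      exact absurd (hmin.trans_le this) (not_lt.2 (le_of_lt hτ))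
    obtain ⟨m, hm⟩ := Nat.exists_eq_add_of_lt hgt
    refine mem_iUnion.2 ⟨m, not_lt.1 (Nat.find_min hex (m := k + m) (by omega)), ?_⟩
    rwa [← hm]
  calc ∫⁻ τ in Ioi (a k), μ {x | τ < f x}
      ≤ (∫⁻ τ in ⋃ m : ℕ, Ico (a (k + m)) (a (k + m + 1)), μ {x | τ < f x}) +
          ∫⁻ τ in {τ | μ {x | τ < f x} = 0}, μ {x | τ < f x} :=
        (lintegral_mono_set hcov).trans (lintegral_union_le _ _ _)
    _ = ∫⁻ τ in ⋃ m : ℕ, Ico (a (k + m)) (a (k + m + 1)), μ {x | τ < f x} := by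
        have hz : ∫⁻ τ in {τ | μ {x | τ < f x} = 0}, μ {x | τ < f x} = 0 :=
          setLIntegral_eq_zero (hDm (measurableSet_singleton 0)) fun τ hτ => hτ
        rw [hz, add_zero]
    _ ≤ ∑' m : ℕ, ∫⁻ τ in Ico (a (k + m)) (a (k + m + 1)), μ {x | τ < f x} :=
        lintegral_iUnion_le _ _
    _ ≤ _ := by
        refine ENNReal.tsum_le_tsum fun m => ?_
        have hj2 : (1 / 2 : ℝ) ^ (k + m) ≤ 1 / 2 := by
          simpa using pow_le_pow_of_le_one (a := (1 / 2 : ℝ)) (by norm_num) (by norm_num)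
            (show 1 ≤ k + m by omega)
        have hw : 0 < I ((1 / 2) ^ (k + m)) / (1 / 2) ^ (k + m) :=
          div_pos (hI.pos _ ⟨hp _, by linarith⟩) (hp _)
        rw [← ENNReal.div_eq_inv_mul.trans (mul_comm _ _),
          ENNReal.le_div_iff_mul_le (Or.inl (by simpa using hw)) (Or.inl ENNReal.ofReal_ne_top),
          setLIntegral_congr Ioo_ae_eq_Ico.symm, ← lintegral_mul_const _ hDm]
        refine le_trans ?_ (lintegral_Ioo_rearr_le hΩ hI hf h0 (hp (k + m + 1))
          (pow_le_pow_of_le_one (by norm_num) (by norm_num) (Nat.le_succ _)))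
        refine setLIntegral_mono' measurableSet_Ioo fun τ hτ => ?_
        rw [← ofReal_measureReal, ← ENNReal.ofReal_mul measureReal_nonneg]
        refine ENNReal.ofReal_le_ofReal ?_
        rw [← mul_div_assoc, div_le_iff₀ (hp _), mul_comm (I _)]
        exact hI.mul_le measureReal_nonneg (measureReal_superlevel_le (hp _).le (hfin _ (hp _))
          hτ.1.le) (by linarith)

/-- Under dyadic growth of `I(t) / t`, the oscillation is controlled by dilations of the averages
of the gradient over the dyadic bands. -/
theorem rearrAvg_sub_mul_le_tsum {M θ : ℝ} (hM : 0 ≤ M) (hθ : 0 ≤ θ)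
    (hgrow : ∀ k m : ℕ, I ((1 / 2) ^ k) / (1 / 2) ^ k ≤
      M * θ ^ m * (I ((1 / 2) ^ (k + m)) / (1 / 2) ^ (k + m)))
    {f : Ω → ℝ} (hf : IsLip f) (h0 : ∀ x, 0 ≤ f x) {t : ℝ} (ht : t ∈ Ioo (0 : ℝ) (1 / 2)) :
    (rearrAvg μ (fun x => ‖f x‖ₑ) t - rearr μ (fun x => ‖f x‖ₑ) t) * ENNReal.ofReal (I t / t) ≤
      ∑' m : ℕ, ENNReal.ofReal (4 * M * (θ / 2) ^ m) *
        compress (bandAverage μ (fun x => ‖f x‖ₑ) (gradNorm f)) (t / 2 ^ m) := by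
  have := hΩ.probability
  set F : Ω → ℝ≥0∞ := fun x => ‖f x‖ₑ with hF
  have hp : ∀ i : ℕ, (0 : ℝ) < (1 / 2) ^ i := fun i => by positivity
  have hfin : ∀ r, 0 < r → rearr μ F r ≠ ∞ := fun r hr =>
    (rearr_lt_top hf.continuous.measurable.enorm (fun x => enorm_ne_top) hr).ne
  -- Locating $2t$ gives $2^{-i-2}<t\le2^{-i-1}$. The $i$-th dyadic interval carries the band $i+1$,
  -- and `compress` corrects this offset.
  obtain ⟨i, hi⟩ := exists_mem_dyadicIoc (s := 2 * t) ⟨by linarith [ht.1], by linarith [ht.2]⟩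
  rw [dyadicIoc, mem_Ioc] at hi
  have hk1 : t ≤ (1 / 2) ^ (i + 1) := by rw [pow_succ]; linarith [hi.2]
  have hk2 : (1 / 2) ^ (i + 2) < t := by rw [pow_succ]; linarith [hi.1]
  have hhalf : (1 / 2 : ℝ) ^ (i + 1) ≤ 1 / 2 := by
    simpa using pow_le_pow_of_le_one (a := (1 / 2 : ℝ)) (by norm_num) (by norm_num)
      (show 1 ≤ i + 1 by omega)
  set w : ℕ → ℝ := fun k => I ((1 / 2) ^ k) / (1 / 2) ^ k with hw
  have hWt : I t / t ≤ 2 * w (i + 1) := by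
    have h1 : I t / t ≤ w (i + 2) := hI.div_le_div (hp _) hk2.le (by linarith [ht.2])
    have h2 : w (i + 2) ≤ 2 * w (i + 1) := by
      simp only [hw]
      rw [div_le_iff₀ (hp _)]
      have e : 2 * (I ((1 / 2) ^ (i + 1)) / (1 / 2) ^ (i + 1)) * (1 / 2) ^ (i + 2) =
          I ((1 / 2) ^ (i + 1)) := by
        have := (hp (i + 1)).ne'
        rw [pow_succ _ (i + 1)]
        field_simp
      rw [e]
      exact hI.mono (hp _).le (by linarith) hhalf
    linarith
  have hti : 1 / t ≤ 2 * 2 ^ (i + 1) := by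
    rw [div_le_iff₀ ht.1]
    have : (2 : ℝ) ^ (i + 2) * (1 / 2) ^ (i + 2) = 1 := by rw [← mul_pow]; norm_num
    have h2 : (2 : ℝ) * 2 ^ (i + 1) = 2 ^ (i + 2) := by ring
    rw [h2, ← this]
    exact mul_le_mul_of_nonneg_left hk2.le (by positivity)
  have hB : ∀ m : ℕ, compress (bandAverage μ F (gradNorm f)) (t / 2 ^ m) =
      ENNReal.ofReal (2 ^ (i + 1 + m)) * ∫⁻ x in dyadicBand μ F (i + 1 + m), gradNorm f x ∂μ := by
    intro m
    have h2m : (1 : ℝ) ≤ 2 ^ m := one_le_pow₀ (by norm_num)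
    have hmem : t / 2 ^ m ∈ Ioo (0 : ℝ) (1 / 2) :=
      ⟨div_pos ht.1 (by positivity), (div_le_self ht.1.le h2m).trans_lt ht.2⟩
    have hmem2 : 2 * (t / 2 ^ m) ∈ dyadicIoc (i + m) := by
      have e : 2 * (t / 2 ^ m) = 2 * t * (1 / 2) ^ m := by rw [one_div_pow]; ring
      rw [dyadicIoc, mem_Ioc, e, show i + m + 1 = i + 1 + m by ring, pow_add _ (i + 1), pow_add _ i m]
      exact ⟨mul_lt_mul_of_pos_right hi.1 (hp m), mul_le_mul_of_nonneg_right hi.2 (hp m).le⟩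
    rw [compress, indicator_of_mem hmem, bandAverage, dyadicGlue_of_mem _ hmem2,
      show i + m + 1 = i + 1 + m by ring]
  have h1 := lintegral_rearr_sub_le hf.continuous.measurable h0 (t := t) (by linarith [ht.2])
    (c := (rearr μ F ((1 / 2) ^ (i + 1))).toReal) ENNReal.toReal_nonneg
    (by rw [ENNReal.ofReal_toReal (hfin _ (hp _))]; exact rearr_antitone F hk1)
  have h2 := h1.trans (lintegral_superlevel_le_tsum hΩ hI hf h0 (k := i + 1) (by omega))
  have hδ : rearrAvg μ F t - rearr μ F t = ENNReal.ofReal (1 / t) *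
      ∫⁻ s in Ioo 0 t, (rearr μ F s - rearr μ F t) := by
    rw [← mul_rearrAvg_sub F ht.1 (hfin t ht.1), ← mul_assoc, ← ENNReal.ofReal_mul
      (by simp [ht.1.le]), one_div_mul_cancel ht.1.ne', ENNReal.ofReal_one, one_mul]
  rw [hδ, mul_right_comm, ← ENNReal.ofReal_mul (by simp [ht.1.le])]
  refine (mul_le_mul_right h2 _).trans ?_
  rw [← ENNReal.tsum_mul_left]
  refine ENNReal.tsum_le_tsum fun m => ?_
  have hwm : 0 < w (i + 1 + m) := by
    refine div_pos (hI.pos _ ⟨hp _, ?_⟩) (hp _)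
    exact pow_lt_one₀ (by norm_num) (by norm_num) (by omega)
  have hW0 : 0 ≤ 1 / t * (I t / t) := mul_nonneg (by simp [ht.1.le])
    (div_nonneg (hI.nonneg ⟨ht.1.le, by linarith [ht.2]⟩) ht.1.le)
  rw [hB, ← ENNReal.ofReal_inv_of_pos hwm, ← mul_assoc (ENNReal.ofReal (4 * _ * _)),
    ← ENNReal.ofReal_mul (by positivity), mul_comm (lintegral _ _), ← mul_assoc,
    ← ENNReal.ofReal_mul hW0]
  refine mul_le_mul_left (ENNReal.ofReal_le_ofReal ?_) _
  rw [← div_eq_mul_inv, div_le_iff₀ hwm]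
  -- The two factors $2$ give the constant $4$. The band average carries $2^{i+1+m}$ where only
  -- $2^{i+1}$ is needed, which turns $\theta^m$ into $(\theta/2)^m$.
  calc 1 / t * (I t / t) ≤ 2 * 2 ^ (i + 1) * (2 * w (i + 1)) := by
        refine mul_le_mul hti hWt (div_nonneg (hI.nonneg ⟨ht.1.le, by linarith [ht.2]⟩)
          ht.1.le) (by positivity)
    _ ≤ 2 * 2 ^ (i + 1) * (2 * (M * θ ^ m * w (i + 1 + m))) := by
        gcongr
        exact hgrow _ _
    _ = _ := by rw [div_pow, pow_add _ (i + 1) m]; field_simp; ring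

theorem exists_lsNorm_le_of_integralCondition (hIm : Measurable I) (X : RISpace μ)
    (hc : HasIntegralCondition I) :
    ∃ K : ℝ≥0, ∀ f : Ω → ℝ, IsLip f → (∀ x, 0 ≤ f x) → ∫⁻ x, ‖f x‖ₑ ∂μ ≠ ∞ →
      X.lsNorm I f ≤ K * (X.norm (gradNorm f) + ∫⁻ x, ‖f x‖ₑ ∂μ) := by
  have := hΩ.probability
  have hμ := hΩ.exists_uniform
  obtain ⟨M, θ, hM, hθ, hθ1, hgrow⟩ := HasIntegralCondition.exists_dyadic_growth hI hc
  set N : ℝ≥0 := (X.norm fun _ => 1).toNNReal with hN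
  have hNe : (N : ℝ≥0∞) = X.norm fun _ => 1 := ENNReal.coe_toNNReal X.norm_one.ne
  -- For $t\ge1/2$ one has $f^{**}(t)\le2\|f\|_{L^1}$ and $I(t)/t\le2I(1/2)$.
  set b : ℝ≥0 := Real.toNNReal (4 * I (1 / 2)) with hb
  have hgeo : (1 - ENNReal.ofReal θ)⁻¹ ≠ ∞ :=
    ENNReal.inv_ne_top.2 (tsub_pos_of_lt (by simpa using hθ1)).ne'
  set A : ℝ≥0 := Real.toNNReal (4 * M) * ((1 - ENNReal.ofReal θ)⁻¹).toNNReal with hA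
  have hAe : (A : ℝ≥0∞) = ENNReal.ofReal (4 * M) * (1 - ENNReal.ofReal θ)⁻¹ := by
    rw [hA, ENNReal.coe_mul, ENNReal.coe_toNNReal hgeo]; rfl
  refine ⟨A + b * N, fun f hf h0 hL1 => ?_⟩
  set F : Ω → ℝ≥0∞ := fun x => ‖f x‖ₑ with hF
  have hFm : Measurable F := hf.continuous.measurable.enorm
  set ℓ : ℝ≥0 := (∫⁻ x, F x ∂μ).toNNReal with hℓ
  have hℓe : ∫⁻ x, F x ∂μ = ℓ := (ENNReal.coe_toNNReal hL1).symm
  set B := compress (bandAverage μ F (gradNorm f)) with hBdef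
  have hBm : Measurable B := measurable_compress (measurable_bandAverage F _)
  have hB : X.bar B ≤ X.norm (gradNorm f) := (X.bar_compress_le hμ).trans
    (X.bar_bandAverage_le hμ hFm (measurable_gradNorm hf.continuous))
  set a : ℕ → ℝ≥0 := fun m => Real.toNNReal (4 * M * (θ / 2) ^ m) with ha
  have hterm : ∀ m : ℕ, Measurable fun t : ℝ => (a m : ℝ≥0∞) * B (t / 2 ^ m) := fun m =>
    (hBm.comp (measurable_id.div_const _)).const_mul _
  have hpt : ∀ t ∈ Ioo (0 : ℝ) 1, (rearrAvg μ F t - rearr μ F t) * ENNReal.ofReal (I t / t) ≤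
      (∑' m : ℕ, (a m : ℝ≥0∞) * B (t / 2 ^ m)) + (b * ℓ : ℝ≥0) := by
    intro t ht
    rcases lt_or_ge t (1 / 2) with h | h
    · exact (rearrAvg_sub_mul_le_tsum hΩ hI hM hθ hgrow hf h0 ⟨ht.1, h⟩).trans le_self_add
    · refine le_trans ?_ le_add_self
      have h1 : rearrAvg μ F t - rearr μ F t ≤ ENNReal.ofReal 2 * ℓ := by
        refine tsub_le_self.trans ((rearrAvg_le hFm ht.2.le).trans ?_)
        rw [hℓe, ENNReal.div_eq_inv_mul, ← ENNReal.ofReal_inv_of_pos ht.1]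
        gcongr
        rw [inv_le_comm₀ ht.1 two_pos]
        linarith
      have h2 : I t / t ≤ 2 * I (1 / 2) := by
        rw [div_le_iff₀ ht.1]
        have h3 := hI.le_half (Ioo_subset_Icc_self ht)
        have h4 := hI.nonneg (Ioo_subset_Icc_self ht)
        nlinarith
      calc _ ≤ ENNReal.ofReal 2 * ℓ * ENNReal.ofReal (2 * I (1 / 2)) := by gcongr
        _ = (b * ℓ : ℝ≥0) := by
          rw [mul_right_comm, ← ENNReal.ofReal_mul zero_le_two, ENNReal.coe_mul, hb,
            ENNReal.ofReal]
          ring_nf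
  have hδm : Measurable fun t => (rearrAvg μ F t - rearr μ F t) * ENNReal.ofReal (I t / t) :=
    ((measurable_rearrAvg F).sub (measurable_rearr F)).mul (hIm.div measurable_id).ennreal_ofReal
  calc X.lsNorm I f
      ≤ X.bar (fun t => (∑' m : ℕ, (a m : ℝ≥0∞) * B (t / 2 ^ m)) + (b * ℓ : ℝ≥0)) :=
        X.bar_mono hμ hδm ((Measurable.tsum hterm).add measurable_const) hpt
    _ ≤ (∑' m : ℕ, X.bar fun t => (a m : ℝ≥0∞) * B (t / 2 ^ m)) + (b * ℓ : ℝ≥0) * N := by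
        refine (X.bar_add hμ (Measurable.tsum hterm) measurable_const).trans ?_
        rw [X.bar_const hμ, ← hNe]
        exact add_le_add_left (X.bar_tsum_le hμ hterm) _
    _ ≤ (∑' m : ℕ, ENNReal.ofReal (4 * M) * (ENNReal.ofReal θ ^ m * X.norm (gradNorm f))) +
          (b * ℓ : ℝ≥0) * N := by
        refine add_le_add_left (ENNReal.tsum_le_tsum fun m => ?_) _
        -- The dilation by $2^m$ costs $2^m$, which against $(\theta/2)^m$ leaves the summable
        -- $\theta^m$.
        rw [X.bar_smul hμ (a m) (h := fun t => B (t / 2 ^ m)) (hBm.comp (measurable_id.div_const _))]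
        calc (a m : ℝ≥0∞) * X.bar (fun t => B (t / 2 ^ m))
            ≤ a m * (2 ^ m * X.norm (gradNorm f)) :=
              mul_le_mul_right ((X.bar_comp_div_pow_le hμ hBm m).trans (mul_le_mul_right hB _)) _
          _ = _ := by
              have e : (a m : ℝ≥0∞) * 2 ^ m = ENNReal.ofReal (4 * M) * ENNReal.ofReal θ ^ m := by
                have e2 : (2 : ℝ≥0∞) ^ m = ENNReal.ofReal (2 ^ m) := by
                  rw [ENNReal.ofReal_pow zero_le_two, ENNReal.ofReal_ofNat]
                have e3 : (a m : ℝ≥0∞) = ENNReal.ofReal (4 * M * (θ / 2) ^ m) := rfl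
                rw [e2, e3, ← ENNReal.ofReal_mul (by positivity), ← ENNReal.ofReal_pow hθ,
                  ← ENNReal.ofReal_mul (by positivity), div_pow]
                congr 1
                field_simp
              rw [← mul_assoc, e, mul_assoc]
    _ = A * X.norm (gradNorm f) + b * N * ℓ := by
        rw [ENNReal.tsum_mul_left, ENNReal.tsum_mul_right, ENNReal.tsum_geometric, hAe]
        push_cast
        ring
    _ ≤ _ := by
        rw [hℓe]
        have : ((A + b * N : ℝ≥0) : ℝ≥0∞) * (X.norm (gradNorm f) + ℓ) =
          (A * X.norm (gradNorm f) + b * N * ℓ) + (A * ℓ + b * N * X.norm (gradNorm f)) := by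
            push_cast; ring
        rw [this]
        exact le_self_add

end

/-! ### Independence of the values of $I$ outside $(0,1)$. -/

section Transfer

variable {Ω : Type*} [MeasurableSpace Ω] {μ : Measure Ω}

theorem RISpace.bar_congr_Ioo (X : RISpace μ) {h k : ℝ → ℝ≥0∞} (e : ∀ s ∈ Ioo (0 : ℝ) 1, h s = k s) :
    X.bar h = X.bar k := by
  refine X.bar_congr_distr fun t => ?_
  rw [unitVol_apply, unitVol_apply]
  congr 1
  ext s
  simp only [mem_inter_iff, mem_ofPred_eq]
  exact and_congr_left fun hs => by rw [e s hs]

variable {I J : ℝ → ℝ} (hIJ : EqOn I J (Ioo 0 1))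
include hIJ

theorem hardyQ_congr (f : ℝ → ℝ≥0∞) {t : ℝ} (ht : 0 ≤ t) : hardyQ I f t = hardyQ J f t :=
  setLIntegral_congr_fun measurableSet_Ioo fun s hs => by
    simp only [hIJ ⟨ht.trans_lt hs.1, hs.2⟩]

theorem hardyQTilde_congr (f : ℝ → ℝ≥0∞) {t : ℝ} (ht : t ∈ Ioo (0 : ℝ) 1) :
    hardyQTilde I f t = hardyQTilde J f t := by
  rw [hardyQTilde, hardyQTilde, hIJ ht]
  congr 1
  exact setLIntegral_congr_fun measurableSet_Ioo fun s hs => by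
    simp only [hIJ ⟨ht.1.trans hs.1, by linarith [hs.2]⟩]

theorem RISpace.weightedNorm_congr (X : RISpace μ) (u : Ω → ℝ) :
    X.weightedNorm I u = X.weightedNorm J u :=
  X.bar_congr_Ioo fun t ht => by rw [hIJ ht]

theorem RISpace.lsNorm_congr (X : RISpace μ) (u : Ω → ℝ) : X.lsNorm I u = X.lsNorm J u :=
  X.bar_congr_Ioo fun t ht => by rw [hIJ ht]

theorem HasIntegralCondition.congr (h : HasIntegralCondition I) : HasIntegralCondition J := by
  obtain ⟨c, hc, h⟩ := h
  refine ⟨c, hc, fun t ht => ?_⟩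
  rw [← hIJ ht]
  refine le_trans (le_of_eq ?_) (h t ht)
  rw [intervalIntegral.integral_of_le ht.2.le, intervalIntegral.integral_of_le ht.2.le,
    integral_Ioc_eq_integral_Ioo, integral_Ioc_eq_integral_Ioo]
  exact setIntegral_congr_fun measurableSet_Ioo fun s hs => by
    simp only [hIJ ⟨ht.1.trans hs.1, hs.2⟩]

end Transfer

/-! ### The gradient bound in part (b). -/

section

variable {Ω : Type*} [MetricSpace Ω] [MeasurableSpace Ω] [BorelSpace Ω] {μ : Measure Ω} {I : ℝ → ℝ}
variable (hΩ : IsMetricProbabilitySpace μ) (hI : IsIsoperimetricEstimator μ I)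
include hΩ hI

theorem exists_lsNorm_le (hIm : Measurable I) (X : RISpace μ)
    (h : X.upperBoydIndex < 1 ∨ HasIntegralCondition I) :
    ∃ K : ℝ≥0, ∀ f : Ω → ℝ, IsLip f → (∀ x, 0 ≤ f x) → ∫⁻ x, ‖f x‖ₑ ∂μ ≠ ∞ →
      X.norm (gradNorm f) ≠ ∞ →
      X.lsNorm I f ≤ K * (X.norm (gradNorm f) + ∫⁻ x, ‖f x‖ₑ ∂μ) := by
  have := hΩ.probability
  have hμ := hΩ.exists_uniform
  rcases h with h | h
  · obtain ⟨K, hK⟩ := X.exists_bar_rearrAvg_le hμ h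
    refine ⟨K, fun f hf h0 _ hfin => ?_⟩
    have hδm : Measurable fun t => (rearrAvg μ (fun x => ‖f x‖ₑ) t -
        rearr μ (fun x => ‖f x‖ₑ) t) * ENNReal.ofReal (I t / t) :=
      ((measurable_rearrAvg _).sub (measurable_rearr _)).mul (hIm.div measurable_id).ennreal_ofReal
    calc X.lsNorm I f ≤ X.bar (rearrAvg μ (gradNorm f)) :=
          X.bar_mono hμ hδm (measurable_rearrAvg _) fun t ht => rearrAvg_sub_mul_le hΩ hI hf h0 ht
      _ ≤ K * X.norm (gradNorm f) := hK _ (measurable_gradNorm hf.continuous) hfin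
      _ ≤ _ := mul_le_mul_right le_self_add _
  · obtain ⟨K, hK⟩ := exists_lsNorm_le_of_integralCondition hΩ hI hIm X h
    exact ⟨K, fun f hf h0 hL1 _ => hK f hf h0 hL1⟩

/-- The estimate for nonnegative functions needs no vanishing set, so it applies directly to
$|g-\int g|$, whose gradient is no larger than that of $g$; the Poincaré inequality supplies the
$L^1$ term. -/
theorem exists_lsNorm_centered_le (hIm : Measurable I) (X Y : RISpace μ)
    (hQ : ∃ C : ℝ≥0, ∀ f : ℝ → ℝ≥0∞, Measurable f → Function.support f ⊆ Ioo 0 (1 / 2) →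
      X.bar f < ∞ → Y.bar (hardyQ I f) ≤ C * X.bar f)
    (h : X.upperBoydIndex < 1 ∨ HasIntegralCondition I) :
    ∃ K : ℝ≥0, ∀ g : Ω → ℝ, IsLip g → Integrable g μ →
      X.lsNorm I (centered μ g) + ∫⁻ x, ‖centered μ g x‖ₑ ∂μ ≤ K * X.norm (gradNorm g) := by
  have := hΩ.probability
  obtain ⟨P, hP0, hP⟩ := exists_poincare hΩ hI X Y hQ
  obtain ⟨L, hL⟩ := exists_lsNorm_le hΩ hI hIm X h
  refine ⟨L * (1 + P) + P, fun g hg hgi => ?_⟩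
  rcases eq_or_ne (X.norm (gradNorm g)) ∞ with htop | hfin
  · rw [htop, ENNReal.mul_top (by exact_mod_cast (add_pos_of_nonneg_of_pos zero_le hP0).ne')]
    exact le_top
  set φ : ℝ → ℝ := fun y => |y - ∫ x, g x ∂μ| with hφdef
  have hφ : LipschitzWith 1 φ := by
    refine LipschitzWith.of_dist_le_mul fun a b => ?_
    rw [NNReal.coe_one, one_mul, Real.dist_eq, Real.dist_eq]
    refine (abs_abs_sub_abs_le _ _).trans (le_of_eq ?_)
    congr 1; ring
  have hf : IsLip (φ ∘ g) := hg.comp_lipschitz hφ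
  have henorm : ∀ x, ‖(φ ∘ g) x‖ₑ = ‖centered μ g x‖ₑ := fun x => by
    simp only [φ, Function.comp, centered, Real.enorm_abs]
  have hgrad : X.norm (gradNorm (φ ∘ g)) ≤ X.norm (gradNorm g) :=
    X.norm_mono _ _ (measurable_gradNorm hf.continuous).aemeasurable
      (measurable_gradNorm hg.continuous).aemeasurable
      (Eventually.of_forall fun x => gradNorm_comp_le hφ x)
  have hL1 : ∫⁻ x, ‖centered μ g x‖ₑ ∂μ ≤ P * X.norm (gradNorm g) := ((hP g hg).2 hgi).2.1
  have h1 := hL (φ ∘ g) hf (fun x => abs_nonneg _) (by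
    simp only [henorm]
    exact ne_top_of_le_ne_top (ENNReal.mul_ne_top ENNReal.coe_ne_top hfin) hL1)
    (ne_top_of_le_ne_top hfin hgrad)
  simp only [RISpace.lsNorm, henorm] at h1
  calc X.lsNorm I (centered μ g) + ∫⁻ x, ‖centered μ g x‖ₑ ∂μ
      ≤ L * (X.norm (gradNorm g) + P * X.norm (gradNorm g)) + P * X.norm (gradNorm g) :=
        add_le_add (h1.trans (mul_le_mul_right (add_le_add hgrad hL1) _)) hL1
    _ = _ := by push_cast; ring

end

end

theorem mainTheorem2 {Ω : Type*} [MetricSpace Ω] [MeasurableSpace Ω] [BorelSpace Ω]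
    (μ : Measure Ω) (hΩ : IsMetricProbabilitySpace μ)
    (I : ℝ → ℝ) (hI : IsIsoperimetricEstimator μ I)
    (X Y : RISpace μ)
    (hQ : ∃ C : ℝ≥0, ∀ f : ℝ → ℝ≥0∞, Measurable f → Function.support f ⊆ Ioo 0 (1 / 2) →
      X.bar f < ∞ → Y.bar (hardyQ I f) ≤ C * X.bar f) :
    -- functions with gradient in `X` are integrable, so that their mean is defined
    (∀ g : Ω → ℝ, IsLip g → X.norm (gradNorm g) < ∞ → Integrable g μ) ∧
    -- the Poincaré inequality
    (∃ K : ℝ≥0, ∀ g : Ω → ℝ, IsLip g → Integrable g μ →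
      Y.fnNorm (centered μ g) ≤ K * X.norm (gradNorm g)) ∧
    -- (a)
    ((∃ C : ℝ≥0, ∀ f : ℝ → ℝ≥0∞, Measurable f → X.bar f < ∞ →
        X.bar (hardyQTilde I f) ≤ C * X.bar f) →
      ∃ K : ℝ≥0, ∀ g : Ω → ℝ, IsLip g → Integrable g μ →
        Y.fnNorm (centered μ g) ≤ K * X.weightedNorm I (centered μ g) ∧
        X.weightedNorm I (centered μ g) ≤ K * X.norm (gradNorm g)) ∧
    -- (b)
    (X.upperBoydIndex < 1 ∨ HasIntegralCondition I →
      ∃ K : ℝ≥0, ∀ g : Ω → ℝ, IsLip g → Integrable g μ →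
        Y.fnNorm (centered μ g) ≤
          K * (X.lsNorm I (centered μ g) + ∫⁻ x, ‖centered μ g x‖ₑ ∂μ) ∧
        X.lsNorm I (centered μ g) + ∫⁻ x, ‖centered μ g x‖ₑ ∂μ ≤
          K * X.norm (gradNorm g)) := by
  -- The weighted functions must be measurable on $\mathbb R$, and $I$ is controlled only on
  -- $[0,1]$; its extension by zero leaves all operators and norms unchanged.
  set J : ℝ → ℝ := (Icc 0 1).indicator I with hJ
  have hIJ : EqOn I J (Ioo 0 1) := fun t ht =>
    (indicator_of_mem (Ioo_subset_Icc_self ht) I).symm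
  have hJm : Measurable J := hI.measurable_indicator
  have hQJ : ∃ C : ℝ≥0, ∀ f : ℝ → ℝ≥0∞, Measurable f → Function.support f ⊆ Ioo 0 (1 / 2) →
      X.bar f < ∞ → Y.bar (hardyQ J f) ≤ C * X.bar f := by
    obtain ⟨C, hC⟩ := hQ
    refine ⟨C, fun f hf hs hfin => le_trans (le_of_eq ?_) (hC f hf hs hfin)⟩
    exact Y.bar_congr_Ioo fun t ht => (hardyQ_congr hIJ f ht.1.le).symm
  have hmeas : ∀ g : Ω → ℝ, IsLip g → Measurable (centered μ g) := fun g hg =>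
    hg.continuous.measurable.sub_const _
  obtain ⟨P, -, hP⟩ := exists_poincare hΩ hI X Y hQ
  refine ⟨fun g hg => (hP g hg).1, ⟨P, fun g hg hgi => ((hP g hg).2 hgi).1⟩, fun hQ' => ?_,
    fun h => ?_⟩
  · have hQJ' : ∃ C : ℝ≥0, ∀ f : ℝ → ℝ≥0∞, Measurable f → X.bar f < ∞ →
        X.bar (hardyQTilde J f) ≤ C * X.bar f := by
      obtain ⟨C, hC⟩ := hQ'
      refine ⟨C, fun f hf hfin => le_trans (le_of_eq ?_) (hC f hf hfin)⟩
      exact X.bar_congr_Ioo fun t ht => (hardyQTilde_congr hIJ f ht).symm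
    obtain ⟨K₁, hK₁⟩ := exists_fnNorm_le_weightedNorm hΩ hI.indicator hJm X Y hQJ
    obtain ⟨K₂, hK₂⟩ := exists_weightedNorm_le hΩ hI.indicator hJm X Y hQJ hQJ'
    refine ⟨K₁ + K₂, fun g hg hgi => ?_⟩
    rw [X.weightedNorm_congr hIJ, ENNReal.coe_add]
    exact ⟨(hK₁ _ (hmeas g hg)).trans (mul_le_mul_left le_self_add _),
      (hK₂ g hg hgi).trans (mul_le_mul_left le_add_self _)⟩
  · obtain ⟨K₁, hK₁⟩ := exists_fnNorm_le_lsNorm hΩ hI.indicator hJm X Y hQJ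
    obtain ⟨K₂, hK₂⟩ := exists_lsNorm_centered_le hΩ hI.indicator hJm X Y hQJ
      (h.imp_right fun h => h.congr hIJ)
    refine ⟨K₁ + K₂, fun g hg hgi => ?_⟩
    rw [X.lsNorm_congr hIJ, ENNReal.coe_add]
    exact ⟨(hK₁ _ (hmeas g hg)).trans (mul_le_mul_left le_self_add _),
      (hK₂ g hg hgi).trans (mul_le_mul_left le_add_self _)⟩
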